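/- For real numbers $a_1\le a_2\le a_3\le a_4$ and $\mu>0$ let $L=\theta^4-\mu^{-1}z\prod_{k=1}^4(\theta+a_k)$, $\theta=z\frac{d}{dz}$, and consider the five families with the following data. | family | $(a_1,a_2,a_3,a_4)$ | $1/\mu$ | $\kappa$ | $c_2\cdot D$ | $\chi$ | |---|---|---|---|---|---| | $X_5$ (mirror quintic) | $(\frac15,\frac25,\frac35,\frac45)$ | $5^5$ | $5$ | $50$ | $-200$ | | $X_{4,3}$ | $(\frac14,\frac13,\frac23,\frac34)$ | $2^63^3$ | $6$ | $48$ | $-156$ | | $X_{4,2}$ | $(\frac14,\frac12,\frac12,\frac34)$ | $2^{10}$ | $8$ | $56$ | $-176$ | | $X_{4,4}$ | $(\frac14,\frac14,\frac34,\frac34)$ | $2^{12}$ | $4$ | $40$ | $-144$ | | $X_{2,2,2,2}$ | $(\frac12,\frac12,\frac12,\frac12)$ | $2^8$ | $16$ | $64$ | $-128$ | All powers and logarithms are principal branches; put $\sigma=(\kappa \bmod 2)/2$. *Basis at $z=0$.* There is a Frobenius basis $\Pi_0=(\Pi_{0,0},\dots,\Pi_{0,3})^T$ of solutions of $L$ on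 $\{0<|z|<\mu\}\setminus(-\infty,0]$, $\Pi_{0,n}=\sum_{j=0}^n f_j(z)\frac{\log^{n-j}z}{(n-j)!}$ with power series $f_j$ convergent for $|z|<\mu$, $f_0(0)=1$, $f_1(0)=f_2(0)=f_3(0)=0$. The integral symplectic basis is $$\Pi=(2\pi i)^3\begin{pmatrix}\frac{\zeta(3)\chi}{(2\pi i)^3}&\frac{c_2\cdot D}{24\cdot 2\pi i}&0&\frac{\kappa}{(2\pi i)^3}\\ \frac{c_2\cdot D}{24}&\frac{\sigma}{2\pi i}&-\frac{\kappa}{(2\pi i)^2}&0\\1&0&0&0\\0&\frac1{2\pi i}&0&0\end{pmatrix}\Pi_0 .$$ *Basis at $z=\infty$.* For the quintic, $\Pi_\infty=(\omega_1,\dots,\omega_4)^T$ with $w=1/z$ and $\omega_k=w^{k/5}\sum_{n\ge0}\frac{(k/5)_n^5}{(k)_{5n}}w^n$; these are solutions of $L$ on $\{|z|>\mu\}\setminus(-\infty,0]$. For the others use the local coordinate $x=\frac1z$ for $X_{4,3}$, $x=\frac1{2^{12}z}$ for $X_{4,2}$, $x=\frac1{2^{20}z}$ for $X_{4,4}$,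 $x=\frac1{2^{16}z}$ for $X_{2,2,2,2}$. For each distinct exponent $a$ of multiplicity $m$ there are solutions $l^a_n=x^a\sum_{j=0}^n g^a_j(x)\frac{\log^{n-j}x}{(n-j)!}$, $0\le n<m$, of $L$ on the same domain, with $g^a_j$ holomorphic for $|x|<x(\mu)$, $g^a_0(0)=1$, $g^a_j(0)=0$ for $j\ge1$. The vector $\Pi_\infty$ consists of all these $l^a_n$, ordered by increasing $a$ and, for equal $a$, by increasing $n$. *Claim.* Continue $\Pi$ analytically from $|z|<\mu$ to $|z|>\mu$ within the lower half-plane $\operatorname{Im}z<0$ for the quintic, and within the upper half-plane $\operatorname{Im}z>0$ for the four other families. Then in each case there is exactly one matrix $T_\infty$ with $\Pi=T_\infty\Pi_\infty$ on the part $|z|>\mu$ of the half-plane; it is invertible, and $(2\pi i)^3\,T_\infty^{-1}$ is the following matrix. (1) $X_5$, with $\alpha=e^{2\pi i/5}$, $(c_1,c_2,c_3,c_4)=(16,16,32,96)$: the $k$-th row, $k=1,\dots,4$, is $$\frac{c_k\pi^4}{\Gamma(\frac k5)^5}\left(-\frac{\alpha^k}{\alpha^k-1},\ -\frac{\alpha^k}{(\alpha^k-1)^2},\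 -1,\ \frac{\alpha^k(2\alpha^k+3)}{(1-\alpha^k)^3}\right).$$ (2) $X_{4,3}$: $$\begin{pmatrix} \frac{8(1+i)\sqrt2\pi^{9/2}}{\Gamma(\frac14)^6}&\frac{8\sqrt2\pi^{9/2}}{\Gamma(\frac14)^6}&-\frac{16\sqrt2\pi^{9/2}}{\Gamma(\frac14)^6}&-\frac{24i\sqrt2\pi^{9/2}}{\Gamma(\frac14)^6}\\ \frac{4e^{\pi i/6}2^{2/3}\pi^{5/2}}{\sqrt3\,\Gamma(\frac16)\Gamma(\frac13)}&\frac{4\cdot2^{2/3}\pi^{5/2}}{3\Gamma(\frac16)\Gamma(\frac13)}&-\frac{4\cdot2^{2/3}\pi^{5/2}}{\Gamma(\frac16)\Gamma(\frac13)}&-\frac{4i2^{2/3}\pi^{5/2}}{\sqrt3\,\Gamma(\frac16)\Gamma(\frac13)}\\ -\frac{80e^{5\pi i/6}\pi^3}{3\Gamma(\frac23)^3}&\frac{80\pi^3}{3\sqrt3\,\Gamma(\frac23)^3}&-\frac{80\pi^3}{\sqrt3\,\Gamma(\frac23)^3}&\frac{80i\pi^3}{3\Gamma(\frac23)^3}\\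 \frac{10(1-i)\sqrt2\pi^{9/2}}{\Gamma(\frac34)^6}&\frac{10\sqrt2\pi^{9/2}}{\Gamma(\frac34)^6}&-\frac{20\sqrt2\pi^{9/2}}{\Gamma(\frac34)^6}&\frac{30i\sqrt2\pi^{9/2}}{\Gamma(\frac34)^6} \end{pmatrix}$$ (3) $X_{4,2}$: $$\begin{pmatrix} \frac{e^{\pi i/4}\sqrt2\pi^{9/2}}{\Gamma(\frac14)^6}&\frac{\pi^{9/2}}{\Gamma(\frac14)^6}&-\frac{2\pi^{9/2}}{\Gamma(\frac14)^6}&-\frac{4i\pi^{9/2}}{\Gamma(\frac14)^6}\\ \frac\pi8&\frac\pi{16}&-\frac\pi4&0\\ \frac18(4-i\pi)\pi&\frac\pi4&-\pi&\frac{i\pi^2}4\\ \frac{(1-i)\pi^{9/2}}{64\Gamma(\frac34)^6}&\frac{\pi^{9/2}}{64\Gamma(\frac34)^6}&-\frac{\pi^{9/2}}{32\Gamma(\frac34)^6}&\frac{i\pi^{9/2}}{16\Gamma(\frac34)^6} \end{pmatrix}$$ (4) $X_{4,4}$: $$\begin{pmatrix} \frac{(1+i)\pi^3}{4\Gamma(\frac14)^4}&\frac{\pi^3}{4\Gamma(\frac14)^4}&-\frac{\pi^3}{2\Gamma(\frac14)^4}&-\frac{i\pi^3}{2\Gamma(\frac14)^4}\\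 \frac{\pi^4}{2\Gamma(\frac14)^4}&0&-\frac{\pi^4}{\Gamma(\frac14)^4}&\frac{i\pi^4}{\Gamma(\frac14)^4}\\ \frac{(1-i)\pi^3}{256\Gamma(\frac34)^4}&\frac{\pi^3}{256\Gamma(\frac34)^4}&-\frac{\pi^3}{128\Gamma(\frac34)^4}&\frac{i\pi^3}{128\Gamma(\frac34)^4}\\ \frac{((2-2i)-\pi)\pi^3}{128\Gamma(\frac34)^4}&\frac{\pi^3}{64\Gamma(\frac34)^4}&\frac{(\pi-2)\pi^3}{64\Gamma(\frac34)^4}&\frac{i\pi^3(2+\pi)}{64\Gamma(\frac34)^4} \end{pmatrix}$$ (5) $X_{2,2,2,2}$: $$\begin{pmatrix} \frac1{32}&\frac1{64}&-\frac1{16}&0\\ -\frac{i\pi}{32}&0&0&\frac{i\pi}8\\ -\frac{\pi^2}{48}&\frac{\pi^2}{192}&\frac{\pi^2}{24}&0\\ \frac{\zeta(3)}4+\frac{i\pi^3}{96}&\frac{\zeta(3)}8&-\frac{\zeta(3)}2&\frac{i\pi^3}{12} \end{pmatrix}$$ -/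

import Mathlib

namespace CYPeriods

section

open scoped Real

/-- Numerical data of a hypergeometric one-parameter family: the exponents `a_k` and the conifold
point `mu` of its Picard-Fuchs operator, and the numbers `κ = D³`, `c₂ · D` and `χ` of the mirror. -/
structure Model where
  a : Fin 4 → ℝ
  mu : ℝ
  kappa : ℕ
  c2D : ℕ
  chi : ℤ

noncomputable def modelX5 : Model where
  a := ![1 / 5, 2 / 5, 3 / 5, 4 / 5]
  mu := 1 / 5 ^ 5
  kappa := 5
  c2D := 50
  chi := -200

noncomputable def modelX43 : Model where
  a := ![1 / 4, 1 / 3, 2 / 3, 3 / 4]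
  mu := 1 / (2 ^ 6 * 3 ^ 3)
  kappa := 6
  c2D := 48
  chi := -156

noncomputable def modelX42 : Model where
  a := ![1 / 4, 1 / 2, 1 / 2, 3 / 4]
  mu := 1 / 2 ^ 10
  kappa := 8
  c2D := 56
  chi := -176

noncomputable def modelX44 : Model where
  a := ![1 / 4, 1 / 4, 3 / 4, 3 / 4]
  mu := 1 / 2 ^ 12
  kappa := 4
  c2D := 40
  chi := -144

noncomputable def modelX2222 : Model where
  a := ![1 / 2, 1 / 2, 1 / 2, 1 / 2]
  mu := 1 / 2 ^ 8
  kappa := 16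
  c2D := 64
  chi := -128

/-- The operator `θ + c`, with `θ = z d/dz`. -/
noncomputable def thetaAdd (c : ℂ) (f : ℂ → ℂ) : ℂ → ℂ :=
  fun z => z * deriv f z + c * f z

/-- The Picard-Fuchs operator `θ⁴ - μ⁻¹ z (θ + a₁)(θ + a₂)(θ + a₃)(θ + a₄)`. -/
noncomputable def picardFuchs (M : Model) (f : ℂ → ℂ) : ℂ → ℂ :=
  fun z => (thetaAdd 0)^[4] f z -
    (M.mu : ℂ)⁻¹ * z *
      thetaAdd (M.a 0) (thetaAdd (M.a 1) (thetaAdd (M.a 2) (thetaAdd (M.a 3) f))) z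

/-- `f` is a holomorphic solution of the Picard-Fuchs equation on the open set `U`. -/
def IsSolutionOn (M : Model) (U : Set ℂ) (f : ℂ → ℂ) : Prop :=
  DifferentiableOn ℂ f U ∧ ∀ z ∈ U, picardFuchs M f z = 0

/-- The expression `x ^ ρ * ∑_{j ≤ n} g_j(x) (log x) ^ (n - j) / (n - j)!`, with principal
branches of the power and of the logarithm. -/
noncomputable def logSeries (ρ : ℝ) (g : ℕ → ℂ → ℂ) (n : ℕ) (x : ℂ) : ℂ :=
  x ^ (ρ : ℂ) *
    ∑ j ∈ Finset.range (n + 1), g j x * Complex.log x ^ (n - j) / ((n - j).factorial : ℂ)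

/-- `B` is a normalized Frobenius basis on `U` in the local coordinate `x`: its `i`-th member
solves the Picard-Fuchs equation on `U` and has there the exponent `ρ i` and the leading
logarithm `(log x) ^ n i / (n i)!`. The power series `g ρ j`, which converge for `|x| < r`,
depend only on the exponent `ρ`; they satisfy `g ρ 0 = 1 + O(x)`, and `g ρ j = O(x)` for `j ≥ 1`. -/
def IsFrobeniusBasis (M : Model) (U : Set ℂ) (x : ℂ → ℂ) (r : ℝ) (ρ : Fin 4 → ℝ) (n : Fin 4 → ℕ)
    (B : Fin 4 → ℂ → ℂ) : Prop :=
  ∃ g : ℝ → ℕ → ℂ → ℂ,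
    (∀ s j, DifferentiableOn ℂ (g s j) (Metric.ball 0 r)) ∧
    (∀ s, g s 0 0 = 1) ∧
    (∀ s j, 1 ≤ j → g s j 0 = 0) ∧
    ∀ i, IsSolutionOn M U (B i) ∧ ∀ z ∈ U, B i z = logSeries (ρ i) (g (ρ i)) (n i) (x z)

/-- The Frobenius basis at the point `z = 0` of maximal unipotent monodromy. -/
def IsBasisAtZero (M : Model) (B : Fin 4 → ℂ → ℂ) : Prop :=
  IsFrobeniusBasis M {z | z ∈ Complex.slitPlane ∧ ‖z‖ < M.mu} (fun z => z) M.mu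
    ![0, 0, 0, 0] ![0, 1, 2, 3] B

/-- The normalized basis at `z = ∞` in the local coordinate `x = lam / z`, its members ordered by
the exponents `a₁ ≤ a₂ ≤ a₃ ≤ a₄` and having the orders `n` in the logarithm. -/
def IsBasisAtInfinity (M : Model) (lam : ℝ) (n : Fin 4 → ℕ) (B : Fin 4 → ℂ → ℂ) : Prop :=
  IsFrobeniusBasis M {z | z ∈ Complex.slitPlane ∧ M.mu < ‖z‖} (fun z => (lam : ℂ) / z)
    (lam / M.mu) M.a n B

/-- `σ = (κ mod 2) / 2`. -/
noncomputable def sigma (M : Model) : ℂ := ((M.kappa % 2 : ℕ) : ℂ) / 2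

/-- The number `2πi`. -/
noncomputable def twoPiI : ℂ := 2 * π * Complex.I

/-- The matrix which expresses the integral symplectic basis of periods in the Frobenius basis
at `z = 0`. -/
noncomputable def periodMatrix (M : Model) : Matrix (Fin 4) (Fin 4) ℂ :=
  twoPiI ^ 3 •
    !![riemannZeta 3 * M.chi / twoPiI ^ 3, M.c2D / (24 * twoPiI), 0, M.kappa / twoPiI ^ 3;
       M.c2D / 24, sigma M / twoPiI, -M.kappa / twoPiI ^ 2, 0;
       1, 0, 0, 0;
       0, 1 / twoPiI, 0, 0]

/-- `T` relates the integral basis of periods at `z = 0` (given there by `periodMatrix M` and the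
Frobenius basis `B₀`) to the basis `Binf` at `z = ∞`: the periods have analytic continuations `P`
from `{z ∈ H | |z| < μ}` to all of `H`, and `P = T Binf` on `{z ∈ H | μ < |z|}`. -/
def IsTransitionMatrix (M : Model) (H : Set ℂ) (B₀ Binf : Fin 4 → ℂ → ℂ)
    (T : Matrix (Fin 4) (Fin 4) ℂ) : Prop :=
  ∃ P : Fin 4 → ℂ → ℂ,
    (∀ i, DifferentiableOn ℂ (P i) H) ∧
    (∀ z ∈ H, ‖z‖ < M.mu → (fun i => P i z) = (periodMatrix M).mulVec (fun i => B₀ i z)) ∧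
    (∀ z ∈ H, M.mu < ‖z‖ → (fun i => P i z) = T.mulVec (fun i => Binf i z))

/-- There is exactly one transition matrix `T`; it is invertible, with inverse `S`. -/
def HasInverseTransitionMatrix (M : Model) (H : Set ℂ) (B₀ Binf : Fin 4 → ℂ → ℂ)
    (S : Matrix (Fin 4) (Fin 4) ℂ) : Prop :=
  ∃ T : Matrix (Fin 4) (Fin 4) ℂ,
    IsTransitionMatrix M H B₀ Binf T ∧
    (∀ T', IsTransitionMatrix M H B₀ Binf T' → T' = T) ∧
    IsUnit T ∧ T⁻¹ = S

def upperHalf : Set ℂ := {z | 0 < z.im}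

def lowerHalf : Set ℂ := {z | z.im < 0}

/-- The solutions `ω_k = w ^ (k/5) ∑ ((k/5)_n)⁵ / (k)_{5n} wⁿ`, `w = 1 / z`, of the mirror quintic,
where `k = i + 1`. -/
noncomputable def omega (i : Fin 4) (z : ℂ) : ℂ :=
  (z⁻¹) ^ (((i : ℕ) + 1 : ℂ) / 5) *
    ∑' n : ℕ, ((ascPochhammer ℂ n).eval (((i : ℕ) + 1 : ℂ) / 5)) ^ 5 /
      (ascPochhammer ℂ (5 * n)).eval ((i : ℕ) + 1 : ℂ) * (z⁻¹) ^ n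

/-- The value of the Gamma function at the real number `s`, as a complex number. -/
noncomputable def gam (s : ℝ) : ℂ := (Real.Gamma s : ℂ)

/-- The real power `t ^ s`, as a complex number. -/
noncomputable def rpw (t s : ℝ) : ℂ := ((t ^ s : ℝ) : ℂ)

/-- The principal power `(-1) ^ s = e^{πis}`. -/
noncomputable def negOnePow (s : ℝ) : ℂ := Complex.exp (π * Complex.I * s)

/-- `α = e^{2πi/5}`. -/
noncomputable def alpha : ℂ := Complex.exp (2 * π * Complex.I / 5)

noncomputable def matX5 : Matrix (Fin 4) (Fin 4) ℂ :=
  !![-(16 * π ^ 4 * alpha) / ((alpha - 1) * gam (1 / 5) ^ 5),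
     -(16 * π ^ 4 * alpha) / ((alpha - 1) ^ 2 * gam (1 / 5) ^ 5),
     -(16 * π ^ 4) / gam (1 / 5) ^ 5,
     (16 * π ^ 4 * alpha * (2 * alpha + 3)) / ((1 - alpha) ^ 3 * gam (1 / 5) ^ 5);
     -(16 * π ^ 4 * alpha ^ 2) / ((alpha ^ 2 - 1) * gam (2 / 5) ^ 5),
     -(16 * π ^ 4 * alpha ^ 2) / ((alpha ^ 2 - 1) ^ 2 * gam (2 / 5) ^ 5),
     -(16 * π ^ 4) / gam (2 / 5) ^ 5,
     (16 * π ^ 4 * alpha ^ 2 * (2 * alpha ^ 2 + 3)) / ((1 - alpha ^ 2) ^ 3 * gam (2 / 5) ^ 5);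
     -(32 * π ^ 4 * alpha ^ 3) / ((alpha ^ 3 - 1) * gam (3 / 5) ^ 5),
     -(32 * π ^ 4 * alpha ^ 3) / ((alpha ^ 3 - 1) ^ 2 * gam (3 / 5) ^ 5),
     -(32 * π ^ 4) / gam (3 / 5) ^ 5,
     (32 * π ^ 4 * alpha ^ 3 * (2 * alpha ^ 3 + 3)) / ((1 - alpha ^ 3) ^ 3 * gam (3 / 5) ^ 5);
     -(96 * π ^ 4 * alpha ^ 4) / ((alpha ^ 4 - 1) * gam (4 / 5) ^ 5),
     -(96 * π ^ 4 * alpha ^ 4) / ((alpha ^ 4 - 1) ^ 2 * gam (4 / 5) ^ 5),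
     -(96 * π ^ 4) / gam (4 / 5) ^ 5,
     (96 * π ^ 4 * alpha ^ 4 * (2 * alpha ^ 4 + 3)) / ((1 - alpha ^ 4) ^ 3 * gam (4 / 5) ^ 5)]

noncomputable def matX43 : Matrix (Fin 4) (Fin 4) ℂ :=
  !![8 * (1 + Complex.I) * rpw 2 (1 / 2) * rpw π (9 / 2) / gam (1 / 4) ^ 6,
     8 * rpw 2 (1 / 2) * rpw π (9 / 2) / gam (1 / 4) ^ 6,
     -(16 * rpw 2 (1 / 2) * rpw π (9 / 2)) / gam (1 / 4) ^ 6,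
     -(24 * Complex.I * rpw 2 (1 / 2) * rpw π (9 / 2)) / gam (1 / 4) ^ 6;
     4 * negOnePow (1 / 6) * rpw 2 (2 / 3) * rpw π (5 / 2) /
       (rpw 3 (1 / 2) * gam (1 / 6) * gam (1 / 3)),
     4 * rpw 2 (2 / 3) * rpw π (5 / 2) / (3 * gam (1 / 6) * gam (1 / 3)),
     -(4 * rpw 2 (2 / 3) * rpw π (5 / 2)) / (gam (1 / 6) * gam (1 / 3)),
     -(4 * Complex.I * rpw 2 (2 / 3) * rpw π (5 / 2)) /
       (rpw 3 (1 / 2) * gam (1 / 6) * gam (1 / 3));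
     -(80 * negOnePow (5 / 6) * π ^ 3) / (3 * gam (2 / 3) ^ 3),
     80 * π ^ 3 / (3 * rpw 3 (1 / 2) * gam (2 / 3) ^ 3),
     -(80 * π ^ 3) / (rpw 3 (1 / 2) * gam (2 / 3) ^ 3),
     80 * Complex.I * π ^ 3 / (3 * gam (2 / 3) ^ 3);
     10 * (1 - Complex.I) * rpw 2 (1 / 2) * rpw π (9 / 2) / gam (3 / 4) ^ 6,
     10 * rpw 2 (1 / 2) * rpw π (9 / 2) / gam (3 / 4) ^ 6,
     -(20 * rpw 2 (1 / 2) * rpw π (9 / 2)) / gam (3 / 4) ^ 6,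
     30 * Complex.I * rpw 2 (1 / 2) * rpw π (9 / 2) / gam (3 / 4) ^ 6]

noncomputable def matX42 : Matrix (Fin 4) (Fin 4) ℂ :=
  !![negOnePow (1 / 4) * rpw 2 (1 / 2) * rpw π (9 / 2) / gam (1 / 4) ^ 6,
     rpw π (9 / 2) / gam (1 / 4) ^ 6,
     -(2 * rpw π (9 / 2)) / gam (1 / 4) ^ 6,
     -(4 * Complex.I * rpw π (9 / 2)) / gam (1 / 4) ^ 6;
     π / 8, π / 16, -π / 4, 0;
     1 / 8 * (4 - Complex.I * π) * π, π / 4, -π, Complex.I * π ^ 2 / 4;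
     (1 - Complex.I) * rpw π (9 / 2) / (64 * gam (3 / 4) ^ 6),
     rpw π (9 / 2) / (64 * gam (3 / 4) ^ 6),
     -rpw π (9 / 2) / (32 * gam (3 / 4) ^ 6),
     Complex.I * rpw π (9 / 2) / (16 * gam (3 / 4) ^ 6)]

noncomputable def matX44 : Matrix (Fin 4) (Fin 4) ℂ :=
  !![(1 + Complex.I) * π ^ 3 / (4 * gam (1 / 4) ^ 4),
     π ^ 3 / (4 * gam (1 / 4) ^ 4),
     -π ^ 3 / (2 * gam (1 / 4) ^ 4),
     -(Complex.I * π ^ 3) / (2 * gam (1 / 4) ^ 4);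
     π ^ 4 / (2 * gam (1 / 4) ^ 4),
     0,
     -π ^ 4 / gam (1 / 4) ^ 4,
     Complex.I * π ^ 4 / gam (1 / 4) ^ 4;
     (1 - Complex.I) * π ^ 3 / (256 * gam (3 / 4) ^ 4),
     π ^ 3 / (256 * gam (3 / 4) ^ 4),
     -π ^ 3 / (128 * gam (3 / 4) ^ 4),
     Complex.I * π ^ 3 / (128 * gam (3 / 4) ^ 4);
     ((2 - 2 * Complex.I) - π) * π ^ 3 / (128 * gam (3 / 4) ^ 4),
     π ^ 3 / (64 * gam (3 / 4) ^ 4),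
     (π - 2) * π ^ 3 / (64 * gam (3 / 4) ^ 4),
     Complex.I * π ^ 3 * (2 + π) / (64 * gam (3 / 4) ^ 4)]

noncomputable def matX2222 : Matrix (Fin 4) (Fin 4) ℂ :=
  !![1 / 32, 1 / 64, -1 / 16, 0;
     -(Complex.I * π) / 32, 0, 0, Complex.I * π / 8;
     -π ^ 2 / 48, π ^ 2 / 192, π ^ 2 / 24, 0;
     riemannZeta 3 / 4 + Complex.I * π ^ 3 / 96, riemannZeta 3 / 8, -riemannZeta 3 / 2,
     Complex.I * π ^ 3 / 12]

end

end CYPeriods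

/-! ### Taylor series at the origin as formal power series. -/

namespace CYPeriods

open Filter Topology PowerSeries

/-! One Mellin-Barnes integral represents the same function on both sides of `|z| = μ`. Put `G(s) =
μ^{-s} ∏_k Γ(a_k + s) / Γ(1 + s)` and integrate `G(s) z^s`, over a vertical line slightly to the
left of `Re s = 0`, against kernels that are polynomials in `1 / (e^{±2πis} - 1)` and so have their
poles at the integers. For `|z| < μ` the line is moved to the right. The functional equation of the
Gamma function turns `G(s + n) / G(s)` into the hypergeometric recursion, and a pole of order `j +
1` extracts the `j`-th Taylor coefficient in the exponent, which produces the logarithms; the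
residues therefore add up to Frobenius solutions at `0` (`tendsto_sum_coeff_jet`,
`lineInt_hypGamma`). For `|z| > μ` the substitution `s ↦ -a_i - s` and the reflection formula turn
`G` into the Gamma quotient of the exponent `a_i` at infinity times a rational function of `u =
e^{±2πis}` (`frobGamma_neg_sub`), and the same residue theorem gives the solutions at infinity. The
integral is holomorphic on the whole half-plane, so it is the continuation (`exists_continuation`).

Each row of the inverse transition matrix thus amounts to a polynomial identity in `u`. The entries
of the period matrix match because they come from the expansion of `log G` at `0`, whose
coefficients of order one, two and three, multiplied by `κ`, are `0`, `c₂π²/6` and `χζ(3)`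
(`GammaClass`). This follows from Gauss' multiplication formula and the expansion of `Γ` at `1`. The
remaining work is explicit: the leading constants come from reflection, duplication and
triplication, and the rows with one logarithm need values of the digamma function
(`Regular.exists_row`, `IsRow`).

Arbitrary normalized bases reduce to canonical series, since the Frobenius recursion has a unique
solution (`IsCoord.eqOn_of_isFrobeniusBasis`). Comparing growth along a ray shows that a basis at
infinity is linearly independent. With the identity theorem on the half-plane this gives both the
invertibility and the uniqueness of the transition matrix (`hasInverseTransitionMatrix`). -/

/-- The Taylor series of `f` at `0`. -/
noncomputable def jet (f : ℂ → ℂ) : ℂ⟦X⟧ :=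
  PowerSeries.mk fun j => iteratedDeriv j f 0 / (j.factorial : ℂ)

lemma coeff_jet (f : ℂ → ℂ) (j : ℕ) :
    coeff j (jet f) = iteratedDeriv j f 0 / (j.factorial : ℂ) := by
  simp [jet]

lemma coeff_zero_jet (f : ℂ → ℂ) : coeff 0 (jet f) = f 0 := by
  simp [jet]

lemma coeff_one_jet (f : ℂ → ℂ) : coeff 1 (jet f) = deriv f 0 := by
  simp [jet]

lemma jet_congr {f g : ℂ → ℂ} (h : f =ᶠ[𝓝 0] g) : jet f = jet g := by
  ext j
  rw [coeff_jet, coeff_jet, h.iteratedDeriv_eq]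

lemma jet_mul {f g : ℂ → ℂ} (hf : AnalyticAt ℂ f 0) (hg : AnalyticAt ℂ g 0) :
    jet (fun s => f s * g s) = jet f * jet g := by
  ext j
  rw [coeff_mul, coeff_jet, iteratedDeriv_fun_mul hf.contDiffAt hg.contDiffAt,
    Finset.Nat.sum_antidiagonal_eq_sum_range_succ_mk, Finset.sum_div]
  refine Finset.sum_congr rfl fun i hi => ?_
  have hij : i ≤ j := Nat.lt_succ_iff.1 (Finset.mem_range.1 hi)
  rw [coeff_jet, coeff_jet, Nat.cast_choose ℂ hij]
  have h1 : (j.factorial : ℂ) ≠ 0 := by exact_mod_cast j.factorial_ne_zero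
  have h2 : (i.factorial : ℂ) ≠ 0 := by exact_mod_cast i.factorial_ne_zero
  have h3 : ((j - i).factorial : ℂ) ≠ 0 := by exact_mod_cast (j - i).factorial_ne_zero
  field_simp

lemma jet_const (c : ℂ) : jet (fun _ => c) = C c := by
  ext j
  rw [coeff_jet, PowerSeries.coeff_C, iteratedDeriv_const]
  split_ifs with h <;> simp [h]

lemma jet_add {f g : ℂ → ℂ} (hf : AnalyticAt ℂ f 0) (hg : AnalyticAt ℂ g 0) :
    jet (fun s => f s + g s) = jet f + jet g := by
  ext j
  rw [map_add, coeff_jet, coeff_jet, coeff_jet,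
    iteratedDeriv_fun_add hf.contDiffAt hg.contDiffAt, add_div]

lemma jet_id : jet (fun s => s) = X := by
  ext j
  rw [coeff_jet, iteratedDeriv_fun_id_zero, PowerSeries.coeff_X]
  split_ifs with h <;> simp [h]

lemma jet_const_add (c : ℂ) : jet (fun s => c + s) = C c + X := by
  rw [jet_add (g := fun s => s) analyticAt_const analyticAt_id, jet_const, jet_id]

lemma jet_const_mul (c : ℂ) {f : ℂ → ℂ} (hf : AnalyticAt ℂ f 0) :
    jet (fun s => c * f s) = C c * jet f := by
  rw [jet_mul analyticAt_const hf, jet_const]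

lemma jet_prod {ι : Type*} (S : Finset ι) {f : ι → ℂ → ℂ} (hf : ∀ i ∈ S, AnalyticAt ℂ (f i) 0) :
    jet (fun s => ∏ i ∈ S, f i s) = ∏ i ∈ S, jet (f i) := by
  classical
  induction S using Finset.induction_on with
  | empty => simpa using jet_const 1
  | insert a S ha ih =>
    have h1 : ∀ i ∈ S, AnalyticAt ℂ (f i) 0 := fun i hi => hf i (Finset.mem_insert_of_mem hi)
    simp only [Finset.prod_insert ha]
    rw [jet_mul (hf a (Finset.mem_insert_self a S)) (Finset.analyticAt_fun_prod _ h1), ih h1]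

lemma coeff_jet_exp (c : ℂ) (j : ℕ) :
    coeff j (jet fun s => Complex.exp (c * s)) = c ^ j / (j.factorial : ℂ) := by
  rw [coeff_jet, iteratedDeriv_cexp_const_mul]
  simp

lemma jet_taylor {f : ℂ → ℂ} (hf : AnalyticAt ℂ f 0) (n : ℕ) :
    ∃ F : ℂ → ℂ, AnalyticAt ℂ F 0 ∧
      ∀ z, f z = (∑ i ∈ Finset.range n, coeff i (jet f) * z ^ i) + z ^ n * F z := by
  obtain ⟨F, hF, h⟩ := hf.exists_eq_sum_add_pow_mul n
  refine ⟨F, hF, fun z => ?_⟩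
  rw [h z, smul_eq_mul]
  congr 1
  refine Finset.sum_congr rfl fun i _ => ?_
  rw [coeff_jet, smul_eq_mul]
  ring

/-- Taylor coefficients are determined by an asymptotic expansion. -/
lemma coeff_jet_of_isBigO {f : ℂ → ℂ} (hf : AnalyticAt ℂ f 0) {n : ℕ} {c : ℕ → ℂ}
    (h : (fun z => f z - ∑ i ∈ Finset.range n, c i * z ^ i) =O[𝓝 0] fun z => z ^ n) :
    ∀ i < n, coeff i (jet f) = c i := by
  obtain ⟨F, hF, hf'⟩ := jet_taylor hf n
  have hF1 : (fun z => z ^ n * F z) =O[𝓝 0] fun z : ℂ => z ^ n := by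
    simpa using (Asymptotics.isBigO_refl (fun z : ℂ => z ^ n) (𝓝 0)).mul
      (hF.continuousAt.isBigO_one ℂ)
  have h2 : (fun z => ∑ i ∈ Finset.range n, (coeff i (jet f) - c i) * z ^ i) =O[𝓝 0]
      fun z : ℂ => z ^ n := by
    refine (h.sub hF1).congr_left fun z => ?_
    rw [hf' z]
    simp only [sub_mul, Finset.sum_sub_distrib]
    ring
  intro i
  induction i using Nat.strong_induction_on with
  | _ i ih =>
    intro hi
    -- At the first index where the coefficients differ, division by `z ^ i` leaves a function that
    -- tends to the difference and, being `O(z ^ (n - i))` with `i < n`, also to `0`.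
    by_contra hne
    have h3 : (fun z : ℂ => ∑ k ∈ Finset.range n, (coeff k (jet f) - c k) * z ^ k)
        = fun z => z ^ i * ∑ k ∈ Finset.range (n - i),
          (coeff (i + k) (jet f) - c (i + k)) * z ^ k := by
      funext z
      obtain ⟨m, rfl⟩ := Nat.exists_eq_add_of_lt hi
      rw [show i + m + 1 = i + (m + 1) by ring, Finset.sum_range_add, Finset.sum_eq_zero,
        zero_add, Finset.mul_sum, Nat.add_sub_cancel_left]
      · refine Finset.sum_congr rfl fun k _ => ?_
        rw [pow_add]
        ring
      · intro k hk
        have hk' := Finset.mem_range.1 hk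
        rw [ih k hk' (by omega), sub_self, zero_mul]
    rw [h3] at h2
    have h4 : (fun z : ℂ => ∑ k ∈ Finset.range (n - i),
        (coeff (i + k) (jet f) - c (i + k)) * z ^ k) =O[𝓝[≠] 0] fun z : ℂ => z ^ (n - i) := by
      have h5 := (Asymptotics.isBigO_refl (fun z : ℂ => (z ^ i)⁻¹) (𝓝[≠] 0)).mul
        (h2.mono nhdsWithin_le_nhds)
      refine h5.congr' ?_ ?_
      · filter_upwards [self_mem_nhdsWithin] with z hz
        rw [← mul_assoc, inv_mul_cancel₀ (pow_ne_zero _ hz), one_mul]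
      · filter_upwards [self_mem_nhdsWithin] with z hz
        rw [pow_sub₀ _ hz hi.le, mul_comm]
    have h6 : Tendsto (fun z : ℂ => z ^ (n - i)) (𝓝[≠] 0) (𝓝 0) := by
      have : Tendsto (fun z : ℂ => z ^ (n - i)) (𝓝 0) (𝓝 (0 ^ (n - i))) :=
        (continuous_pow _).tendsto 0
      rw [zero_pow (by omega)] at this
      exact this.mono_left nhdsWithin_le_nhds
    have h7 := h4.trans_tendsto h6
    have h8 : Tendsto (fun z : ℂ => ∑ k ∈ Finset.range (n - i),
        (coeff (i + k) (jet f) - c (i + k)) * z ^ k) (𝓝[≠] 0)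
        (𝓝 (coeff i (jet f) - c i)) := by
      have hc : Continuous fun z : ℂ => ∑ k ∈ Finset.range (n - i),
        (coeff (i + k) (jet f) - c (i + k)) * z ^ k := by fun_prop
      have h9 := hc.tendsto 0
      rw [Finset.sum_eq_single 0 (fun b _ hb => by simp [hb])
        (fun hb => absurd (Finset.mem_range.2 (by omega)) hb)] at h9
      simpa using h9.mono_left nhdsWithin_le_nhds
    exact hne (sub_eq_zero.1 (tendsto_nhds_unique h8 h7))

lemma jet_mul_jet_inv {f : ℂ → ℂ} (hf : AnalyticAt ℂ f 0) (h0 : f 0 ≠ 0) :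
    jet f * jet (fun s => (f s)⁻¹) = 1 := by
  rw [← jet_mul (g := fun s => (f s)⁻¹) hf (hf.inv h0), ← map_one (C (R := ℂ)), ← jet_const]
  refine jet_congr ?_
  filter_upwards [hf.continuousAt.eventually_ne h0] with s hs
  exact mul_inv_cancel₀ hs

end CYPeriods

/-! ### Frobenius series with logarithms and the hypergeometric operator. -/

namespace CYPeriods

open Filter Topology PowerSeries

/-- The disc of radius `r`, cut along the negative real axis. -/
def slitDisc (r : ℝ) : Set ℂ := {x | x ∈ Complex.slitPlane ∧ ‖x‖ < r}

lemma isOpen_slitDisc (r : ℝ) : IsOpen (slitDisc r) :=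
  Complex.isOpen_slitPlane.inter (isOpen_lt continuous_norm continuous_const)

/-- The function `∑ a_{n,j} xⁿ`, where `a_{n,j}` is the `j`-th coefficient of `a n`. -/
noncomputable def ser (a : ℕ → ℂ⟦X⟧) (j : ℕ) (x : ℂ) : ℂ := ∑' n, coeff j (a n) * x ^ n

/-- Convergence of all the series `ser a j` on the disc of radius `r`. -/
def Conv (r : ℝ) (a : ℕ → ℂ⟦X⟧) : Prop :=
  ∀ j, ∀ x : ℂ, ‖x‖ < r → Summable fun n => coeff j (a n) * x ^ n

lemma Conv.hasSum {r : ℝ} {a : ℕ → ℂ⟦X⟧} (ha : Conv r a) (j : ℕ) {x : ℂ} (hx : ‖x‖ < r) :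
    HasSum (fun n => coeff j (a n) * x ^ n) (ser a j x) :=
  (ha j x hx).hasSum

/-- Absolute convergence at the real point `t` dominates the series on the whole ball of radius `t`;
this majorant is what termwise differentiation needs. -/
lemma Conv.bound {r : ℝ} {a : ℕ → ℂ⟦X⟧} (ha : Conv r a) (j : ℕ) {t : ℝ} (ht0 : 0 ≤ t)
    (ht : t < r) : Summable (fun n => ‖coeff j (a n) * (t : ℂ) ^ n‖) ∧
      ∀ n, ∀ w ∈ Metric.ball (0 : ℂ) t, ‖coeff j (a n) * w ^ n‖ ≤ ‖coeff j (a n) * (t : ℂ) ^ n‖ := by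
  refine ⟨(ha j t (by simpa [abs_of_nonneg ht0] using ht)).norm, fun n w hw => ?_⟩
  have hw' : ‖w‖ ≤ t := (mem_ball_zero_iff.1 hw).le
  rw [norm_mul, norm_mul, norm_pow, norm_pow, Complex.norm_real, Real.norm_of_nonneg ht0]
  gcongr

lemma Conv.differentiableOn {r : ℝ} {a : ℕ → ℂ⟦X⟧} (ha : Conv r a) (j : ℕ) :
    DifferentiableOn ℂ (ser a j) (Metric.ball 0 r) := by
  intro x hx
  obtain ⟨t, ht1, ht2⟩ := exists_between (mem_ball_zero_iff.1 hx)
  have ht0 : 0 ≤ t := (norm_nonneg x).trans ht1.le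
  obtain ⟨h1, h2⟩ := ha.bound j ht0 ht2
  have h := Complex.differentiableOn_tsum_of_summable_norm h1
    (fun n => ((differentiable_id.pow n).const_mul _).differentiableOn) Metric.isOpen_ball h2
  exact (h.differentiableAt (Metric.isOpen_ball.mem_nhds (mem_ball_zero_iff.2 ht1)))
    |>.differentiableWithinAt

lemma Conv.hasSum_deriv {r : ℝ} {a : ℕ → ℂ⟦X⟧} (ha : Conv r a) (j : ℕ) {x : ℂ} (hx : ‖x‖ < r) :
    HasSum (fun n : ℕ => (n : ℂ) * (coeff j (a n) * x ^ n)) (x * deriv (ser a j) x) := by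
  obtain ⟨t, ht1, ht2⟩ := exists_between hx
  have ht0 : 0 ≤ t := (norm_nonneg x).trans ht1.le
  obtain ⟨h1, h2⟩ := ha.bound j ht0 ht2
  have h := (Complex.hasSum_deriv_of_summable_norm h1
    (fun n => ((differentiable_id.pow n).const_mul _).differentiableOn) Metric.isOpen_ball h2
    (mem_ball_zero_iff.2 ht1)).mul_left x
  convert! h using 2 with n
  have : deriv (fun w : ℂ => coeff j (a n) * w ^ n) x = coeff j (a n) * (n * x ^ (n - 1)) := by
    simp
  change _ = x * deriv (fun w : ℂ => coeff j (a n) * w ^ n) x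
  rw [this]
  rcases n with _ | n
  · simp
  · simp [pow_succ]
    ring

/-- Multiplication of the `n`-th term by `n + c + T`. -/
noncomputable def nabla (c : ℂ) (a : ℕ → ℂ⟦X⟧) (n : ℕ) : ℂ⟦X⟧ := (C ((n : ℂ) + c) + X) * a n

lemma coeff_zero_linear_mul (k : ℂ) (a : ℂ⟦X⟧) : coeff 0 ((C k + X) * a) = k * coeff 0 a := by
  simp [add_mul]

lemma coeff_succ_linear_mul (k : ℂ) (a : ℂ⟦X⟧) (j : ℕ) :
    coeff (j + 1) ((C k + X) * a) = k * coeff (j + 1) a + coeff j a := by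
  rw [add_mul, map_add, coeff_C_mul, coeff_succ_X_mul]

/-- Termwise, `θ` supplies the factor `n`, and multiplication by the formal variable lowers the
order of the coefficient by one, so the series of order `j - 1` enters that of order `j`. -/
lemma Conv.hasSum_nabla {r : ℝ} {a : ℕ → ℂ⟦X⟧} (ha : Conv r a) (c : ℂ) (j : ℕ) {x : ℂ}
    (hx : ‖x‖ < r) : HasSum (fun n => coeff j (nabla c a n) * x ^ n)
      (x * deriv (ser a j) x + c * ser a j x + if j = 0 then 0 else ser a (j - 1) x) := by
  have h := (ha.hasSum_deriv j hx).add ((ha.hasSum j hx).mul_left c)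
  rcases j with _ | j
  · simp only [if_true, add_zero]
    refine h.congr_fun fun n => ?_
    rw [nabla, coeff_zero_linear_mul]
    ring
  · simp only [Nat.succ_ne_zero, if_false, Nat.add_sub_cancel]
    refine (h.add (ha.hasSum j hx)).congr_fun fun n => ?_
    rw [nabla, coeff_succ_linear_mul]
    ring

lemma conv_nabla {r : ℝ} {a : ℕ → ℂ⟦X⟧} (ha : Conv r a) (c : ℂ) : Conv r (nabla c a) :=
  fun j _ hx => (ha.hasSum_nabla c j hx).summable

lemma logSeries_congr {ρ : ℝ} {g g' : ℕ → ℂ → ℂ} {N : ℕ} {x : ℂ} (h : ∀ j ≤ N, g j x = g' j x) :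
    logSeries ρ g N x = logSeries ρ g' N x := by
  unfold logSeries
  congr 1
  refine Finset.sum_congr rfl fun j hj => ?_
  rw [h j (Nat.lt_succ_iff.1 (Finset.mem_range.1 hj))]

lemma hasDerivAt_log_pow {x : ℂ} (hx : x ∈ Complex.slitPlane) (m : ℕ) :
    HasDerivAt (fun x => Complex.log x ^ m / (m.factorial : ℂ))
      ((if m = 0 then 0 else Complex.log x ^ (m - 1) / ((m - 1).factorial : ℂ)) / x) x := by
  have h := ((Complex.hasDerivAt_log hx).pow m).div_const (m.factorial : ℂ)
  refine h.congr_deriv ?_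
  rcases m with _ | m
  · simp
  · have h1 : ((m.factorial : ℕ) : ℂ) ≠ 0 := by exact_mod_cast m.factorial_ne_zero
    have h2 : ((m : ℂ) + 1) ≠ 0 := by exact_mod_cast m.succ_ne_zero
    simp only [Nat.succ_ne_zero, if_false, Nat.add_sub_cancel, Nat.factorial_succ]
    push_cast
    field_simp

lemma hasDerivAt_logSeries {ρ : ℝ} {g : ℕ → ℂ → ℂ} (N : ℕ) {x : ℂ} (hx : x ∈ Complex.slitPlane)
    (hg : ∀ j, DifferentiableAt ℂ (g j) x) :
    HasDerivAt (logSeries ρ g N) (x⁻¹ * logSeries ρ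
      (fun j x => x * deriv (g j) x + ρ * g j x + if j = 0 then 0 else g (j - 1) x) N x) x := by
  have hx0 : x ≠ 0 := Complex.slitPlane_ne_zero hx
  have h1 : HasDerivAt (fun x : ℂ => x ^ (ρ : ℂ)) (x⁻¹ * (ρ * x ^ (ρ : ℂ))) x := by
    refine ((hasDerivAt_id x).cpow_const hx).congr_deriv ?_
    simp only [id_eq]
    rw [Complex.cpow_sub _ _ hx0, Complex.cpow_one]
    field_simp
  have h2 := HasDerivAt.fun_sum (u := Finset.range (N + 1)) fun j _ =>
    (hg j).hasDerivAt.mul (hasDerivAt_log_pow hx (N - j))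
  have h3 := h1.mul h2
  have hfun : logSeries ρ g N = fun x => x ^ (ρ : ℂ) * ∑ j ∈ Finset.range (N + 1),
      g j x * (Complex.log x ^ (N - j) / ((N - j).factorial : ℂ)) := by
    funext y
    simp only [logSeries, mul_div_assoc]
  rw [hfun]
  refine h3.congr_deriv ?_
  unfold logSeries
  -- Differentiating a power of the logarithm lowers it by one, which amounts to putting `g (j - 1)`
  -- in position `j`. The last term on the left and the first on the right vanish.
  have h4 : ∑ j ∈ Finset.range (N + 1), g j x * ((if N - j = 0 then 0 else
      Complex.log x ^ (N - j - 1) / ((N - j - 1).factorial : ℂ)) / x) =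
      x⁻¹ * ∑ j ∈ Finset.range (N + 1), (if j = 0 then 0 else g (j - 1) x) *
        Complex.log x ^ (N - j) / ((N - j).factorial : ℂ) := by
    rw [Finset.sum_range_succ, Finset.sum_range_succ']
    simp only [Nat.sub_self, if_true, zero_div, mul_zero, add_zero, Nat.succ_ne_zero, if_false,
      Nat.add_sub_cancel, zero_mul]
    rw [Finset.mul_sum]
    refine Finset.sum_congr rfl fun j hj => ?_
    have hj' := Finset.mem_range.1 hj
    rw [if_neg (by omega), show N - j - 1 = N - (j + 1) by omega]
    field_simp
  rw [Finset.sum_add_distrib, h4]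
  simp only [add_mul, add_div, Finset.sum_add_distrib, Finset.mul_sum]
  simp only [← Finset.mul_sum, Pi.mul_apply, mul_div_assoc, mul_assoc]
  field_simp
  ring

/-- With a formal exponent `T`, the function `logSeries ρ (ser a) N` is the coefficient of `T ^ N`
in `∑ a_n(T) x ^ (n + ρ + T)`. On `x ^ (n + ρ + T)` the operator `θ + c` is multiplication by `n + ρ
+ c + T`. -/
lemma thetaAdd_logSeries {ρ : ℝ} {r : ℝ} {a : ℕ → ℂ⟦X⟧} (ha : Conv r a) (c : ℂ) (N : ℕ) :
    Set.EqOn (thetaAdd c (logSeries ρ (ser a) N)) (logSeries ρ (ser (nabla (ρ + c) a)) N)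
      (slitDisc r) := by
  intro x hx
  have hx0 : x ≠ 0 := Complex.slitPlane_ne_zero hx.1
  have hd := hasDerivAt_logSeries (ρ := ρ) (g := ser a) N hx.1 fun j =>
    (ha.differentiableOn j).differentiableAt
      (Metric.isOpen_ball.mem_nhds (mem_ball_zero_iff.2 hx.2))
  rw [thetaAdd, hd.deriv, ← mul_assoc, mul_inv_cancel₀ hx0, one_mul]
  unfold logSeries
  rw [mul_left_comm, ← mul_add]
  congr 1
  rw [Finset.mul_sum, ← Finset.sum_add_distrib]
  refine Finset.sum_congr rfl fun j _ => ?_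
  rw [show ser (nabla (ρ + c) a) j x = _ from (ha.hasSum_nabla (ρ + c) j hx.2).tsum_eq]
  ring

lemma differentiableOn_logSeries {ρ : ℝ} {r : ℝ} {g : ℕ → ℂ → ℂ}
    (hg : ∀ j, DifferentiableOn ℂ (g j) (Metric.ball 0 r)) (N : ℕ) :
    DifferentiableOn ℂ (logSeries ρ g N) (slitDisc r) := fun _ hx =>
  (hasDerivAt_logSeries N hx.1 fun j => (hg j).differentiableAt
    (Metric.isOpen_ball.mem_nhds (mem_ball_zero_iff.2 hx.2))).differentiableAt
    |>.differentiableWithinAt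

lemma thetaAdd_congr {U : Set ℂ} (hU : IsOpen U) (c : ℂ) {f g : ℂ → ℂ} (h : Set.EqOn f g U) :
    Set.EqOn (thetaAdd c f) (thetaAdd c g) U := by
  intro x hx
  have h1 : f =ᶠ[𝓝 x] g := h.eventuallyEq_of_mem (hU.mem_nhds hx)
  rw [thetaAdd, thetaAdd, h1.deriv_eq, h hx]

/-- The operator `(θ + c₁)(θ + c₂)(θ + c₃)(θ + c₄)`. -/
noncomputable def thetaProd (c : Fin 4 → ℝ) (f : ℂ → ℂ) : ℂ → ℂ :=
  thetaAdd (c 0) (thetaAdd (c 1) (thetaAdd (c 2) (thetaAdd (c 3) f)))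

lemma thetaProd_congr {U : Set ℂ} (hU : IsOpen U) (c : Fin 4 → ℝ) {f g : ℂ → ℂ}
    (h : Set.EqOn f g U) : Set.EqOn (thetaProd c f) (thetaProd c g) U :=
  thetaAdd_congr hU _ <| thetaAdd_congr hU _ <| thetaAdd_congr hU _ <| thetaAdd_congr hU _ h

/-- Multiplication of the `n`-th term by `∏ (n + ρ + c_k + T)`. -/
noncomputable def nablaProd (ρ : ℝ) (c : Fin 4 → ℝ) (a : ℕ → ℂ⟦X⟧) : ℕ → ℂ⟦X⟧ :=
  nabla (ρ + c 0) (nabla (ρ + c 1) (nabla (ρ + c 2) (nabla (ρ + c 3) a)))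

lemma nablaProd_apply (ρ : ℝ) (c : Fin 4 → ℝ) (a : ℕ → ℂ⟦X⟧) (n : ℕ) :
    nablaProd ρ c a n = (∏ k, (C ((n : ℂ) + (ρ + c k)) + X)) * a n := by
  simp only [nablaProd, nabla, Fin.prod_univ_four, mul_assoc]

lemma conv_nablaProd {r : ℝ} {a : ℕ → ℂ⟦X⟧} (ha : Conv r a) (ρ : ℝ) (c : Fin 4 → ℝ) :
    Conv r (nablaProd ρ c a) :=
  conv_nabla (conv_nabla (conv_nabla (conv_nabla ha _) _) _) _

lemma thetaProd_logSeries {ρ : ℝ} {r : ℝ} {a : ℕ → ℂ⟦X⟧} (ha : Conv r a) (c : Fin 4 → ℝ) (N : ℕ) :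
    Set.EqOn (thetaProd c (logSeries ρ (ser a) N)) (logSeries ρ (ser (nablaProd ρ c a)) N)
      (slitDisc r) := by
  have hU := isOpen_slitDisc r
  have h3 := thetaAdd_logSeries (ρ := ρ) ha (c 3) N
  have h2 := (thetaAdd_congr hU (c 2) h3).trans (thetaAdd_logSeries (conv_nabla ha _) (c 2) N)
  have h1 := (thetaAdd_congr hU (c 1) h2).trans
    (thetaAdd_logSeries (conv_nabla (conv_nabla ha _) _) (c 1) N)
  exact (thetaAdd_congr hU (c 0) h1).trans
    (thetaAdd_logSeries (conv_nabla (conv_nabla (conv_nabla ha _) _) _) (c 0) N)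

/-- The hypergeometric operator `∏ (θ + α_k) - r⁻¹ x ∏ (θ + β_k)`. -/
noncomputable def hyp (α β : Fin 4 → ℝ) (r : ℝ) (f : ℂ → ℂ) (x : ℂ) : ℂ :=
  thetaProd α f x - (r : ℂ)⁻¹ * x * thetaProd β f x

lemma hyp_congr {U : Set ℂ} (hU : IsOpen U) {α β : Fin 4 → ℝ} {r : ℝ} {f g : ℂ → ℂ}
    (h : Set.EqOn f g U) : Set.EqOn (hyp α β r f) (hyp α β r g) U := fun x hx => by
  rw [hyp, hyp, thetaProd_congr hU α h hx, thetaProd_congr hU β h hx]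

/-- The coefficients of the result of the hypergeometric operator. -/
noncomputable def hypCoeff (α β : Fin 4 → ℝ) (r ρ : ℝ) (a : ℕ → ℂ⟦X⟧) (n : ℕ) : ℂ⟦X⟧ :=
  nablaProd ρ α a n - if n = 0 then 0 else C (r : ℂ)⁻¹ * nablaProd ρ β a (n - 1)

lemma Conv.hasSum_hypCoeff {α β : Fin 4 → ℝ} {r ρ : ℝ} {a : ℕ → ℂ⟦X⟧} (ha : Conv r a) (j : ℕ)
    {x : ℂ} (hx : ‖x‖ < r) : HasSum (fun n => coeff j (hypCoeff α β r ρ a n) * x ^ n)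
      (ser (nablaProd ρ α a) j x - (r : ℂ)⁻¹ * x * ser (nablaProd ρ β a) j x) := by
  have h1 := (conv_nablaProd ha ρ α).hasSum j hx
  have h2 := ((conv_nablaProd ha ρ β).hasSum j hx).mul_left ((r : ℂ)⁻¹ * x)
  have h3 : HasSum (fun n => coeff j (if n = 0 then (0 : ℂ⟦X⟧) else
      C (r : ℂ)⁻¹ * nablaProd ρ β a (n - 1)) * x ^ n)
      ((r : ℂ)⁻¹ * x * ser (nablaProd ρ β a) j x) := by
    rw [← hasSum_nat_add_iff' 1]
    simp only [Finset.range_one, Finset.sum_singleton, if_true, map_zero, zero_mul, sub_zero,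
      Nat.succ_ne_zero, if_false, Nat.add_sub_cancel]
    refine h2.congr_fun fun n => ?_
    rw [coeff_C_mul]
    ring
  refine (h1.sub h3).congr_fun fun n => ?_
  rw [hypCoeff, map_sub]
  ring

lemma conv_hypCoeff {α β : Fin 4 → ℝ} {r ρ : ℝ} {a : ℕ → ℂ⟦X⟧} (ha : Conv r a) :
    Conv r (hypCoeff α β r ρ a) := fun j _ hx => (ha.hasSum_hypCoeff j hx).summable

lemma hyp_logSeries {α β : Fin 4 → ℝ} {ρ : ℝ} {r : ℝ} {a : ℕ → ℂ⟦X⟧} (ha : Conv r a) (N : ℕ) :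
    Set.EqOn (hyp α β r (logSeries ρ (ser a) N)) (logSeries ρ (ser (hypCoeff α β r ρ a)) N)
      (slitDisc r) := by
  intro x hx
  rw [hyp, thetaProd_logSeries ha α N hx, thetaProd_logSeries ha β N hx]
  unfold logSeries
  rw [mul_left_comm, ← mul_sub, Finset.mul_sum, ← Finset.sum_sub_distrib]
  congr 1
  refine Finset.sum_congr rfl fun j _ => ?_
  have h := (ha.hasSum_hypCoeff (α := α) (β := β) (ρ := ρ) j hx.2).tsum_eq
  rw [show ser (hypCoeff α β r ρ a) j x = _ from h]
  ring

/-- The slit disc omits `0`, so the constant term is recovered as a limit along the positive real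
axis. -/
lemma eq_zero_of_tsum_eq_zero_zero {r : ℝ} (hr : 0 < r) {b : ℕ → ℂ}
    (hb : ∀ x : ℂ, ‖x‖ < r → Summable fun n => b n * x ^ n)
    (h : ∀ x ∈ slitDisc r, ∑' n, b n * x ^ n = 0) : b 0 = 0 := by
  have hconv : Conv r fun n => C (b n) := by
    intro j x hx
    rcases j with _ | j
    · simpa using hb x hx
    · simp [summable_zero]
  have hc : ContinuousAt (ser (fun n => C (b n)) 0) 0 :=
    ((hconv.differentiableOn 0).differentiableAt (Metric.ball_mem_nhds 0 hr)).continuousAt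
  have h1 : Tendsto (fun t : ℝ => ser (fun n => C (b n)) 0 t) (𝓝[>] 0)
      (𝓝 (ser (fun n => C (b n)) 0 0)) := by
    refine hc.tendsto.comp ?_
    have : Tendsto (fun t : ℝ => (t : ℂ)) (𝓝 0) (𝓝 ((0 : ℝ) : ℂ)) :=
      Complex.continuous_ofReal.tendsto 0
    exact (this.mono_left nhdsWithin_le_nhds)
  have h2 : (fun t : ℝ => ser (fun n => C (b n)) 0 t) =ᶠ[𝓝[>] 0] fun _ => 0 := by
    filter_upwards [Ioo_mem_nhdsGT hr] with t ht
    simp only [ser, coeff_zero_C]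
    refine h t ⟨Complex.ofReal_mem_slitPlane.2 ht.1, ?_⟩
    rw [Complex.norm_real, Real.norm_of_nonneg ht.1.le]
    exact ht.2
  have h3 := tendsto_nhds_unique (h1.congr' h2) tendsto_const_nhds
  rw [ser, tsum_eq_single 0 (fun n hn => by simp [hn])] at h3
  simpa using h3

lemma eq_zero_of_tsum_eq_zero {r : ℝ} (hr : 0 < r) {b : ℕ → ℂ}
    (hb : ∀ x : ℂ, ‖x‖ < r → Summable fun n => b n * x ^ n)
    (h : ∀ x ∈ slitDisc r, ∑' n, b n * x ^ n = 0) (n : ℕ) : b n = 0 := by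
  induction n generalizing b with
  | zero => exact eq_zero_of_tsum_eq_zero_zero hr hb h
  | succ n ih =>
    have h0 : b 0 = 0 := eq_zero_of_tsum_eq_zero_zero hr hb h
    -- Once the constant term is zero, a factor `x` can be cancelled on the slit disc, and the
    -- shifted series satisfies the same hypotheses.
    refine ih (b := fun n => b (n + 1)) (fun x hx => ?_) fun x hx => ?_
    · by_cases hx0 : x = 0
      · subst hx0
        exact summable_of_ne_finset_zero (s := {0}) fun n hn => by simp_all
      · have h1 := ((summable_nat_add_iff 1).2 (hb x hx)).mul_left x⁻¹
        refine h1.congr fun n => ?_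
        field_simp
        ring
    · have hx0 : x ≠ 0 := Complex.slitPlane_ne_zero hx.1
      have h1 := (hb x hx.2).tsum_eq_zero_add
      rw [h x hx, h0, zero_mul, zero_add] at h1
      have h2 : ∑' n, b (n + 1) * x ^ (n + 1) = x * ∑' n, b (n + 1) * x ^ n := by
        rw [← tsum_mul_left]
        refine tsum_congr fun n => ?_
        ring
      rw [h2] at h1
      exact (mul_eq_zero.1 h1.symm).resolve_left hx0

end CYPeriods

/-! ### Existence and uniqueness of normalized Frobenius bases. -/

namespace CYPeriods

open Filter Topology PowerSeries

/-- The ratio `r⁻ⁿ ∏_{i < n} ∏_k (q_k + i + s) / (p_k + i + s)` of two coefficients of a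
hypergeometric series. -/
noncomputable def hypRatio (q p : Fin 4 → ℝ) (r : ℝ) (n : ℕ) (s : ℂ) : ℂ :=
  ∏ i ∈ Finset.range n, ((r : ℂ)⁻¹ * ∏ k, ((q k + i : ℂ) + s) * ((p k + i : ℂ) + s)⁻¹)

/-- The hypothesis `0 < q_k < p_k`. -/
def Admissible (q p : Fin 4 → ℝ) : Prop := ∀ k, 0 < q k ∧ q k < p k

lemma Admissible.exists_radius {q p : Fin 4 → ℝ} (h : Admissible q p) :
    ∃ δ > 0, ∀ k, δ ≤ q k := by
  refine ⟨Finset.univ.inf' Finset.univ_nonempty q, ?_, fun k => Finset.inf'_le _ (Finset.mem_univ k)⟩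
  exact (Finset.lt_inf'_iff _).2 fun k _ => (h k).1

lemma shift_re_pos {q δ : ℝ} (hq : δ ≤ q) (i : ℕ) {s : ℂ} (hs : ‖s‖ < δ) :
    0 < ((q + i : ℂ) + s).re := by
  have h1 := (abs_le.1 (Complex.abs_re_le_norm s)).1
  have h2 : (0 : ℝ) ≤ i := i.cast_nonneg
  simp
  linarith

lemma shift_ne_zero {q δ : ℝ} (hq : δ ≤ q) (i : ℕ) {s : ℂ} (hs : ‖s‖ < δ) :
    (q + i : ℂ) + s ≠ 0 := fun h => by
  have := shift_re_pos hq i hs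
  rw [h] at this
  simp at this

lemma analyticAt_hypRatio {q p : Fin 4 → ℝ} {r δ : ℝ} (hp : ∀ k, δ ≤ p k)
    (n : ℕ) {s : ℂ} (hs : ‖s‖ < δ) : AnalyticAt ℂ (hypRatio q p r n) s := by
  refine Finset.analyticAt_fun_prod _ fun i _ => analyticAt_const.mul
    (Finset.analyticAt_fun_prod _ fun k _ => ?_)
  exact (analyticAt_const.add analyticAt_id).mul
    ((analyticAt_const.add analyticAt_id).inv (shift_ne_zero (hp k) i hs))

/-- Adding a nonnegative real number to a point of the right half-plane does not decrease its
modulus. Hence every quotient in `hypRatio` has modulus at most one, uniformly in `s`. -/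
lemma norm_shift_le {q p δ : ℝ} (hq : δ ≤ q) (hqp : q ≤ p) (i : ℕ) {s : ℂ} (hs : ‖s‖ < δ) :
    ‖(q + i : ℂ) + s‖ ≤ ‖(p + i : ℂ) + s‖ := by
  have h := shift_re_pos hq i hs
  have e : (p + i : ℂ) + s = ((q + i : ℂ) + s) + ((p - q : ℝ) : ℂ) := by push_cast; ring
  rw [e]
  generalize (q + i : ℂ) + s = w at h
  rw [← sq_le_sq₀ (norm_nonneg _) (norm_nonneg _), Complex.sq_norm, Complex.sq_norm,
    Complex.normSq_apply, Complex.normSq_apply]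
  simp
  nlinarith

lemma norm_hypRatio_le {q p : Fin 4 → ℝ} {r δ : ℝ} (hr : 0 < r) (h : Admissible q p)
    (hq : ∀ k, δ ≤ q k) (n : ℕ) {s : ℂ} (hs : ‖s‖ < δ) : ‖hypRatio q p r n s‖ ≤ (r⁻¹) ^ n := by
  rw [hypRatio, norm_prod]
  refine (Finset.prod_le_prod (g := fun _ => r⁻¹) (fun _ _ => norm_nonneg _) fun i _ => ?_).trans_eq
    (by simp)
  rw [norm_mul, norm_inv, Complex.norm_real, Real.norm_of_nonneg hr.le, norm_prod]
  refine mul_le_of_le_one_right (inv_nonneg.2 hr.le)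
    (Finset.prod_le_one (fun _ _ => norm_nonneg _) fun k _ => ?_)
  rw [norm_mul, norm_inv, ← div_eq_mul_inv]
  exact div_le_one_of_le₀ (norm_shift_le (hq k) (h k).2.le i hs) (norm_nonneg _)

/-- The Taylor coefficients of the hypergeometric coefficients in the exponent. -/
noncomputable def frobCoeff (q p : Fin 4 → ℝ) (r : ℝ) (n : ℕ) : ℂ⟦X⟧ := jet (hypRatio q p r n)

lemma frobCoeff_zero (q p : Fin 4 → ℝ) (r : ℝ) : frobCoeff q p r 0 = 1 := by
  have : hypRatio q p r 0 = fun _ => 1 := by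
    funext s
    simp [hypRatio]
  rw [frobCoeff, this, jet_const, map_one]

/-- Cauchy's estimate on the circle of radius `δ / 2` turns the uniform bound `r⁻ⁿ` into `r⁻ⁿ / (δ /
2) ^ j` for the `j`-th Taylor coefficient, so for every `j` the series converges on the disc of
radius `r`. -/
lemma conv_frobCoeff {q p : Fin 4 → ℝ} {r : ℝ} (hr : 0 < r) (h : Admissible q p) :
    Conv r (frobCoeff q p r) := by
  intro j x hx
  obtain ⟨δ, hδ, hq⟩ := h.exists_radius
  have hb : ∀ n, ‖coeff j (frobCoeff q p r n)‖ ≤ (r⁻¹) ^ n / (δ / 2) ^ j := by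
    intro n
    have hd : DiffContOnCl ℂ (hypRatio q p r n) (Metric.ball 0 (δ / 2)) := by
      refine DifferentiableOn.diffContOnCl fun s hs => ?_
      rw [closure_ball _ (by positivity), mem_closedBall_zero_iff] at hs
      exact (analyticAt_hypRatio (fun k => (hq k).trans (h k).2.le) n
        (by linarith : ‖s‖ < δ)).differentiableAt.differentiableWithinAt
    have h1 := Complex.norm_iteratedDeriv_le_of_forall_mem_sphere_norm_le j (half_pos hδ) hd
      (C := (r⁻¹) ^ n) fun s hs => norm_hypRatio_le hr h hq n (by
        rw [mem_sphere_zero_iff_norm.1 hs]; linarith)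
    rw [frobCoeff, coeff_jet, norm_div, Complex.norm_natCast, div_le_iff₀ (by positivity)]
    refine h1.trans_eq ?_
    ring
  refine Summable.of_norm_bounded (g := fun n => ((δ / 2) ^ j)⁻¹ * (‖x‖ / r) ^ n) ?_ fun n => ?_
  · exact (summable_geometric_of_lt_one (by positivity) ((div_lt_one hr).2 hx)).mul_left _
  · rw [norm_mul, norm_pow]
    refine (mul_le_mul_of_nonneg_right (hb n) (by positivity)).trans_eq ?_
    rw [div_eq_mul_inv, div_pow, inv_pow]
    ring

lemma frobCoeff_succ {q p : Fin 4 → ℝ} {r : ℝ} (h : Admissible q p) (n : ℕ) :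
    (∏ k, (C (p k + n : ℂ) + X)) * frobCoeff q p r (n + 1) =
      C (r : ℂ)⁻¹ * ((∏ k, (C (q k + n : ℂ) + X)) * frobCoeff q p r n) := by
  obtain ⟨δ, hδ, hq⟩ := h.exists_radius
  have hp : ∀ k, δ ≤ p k := fun k => (hq k).trans (h k).2.le
  have h0 : ‖(0 : ℂ)‖ < δ := by simpa using hδ
  have ha : ∀ c : Fin 4 → ℝ, AnalyticAt ℂ (fun s => ∏ k, ((c k + n : ℂ) + s)) 0 := fun c =>
    Finset.analyticAt_fun_prod _ fun k _ => analyticAt_const.add analyticAt_id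
  have hj : ∀ c : Fin 4 → ℝ, jet (fun s => ∏ k, ((c k + n : ℂ) + s)) =
      ∏ k, (C (c k + n : ℂ) + X) := fun c => by
    rw [jet_prod (f := fun k s => (c k + n : ℂ) + s) _ fun k _ => analyticAt_const.add analyticAt_id]
    simp only [jet_const_add]
  have hn := fun m => analyticAt_hypRatio (q := q) (p := p) (r := r) hp m h0
  rw [frobCoeff, frobCoeff, ← hj, ← hj, ← jet_mul (ha p) (hn (n + 1)), ← jet_mul (ha q) (hn n),
    
    ← jet_const_mul (f := fun s => (∏ k, ((q k + n : ℂ) + s)) * hypRatio q p r n s) _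
      ((ha q).mul (hn n))]
  refine jet_congr ?_
  filter_upwards [Metric.ball_mem_nhds (0 : ℂ) hδ] with s hs
  have h1 : hypRatio q p r (n + 1) s = hypRatio q p r n s *
      ((r : ℂ)⁻¹ * ∏ k, ((q k + n : ℂ) + s) * ((p k + n : ℂ) + s)⁻¹) := Finset.prod_range_succ _ _
  rw [h1, Finset.prod_mul_distrib]
  have : (∏ k, ((p k + n : ℂ) + s)) * ∏ k, ((p k + n : ℂ) + s)⁻¹ = 1 := by
    rw [← Finset.prod_mul_distrib]
    exact Finset.prod_eq_one fun k _ =>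
      mul_inv_cancel₀ (shift_ne_zero (hp k) n (mem_ball_zero_iff.1 hs))
  linear_combination (hypRatio q p r n s * (r : ℂ)⁻¹ * ∏ k, ((q k + n : ℂ) + s)) * this

/-- The recursion `frobCoeff_succ` kills all terms beyond the first. What remains is the indicial
polynomial `∏ (ρ + α_k + T)`, which vanishes through order `N` when `ρ` is an exponent of high
enough multiplicity. -/
lemma hyp_logSeries_frobCoeff {α β : Fin 4 → ℝ} {r ρ : ℝ} (hr : 0 < r)
    (h : Admissible (fun k => ρ + β k) (fun k => 1 + ρ + α k)) {N : ℕ}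
    (hN : ∀ j ≤ N, coeff j (∏ k, (C ((ρ + α k : ℝ) : ℂ) + X)) = 0) :
    ∀ x ∈ slitDisc r, hyp α β r (logSeries ρ (ser (frobCoeff (fun k => ρ + β k)
      (fun k => 1 + ρ + α k) r)) N) x = 0 := by
  intro x hx
  set a := frobCoeff (fun k => ρ + β k) (fun k => 1 + ρ + α k) r with ha
  have hc : Conv r a := conv_frobCoeff hr h
  have h1 : ∀ n, hypCoeff α β r ρ a (n + 1) = 0 := by
    intro n
    rw [hypCoeff, if_neg (Nat.succ_ne_zero n), Nat.add_sub_cancel, nablaProd_apply,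
      nablaProd_apply, sub_eq_zero]
    have h2 := frobCoeff_succ (r := r) h n
    rw [← ha] at h2
    have e1 : ∀ k, ((n + 1 : ℕ) : ℂ) + (ρ + α k) = ((1 + ρ + α k : ℝ) : ℂ) + n := fun k => by
      push_cast
      ring
    have e2 : ∀ k, (n : ℂ) + (ρ + β k) = ((ρ + β k : ℝ) : ℂ) + n := fun k => by
      push_cast
      ring
    simp only [e1, e2]
    exact h2
  have h2 : hypCoeff α β r ρ a 0 = ∏ k, (C ((ρ + α k : ℝ) : ℂ) + X) := by
    rw [hypCoeff, if_pos rfl, sub_zero, nablaProd_apply, ha, frobCoeff_zero, mul_one]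
    simp
  rw [hyp_logSeries hc N hx, logSeries_congr (g' := fun _ _ => 0)]
  · simp [logSeries]
  · intro j hj
    rw [ser, tsum_eq_single 0]
    · rw [h2, hN j hj, zero_mul]
    · rintro (_ | n) hn
      · exact absurd rfl hn
      · rw [h1, map_zero, zero_mul]

/-- The difference of two normalized solutions has this shape. Its constant coefficient is zero, and
the recursion multiplies the coefficient `n + 1` by `∏ (n + 1 + ρ + α_k)`, which is non-zero by
positivity: no resonance restarts the series. -/
lemma eqOn_zero_of_hyp_eq_zero {α β : Fin 4 → ℝ} {r ρ : ℝ} (hr : 0 < r)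
    (hα : ∀ k, 0 < 1 + ρ + α k) {h : ℂ → ℂ} (hd : DifferentiableOn ℂ h (Metric.ball 0 r))
    (h0 : h 0 = 0) (hh : ∀ x ∈ slitDisc r, hyp α β r (fun x => x ^ (ρ : ℂ) * h x) x = 0) :
    Set.EqOn h (fun _ => 0) (Metric.ball 0 r) := by
  set c : ℕ → ℂ := fun n => iteratedDeriv n h 0 / (n.factorial : ℂ) with hc
  set a : ℕ → ℂ⟦X⟧ := fun n => C (c n) with ha
  have hs : ∀ x ∈ Metric.ball (0 : ℂ) r, HasSum (fun n => c n * x ^ n) (h x) := by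
    intro x hx
    refine (Complex.hasSum_taylorSeries_on_ball hd hx).congr_fun fun n => ?_
    simp only [hc, sub_zero, smul_eq_mul]
    ring
  have hconv : Conv r a := by
    intro j x hx
    rcases j with _ | j
    · simpa [ha] using (hs x (mem_ball_zero_iff.2 hx)).summable
    · simp [ha, summable_zero]
  have hser : ∀ x ∈ Metric.ball (0 : ℂ) r, ser a 0 x = h x := by
    intro x hx
    rw [← (hs x hx).tsum_eq, ser]
    simp [ha]
  have heq : Set.EqOn (fun x => x ^ (ρ : ℂ) * h x) (logSeries ρ (ser a) 0) (slitDisc r) := by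
    intro x hx
    simp [logSeries, hser x (mem_ball_zero_iff.2 hx.2)]
  have hz : ∀ x ∈ slitDisc r, ∑' n, coeff 0 (hypCoeff α β r ρ a n) * x ^ n = 0 := by
    intro x hx
    have h1 := hh x hx
    rw [hyp_congr (isOpen_slitDisc r) heq hx, hyp_logSeries hconv 0 hx] at h1
    have hx0 : x ≠ 0 := Complex.slitPlane_ne_zero hx.1
    simpa [logSeries, hx0, Complex.cpow_eq_zero_iff, ser] using h1
  have hcoef := eq_zero_of_tsum_eq_zero hr (fun x hx => conv_hypCoeff hconv 0 x hx) hz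
  have hc0 : ∀ n, c n = 0 := by
    intro n
    induction n with
    | zero => simp [hc, h0]
    | succ n ih =>
      have h1 := hcoef (n + 1)
      rw [hypCoeff, if_neg (Nat.succ_ne_zero n), Nat.add_sub_cancel, nablaProd_apply,
        nablaProd_apply] at h1
      simp only [ha, ih, map_zero, mul_zero, sub_zero, coeff_zero_eq_constantCoeff, map_mul,
        map_prod, map_add, constantCoeff_C, constantCoeff_X, add_zero] at h1
      refine (mul_eq_zero.1 h1).resolve_left (Finset.prod_ne_zero_iff.2 fun k _ hk => ?_)
      have h2 := congrArg Complex.re hk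
      simp at h2
      have := hα k
      have hn : (0 : ℝ) ≤ n := n.cast_nonneg
      linarith
  intro x hx
  rw [← (hs x hx).tsum_eq]
  simp [hc0]

/-- On `U` the Picard-Fuchs equation becomes, in the coordinate `x`, a hypergeometric equation on
the slit disc of radius `r`. -/
structure IsCoord (M : Model) (U : Set ℂ) (x : ℂ → ℂ) (r : ℝ) (α β : Fin 4 → ℝ) : Prop where
  isOpen : IsOpen U
  mapsTo : Set.MapsTo x U (slitDisc r)
  surjOn : Set.SurjOn x U (slitDisc r)
  differentiableOn : DifferentiableOn ℂ x U
  iff_hyp : ∀ F, DifferentiableOn ℂ F (slitDisc r) → ∀ z ∈ U,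
    (picardFuchs M (F ∘ x) z = 0 ↔ hyp α β r F (x z) = 0)

lemma picardFuchs_eq (M : Model) (f : ℂ → ℂ) (z : ℂ) :
    picardFuchs M f z = thetaProd 0 f z - (M.mu : ℂ)⁻¹ * z * thetaProd M.a f z := by
  simp [picardFuchs, thetaProd]

lemma picardFuchs_congr {M : Model} {U : Set ℂ} (hU : IsOpen U) {f g : ℂ → ℂ}
    (h : Set.EqOn f g U) : Set.EqOn (picardFuchs M f) (picardFuchs M g) U := fun z hz => by
  rw [picardFuchs_eq, picardFuchs_eq, thetaProd_congr hU _ h hz, thetaProd_congr hU _ h hz]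

lemma IsSolutionOn.congr {M : Model} {U : Set ℂ} (hU : IsOpen U) {f g : ℂ → ℂ}
    (hf : IsSolutionOn M U f) (h : Set.EqOn f g U) : IsSolutionOn M U g :=
  ⟨hf.1.congr h.symm, fun z hz => (picardFuchs_congr hU h hz).symm.trans (hf.2 z hz)⟩

lemma isCoord_zero (M : Model) : IsCoord M {z | z ∈ Complex.slitPlane ∧ ‖z‖ < M.mu} (fun z => z)
    M.mu 0 M.a where
  isOpen := isOpen_slitDisc M.mu
  mapsTo := fun _ h => h
  surjOn := fun z h => ⟨z, h, rfl⟩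
  differentiableOn := differentiableOn_id
  iff_hyp := fun F _ z _ => by
    rw [picardFuchs_eq]
    rfl

lemma differentiableOn_thetaAdd {U : Set ℂ} (hU : IsOpen U) (c : ℂ) {f : ℂ → ℂ}
    (hf : DifferentiableOn ℂ f U) : DifferentiableOn ℂ (thetaAdd c f) U :=
  (differentiableOn_id.mul (hf.deriv hU)).add (hf.const_mul c)

lemma thetaAdd_comp_div {r lam : ℝ} (c e : ℂ) {F : ℂ → ℂ} (hF : DifferentiableOn ℂ F (slitDisc r))
    {z : ℂ} (hz0 : z ≠ 0) (hz : (lam : ℂ) / z ∈ slitDisc r) :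
    thetaAdd c (fun z => e * F (lam / z)) z = -e * thetaAdd (-c) F (lam / z) := by
  have h1 : HasDerivAt F (deriv F (lam / z)) (lam / z) :=
    (hF.differentiableAt ((isOpen_slitDisc r).mem_nhds hz)).hasDerivAt
  have h2 : HasDerivAt (fun z : ℂ => (lam : ℂ) / z) (-(lam : ℂ) / z ^ 2) z := by
    simpa [div_eq_mul_inv] using (hasDerivAt_inv hz0).const_mul (lam : ℂ)
  have h3 := (h1.comp z h2).const_mul e
  simp only [thetaAdd]
  rw [show deriv (fun z => e * F (lam / z)) z = _ from h3.deriv]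
  field_simp
  ring

lemma thetaProd_comp_div {U : Set ℂ} (hU : IsOpen U) {r lam : ℝ}
    (hmap : Set.MapsTo (fun z => (lam : ℂ) / z) U (slitDisc r)) (h0 : (0 : ℂ) ∉ U)
    (c : Fin 4 → ℝ) {F : ℂ → ℂ} (hF : DifferentiableOn ℂ F (slitDisc r)) :
    Set.EqOn (thetaProd c (F ∘ fun z => (lam : ℂ) / z))
      (fun z => thetaProd (fun k => -c k) F (lam / z)) U := by
  have hD := isOpen_slitDisc r
  have key : ∀ (c e : ℂ) (F : ℂ → ℂ), DifferentiableOn ℂ F (slitDisc r) →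
      Set.EqOn (thetaAdd c (fun z => e * F (lam / z)))
        (fun z => -e * thetaAdd (-c) F (lam / z)) U := fun c e F hF z hz =>
    thetaAdd_comp_div c e hF (fun h => h0 (h ▸ hz)) (hmap hz)
  have d3 := differentiableOn_thetaAdd hD (-(c 3 : ℂ)) hF
  have d2 := differentiableOn_thetaAdd hD (-(c 2 : ℂ)) d3
  have d1 := differentiableOn_thetaAdd hD (-(c 1 : ℂ)) d2
  -- The scalar `e` in `key` records the accumulated sign; after four factors it is `+1` again.
  have h3 := key (c 3) 1 F hF
  have h2 := (thetaAdd_congr hU (c 2) h3).trans (key (c 2) (-1) _ d3)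
  have h1 := (thetaAdd_congr hU (c 1) h2).trans (key (c 1) (- -1) _ d2)
  have h := (thetaAdd_congr hU (c 0) h1).trans (key (c 0) (- - -1) _ d1)
  intro z hz
  have h4 := h hz
  simp only [neg_neg, one_mul] at h4
  simp only [thetaProd, Complex.ofReal_neg]
  exact h4

/-- Under `x = lam / z` the operator `θ` changes sign, so `θ + a_k` becomes `-(θ - a_k)`.
Multiplying the equation by `-μ x / lam` then exchanges the roles of the two products; the exponents
become the `a_k` and the radius `lam / μ`. -/
lemma isCoord_infinity {M : Model} (hmu : 0 < M.mu) {lam : ℝ} (hlam : 0 < lam) :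
    IsCoord M {z | z ∈ Complex.slitPlane ∧ M.mu < ‖z‖} (fun z => (lam : ℂ) / z) (lam / M.mu)
      (fun k => -M.a k) 0 := by
  have hU : IsOpen {z | z ∈ Complex.slitPlane ∧ M.mu < ‖z‖} :=
    Complex.isOpen_slitPlane.inter (isOpen_lt continuous_const continuous_norm)
  have h0 : (0 : ℂ) ∉ {z | z ∈ Complex.slitPlane ∧ M.mu < ‖z‖} := fun h =>
    Complex.slitPlane_ne_zero h.1 rfl
  have hslit : ∀ z ∈ Complex.slitPlane, (lam : ℂ) / z ∈ Complex.slitPlane := by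
    intro z hz
    have h2 : 0 < Complex.normSq z := Complex.normSq_pos.2 (Complex.slitPlane_ne_zero hz)
    rw [Complex.mem_slitPlane_iff] at hz ⊢
    rw [div_eq_mul_inv, Complex.re_ofReal_mul, Complex.im_ofReal_mul, Complex.inv_re,
      Complex.inv_im]
    rcases hz with h1 | h1
    · exact Or.inl (by positivity)
    · exact Or.inr (mul_ne_zero hlam.ne' (div_ne_zero (neg_ne_zero.2 h1) h2.ne'))
  have hmap : Set.MapsTo (fun z => (lam : ℂ) / z) {z | z ∈ Complex.slitPlane ∧ M.mu < ‖z‖}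
      (slitDisc (lam / M.mu)) := by
    rintro z ⟨hz1, hz2⟩
    refine ⟨hslit z hz1, ?_⟩
    rw [norm_div, Complex.norm_real, Real.norm_of_nonneg hlam.le]
    exact div_lt_div_of_pos_left hlam hmu hz2
  refine ⟨hU, hmap, ?_, ?_, ?_⟩
  · rintro x ⟨hx1, hx2⟩
    have hx0 : 0 < ‖x‖ := norm_pos_iff.2 (Complex.slitPlane_ne_zero hx1)
    refine ⟨lam / x, ⟨hslit x hx1, ?_⟩, ?_⟩
    · rw [norm_div, Complex.norm_real, Real.norm_of_nonneg hlam.le]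
      rw [lt_div_iff₀ hmu] at hx2
      rw [lt_div_iff₀ hx0]
      linarith
    · have : (lam : ℂ) ≠ 0 := by exact_mod_cast hlam.ne'
      exact div_div_cancel₀ this
  · exact fun z hz => ((differentiableAt_const _).div differentiableAt_id
      (Complex.slitPlane_ne_zero hz.1)).differentiableWithinAt
  · intro F hF z hz
    have hz0 : z ≠ 0 := Complex.slitPlane_ne_zero hz.1
    rw [picardFuchs_eq, thetaProd_comp_div hU hmap h0 _ hF hz,
      thetaProd_comp_div hU hmap h0 _ hF hz, hyp]
    have h1 : (M.mu : ℂ) ≠ 0 := by exact_mod_cast hmu.ne'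
    have h2 : (lam : ℂ) ≠ 0 := by exact_mod_cast hlam.ne'
    have h3 : (fun k => -(0 : Fin 4 → ℝ) k) = 0 := by funext k; simp
    rw [h3]
    push_cast
    rw [sub_eq_zero, sub_eq_zero]
    constructor
    · intro h
      rw [h]
      field_simp
    · intro h
      rw [h]
      field_simp

lemma thetaProd_sub {U : Set ℂ} (hU : IsOpen U) (c : Fin 4 → ℝ) {f g : ℂ → ℂ}
    (hf : DifferentiableOn ℂ f U) (hg : DifferentiableOn ℂ g U) :
    Set.EqOn (thetaProd c (fun x => f x - g x)) (fun x => thetaProd c f x - thetaProd c g x) U := by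
  have key : ∀ (c : ℂ) (f g : ℂ → ℂ), DifferentiableOn ℂ f U → DifferentiableOn ℂ g U →
      Set.EqOn (thetaAdd c (fun x => f x - g x)) (fun x => thetaAdd c f x - thetaAdd c g x) U := by
    intro c f g hf hg x hx
    have h1 := hf.differentiableAt (hU.mem_nhds hx)
    have h2 := hg.differentiableAt (hU.mem_nhds hx)
    simp only [thetaAdd, deriv_fun_sub h1 h2]
    ring
  have hd := fun c (f : ℂ → ℂ) hf => differentiableOn_thetaAdd hU c (f := f) hf
  have h3 := key (c 3) f g hf hg
  have h2 := (thetaAdd_congr hU (c 2) h3).trans (key (c 2) _ _ (hd _ _ hf) (hd _ _ hg))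
  have h1 := (thetaAdd_congr hU (c 1) h2).trans
    (key (c 1) _ _ (hd _ _ (hd _ _ hf)) (hd _ _ (hd _ _ hg)))
  exact (thetaAdd_congr hU (c 0) h1).trans
    (key (c 0) _ _ (hd _ _ (hd _ _ (hd _ _ hf))) (hd _ _ (hd _ _ (hd _ _ hg))))

lemma hyp_sub {α β : Fin 4 → ℝ} {r : ℝ} {f g : ℂ → ℂ} (hf : DifferentiableOn ℂ f (slitDisc r))
    (hg : DifferentiableOn ℂ g (slitDisc r)) {x : ℂ} (hx : x ∈ slitDisc r) :
    hyp α β r (fun x => f x - g x) x = hyp α β r f x - hyp α β r g x := by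
  simp only [hyp, thetaProd_sub (isOpen_slitDisc r) α hf hg hx,
    thetaProd_sub (isOpen_slitDisc r) β hf hg hx]
  ring

/-- The coefficients `g ρ j` of the normalized Frobenius basis. -/
noncomputable def frobSeries (α β : Fin 4 → ℝ) (r ρ : ℝ) : ℕ → ℂ → ℂ :=
  ser (frobCoeff (fun k => ρ + β k) (fun k => 1 + ρ + α k) r)

open Classical in
theorem IsCoord.isFrobeniusBasis {M : Model} {U : Set ℂ} {x : ℂ → ℂ} {r : ℝ} {α β : Fin 4 → ℝ}
    (hx : IsCoord M U x r α β) (hr : 0 < r) {ρ : Fin 4 → ℝ} {n : Fin 4 → ℕ}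
    (hadm : ∀ i, Admissible (fun k => ρ i + β k) (fun k => 1 + ρ i + α k))
    (hn : ∀ i, ∀ j ≤ n i, coeff j (∏ k, (C ((ρ i + α k : ℝ) : ℂ) + X)) = 0)
    {B : Fin 4 → ℂ → ℂ}
    (hB : ∀ i, ∀ z ∈ U, B i z = logSeries (ρ i) (frobSeries α β r (ρ i)) (n i) (x z)) :
    IsFrobeniusBasis M U x r ρ n B := by
  have hd : ∀ i j, DifferentiableOn ℂ (frobSeries α β r (ρ i) j) (Metric.ball 0 r) := fun i j =>
    (conv_frobCoeff hr (hadm i)).differentiableOn j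
  have h0 : ∀ s j, frobSeries α β r s j 0 = if j = 0 then 1 else 0 := by
    intro s j
    rw [frobSeries, ser, tsum_eq_single 0 (fun n hn => by simp [hn]), frobCoeff_zero,
      PowerSeries.coeff_one]
    simp
  -- Series are demanded at every real exponent; away from the `ρ i` the constants `1` and `0` serve
  -- as normalized placeholders.
  refine ⟨fun s => if ∃ i, ρ i = s then frobSeries α β r s else
    fun j _ => if j = 0 then 1 else 0, ?_, ?_, ?_, fun i => ⟨?_, ?_⟩⟩
  · intro s j
    dsimp only
    by_cases hs : ∃ i, ρ i = s
    · rw [if_pos hs]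
      obtain ⟨i, rfl⟩ := hs
      exact hd i j
    · rw [if_neg hs]
      exact differentiableOn_const _
  · intro s
    dsimp only
    by_cases hs : ∃ i, ρ i = s
    · rw [if_pos hs, h0, if_pos rfl]
    · rw [if_neg hs, if_pos rfl]
  · intro s j hj
    have hj0 : j ≠ 0 := by omega
    dsimp only
    by_cases hs : ∃ i, ρ i = s
    · rw [if_pos hs, h0, if_neg hj0]
    · rw [if_neg hs, if_neg hj0]
  · have hF := differentiableOn_logSeries (ρ := ρ i) (hd i) (n i)
    have hsol : IsSolutionOn M U (logSeries (ρ i) (frobSeries α β r (ρ i)) (n i) ∘ x) :=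
      ⟨hF.comp hx.differentiableOn hx.mapsTo, fun z hz => (hx.iff_hyp _ hF z hz).2
        (hyp_logSeries_frobCoeff hr (hadm i) (hn i) _ (hx.mapsTo hz))⟩
    exact hsol.congr hx.isOpen fun z hz => (hB i z hz).symm
  · intro z hz
    dsimp only
    rw [if_pos ⟨i, rfl⟩]
    exact hB i z hz

/-- Induction on the logarithmic order. By `hn` the lower orders of the same exponent belong to the
basis, so their series agree already, and the difference of two members of order `N` is `x ^ ρ`
times a holomorphic function vanishing at `0`. Such a solution is zero by
`eqOn_zero_of_hyp_eq_zero`. -/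
theorem IsCoord.eqOn_of_isFrobeniusBasis {M : Model} {U : Set ℂ} {x : ℂ → ℂ} {r : ℝ}
    {α β : Fin 4 → ℝ} (hx : IsCoord M U x r α β) (hr : 0 < r) {ρ : Fin 4 → ℝ} {n : Fin 4 → ℕ}
    (hα : ∀ i k, 0 < 1 + ρ i + α k) (hn : ∀ i, ∀ j < n i, ∃ i', ρ i' = ρ i ∧ n i' = j)
    {B B' : Fin 4 → ℂ → ℂ} (hB : IsFrobeniusBasis M U x r ρ n B)
    (hB' : IsFrobeniusBasis M U x r ρ n B') (i : Fin 4) : Set.EqOn (B i) (B' i) U := by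
  obtain ⟨g, hg1, hg2, hg3, hg4⟩ := hB
  obtain ⟨g', hg1', hg2', hg3', hg4'⟩ := hB'
  have key : ∀ N, ∀ i, n i = N → Set.EqOn (g (ρ i) N) (g' (ρ i) N) (Metric.ball 0 r) := by
    intro N
    induction N using Nat.strong_induction_on with
    | _ N ih =>
      intro i hi
      have hlow : ∀ j < N, Set.EqOn (g (ρ i) j) (g' (ρ i) j) (Metric.ball 0 r) := by
        intro j hj
        obtain ⟨i', h1, h2⟩ := hn i j (hi ▸ hj)
        rw [← h1]
        exact ih j hj i' h2
      have hdiff : DifferentiableOn ℂ (fun x => g (ρ i) N x - g' (ρ i) N x) (Metric.ball 0 r) :=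
        (hg1 _ _).sub (hg1' _ _)
      have hz : g (ρ i) N 0 - g' (ρ i) N 0 = 0 := by
        rcases Nat.eq_zero_or_pos N with h | h
        · rw [h, hg2, hg2', sub_self]
        · rw [hg3 _ _ h, hg3' _ _ h, sub_self]
      have hF : Set.EqOn (fun x => logSeries (ρ i) (g (ρ i)) N x - logSeries (ρ i) (g' (ρ i)) N x)
          (fun x => x ^ (ρ i : ℂ) * (g (ρ i) N x - g' (ρ i) N x)) (slitDisc r) := by
        intro y hy
        simp only [logSeries]
        rw [← mul_sub, ← Finset.sum_sub_distrib, Finset.sum_range_succ, Finset.sum_eq_zero]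
        · simp
        · intro j hj
          rw [hlow j (Finset.mem_range.1 hj) (mem_ball_zero_iff.2 hy.2), sub_self]
      have hsol : ∀ (G : ℝ → ℕ → ℂ → ℂ) (D : Fin 4 → ℂ → ℂ),
          (∀ s j, DifferentiableOn ℂ (G s j) (Metric.ball 0 r)) →
          (∀ i, IsSolutionOn M U (D i) ∧ ∀ z ∈ U, D i z = logSeries (ρ i) (G (ρ i)) (n i) (x z)) →
          ∀ y ∈ slitDisc r, hyp α β r (logSeries (ρ i) (G (ρ i)) N) y = 0 := by
        intro G D hG hD y hy
        obtain ⟨z, hz, rfl⟩ := hx.surjOn hy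
        have h1 := ((hD i).1.congr hx.isOpen (hD i).2).2 z hz
        rw [hi] at h1
        exact (hx.iff_hyp _ (differentiableOn_logSeries (hG _) N) z hz).1 h1
      have hsub : ∀ y ∈ slitDisc r,
          hyp α β r (fun x => x ^ (ρ i : ℂ) * (g (ρ i) N x - g' (ρ i) N x)) y = 0 := by
        intro y hy
        rw [← hyp_congr (isOpen_slitDisc r) hF hy,
          hyp_sub (differentiableOn_logSeries (hg1 _) N) (differentiableOn_logSeries (hg1' _) N) hy,
          hsol g B hg1 hg4 y hy, hsol g' B' hg1' hg4' y hy, sub_self]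
      intro y hy
      exact sub_eq_zero.1 (eqOn_zero_of_hyp_eq_zero hr (hα i) hdiff hz hsub hy)
  intro z hz
  rw [(hg4 i).2 z hz, (hg4' i).2 z hz]
  refine logSeries_congr fun j hj => ?_
  have hz' : x z ∈ Metric.ball (0 : ℂ) r := mem_ball_zero_iff.2 (hx.mapsTo hz).2
  rcases hj.lt_or_eq with hj | hj
  · obtain ⟨i', h1, h2⟩ := hn i j hj
    rw [← h1]
    exact key j i' h2 hz'
  · exact key j i hj.symm hz'

end CYPeriods

/-! ### Periodic kernels with poles at the integers, and their growth. -/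

namespace CYPeriods

open Filter Topology PowerSeries MeasureTheory

/-- The function `1 / (e^{ws} - 1)`. -/
noncomputable def kerE (w s : ℂ) : ℂ := (Complex.exp (w * s) - 1)⁻¹

/-- The polynomials in `1 / (e^{ws} - 1)` which are the normalized derivatives of
`w / (e^{ws} - 1)`. -/
noncomputable def kerPoly (w : ℂ) (j : ℕ) (E : ℂ) : ℂ :=
  match j with
  | 0 => w * E
  | 1 => w ^ 2 * (E + E ^ 2)
  | 2 => w ^ 3 / 2 * (E + 3 * E ^ 2 + 2 * E ^ 3)
  | 3 => w ^ 4 / 6 * (E + 7 * E ^ 2 + 12 * E ^ 3 + 6 * E ^ 4)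
  | _ => 0

/-- A function with period `2πi / w` and with principal part `s^{-(j + 1)}` at `0`, for `j ≤ 3`. -/
noncomputable def ker (w : ℂ) (j : ℕ) (s : ℂ) : ℂ := kerPoly w j (kerE w s)

lemma hasDerivAt_kerE {w s : ℂ} (h : Complex.exp (w * s) ≠ 1) :
    HasDerivAt (kerE w) (-w * (kerE w s + kerE w s ^ 2)) s := by
  have h0 : Complex.exp (w * s) - 1 ≠ 0 := sub_ne_zero.2 h
  have h1 : HasDerivAt (fun s => Complex.exp (w * s) - 1) (Complex.exp (w * s) * w) s := by
    simpa using (((hasDerivAt_id s).const_mul w).cexp).sub_const 1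
  refine (h1.inv h0).congr_deriv ?_
  rw [kerE]
  field_simp
  ring

lemma hasDerivAt_kerPoly (w E : ℂ) {j : ℕ} (hj : j < 3) :
    HasDerivAt (kerPoly w j) (match j with
      | 0 => w
      | 1 => w ^ 2 * (1 + 2 * E)
      | _ => w ^ 3 / 2 * (1 + 6 * E + 6 * E ^ 2)) E := by
  have h1 := hasDerivAt_id E
  interval_cases j
  · have := h1.const_mul w
    rw [mul_one] at this
    exact this
  · have := (h1.add (h1.pow 2)).const_mul (w ^ 2)
    refine this.congr_deriv ?_
    simp
  · have := ((h1.add ((h1.pow 2).const_mul 3)).add ((h1.pow 3).const_mul 2)).const_mul (w ^ 3 / 2)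
    refine this.congr_deriv ?_
    simp
    left
    ring

/-- The equation `E' = -w (E + E²)` for `E = kerE w` makes every derivative of `w E` a polynomial in
`E`; the polynomials `kerPoly` are these derivatives, divided by `(-1)^j j!`. -/
lemma hasDerivAt_ker {w s : ℂ} (h : Complex.exp (w * s) ≠ 1) {j : ℕ} (hj : j < 3) :
    HasDerivAt (ker w j) (-(j + 1) * ker w (j + 1) s) s := by
  refine ((hasDerivAt_kerPoly w (kerE w s) hj).comp s (hasDerivAt_kerE h)).congr_deriv ?_
  simp only [ker]
  generalize kerE w s = E
  interval_cases j <;> simp [kerPoly] <;> ring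

lemma continuous_kerPoly (w : ℂ) (j : ℕ) : Continuous (kerPoly w j) := by
  rcases j with _ | _ | _ | _ | j <;> unfold kerPoly <;> fun_prop

lemma differentiable_kerPoly (w : ℂ) (j : ℕ) : Differentiable ℂ (kerPoly w j) := by
  rcases j with _ | _ | _ | _ | j <;> unfold kerPoly <;> fun_prop

lemma differentiableAt_ker {w s : ℂ} (h : Complex.exp (w * s) ≠ 1) (j : ℕ) :
    DifferentiableAt ℂ (ker w j) s :=
  (differentiable_kerPoly w j _).comp s (hasDerivAt_kerE h).differentiableAt

lemma eventually_exp_ne_one {w : ℂ} (hw : w ≠ 0) :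
    ∀ᶠ s in 𝓝[≠] (0 : ℂ), Complex.exp (w * s) ≠ 1 := by
  have h1 : HasDerivAt (fun s => Complex.exp (w * s)) w 0 := by
    simpa using ((hasDerivAt_id (0 : ℂ)).const_mul w).cexp
  simpa using h1.eventually_ne hw (c := 1)

/-- For `j = 0` the factorization `e^{ws} - 1 = s (w + s F(s))` gives the simple pole.
Differentiation then raises the pole without creating terms of lower order. -/
lemma ker_principal_part {w : ℂ} (hw : w ≠ 0) {j : ℕ} (hj : j < 4) :
    ∃ k : ℂ → ℂ, AnalyticAt ℂ k 0 ∧ ∀ᶠ s in 𝓝[≠] (0 : ℂ), ker w j s = (s ^ (j + 1))⁻¹ + k s := by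
  induction j with
  | zero =>
    have hexp : AnalyticAt ℂ (fun s => Complex.exp (w * s)) 0 := by fun_prop
    obtain ⟨F, hF, h1⟩ := jet_taylor hexp 2
    have hD : AnalyticAt ℂ (fun s => w * (w + s * F s)⁻¹) 0 := by
      refine analyticAt_const.mul ((analyticAt_const.add (analyticAt_id.mul hF)).inv ?_)
      simpa using hw
    obtain ⟨k, hk, h2⟩ := jet_taylor hD 1
    refine ⟨k, hk, ?_⟩
    have hne : ∀ᶠ s in 𝓝[≠] (0 : ℂ), w + s * F s ≠ 0 := by
      have hc : ContinuousAt (fun s => w + s * F s) 0 :=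
        continuousAt_const.add (continuousAt_id.mul hF.continuousAt)
      exact (hc.eventually_ne (by simpa using hw)).filter_mono nhdsWithin_le_nhds
    filter_upwards [self_mem_nhdsWithin, hne] with s hs hs'
    have hs0 : s ≠ 0 := hs
    have h3 := h1 s
    have h4 := h2 s
    simp only [Finset.sum_range_succ, Finset.range_one, Finset.sum_singleton, coeff_jet_exp] at h3
    rw [Finset.range_one, Finset.sum_singleton, coeff_zero_jet] at h4
    simp at h3 h4
    rw [ker, kerPoly, kerE, h3]
    have h5 : 1 + w * s + s ^ 2 * F s - 1 = s * (w + s * F s) := by ring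
    rw [h5, mul_inv, mul_left_comm, h4, mul_inv_cancel₀ hw]
    field_simp
    ring
  | succ j ih =>
    obtain ⟨k, hk, h⟩ := ih (by omega)
    refine ⟨fun s => -(j + 1 : ℂ)⁻¹ * deriv k s, analyticAt_const.mul hk.deriv, ?_⟩
    have hd := EventuallyEq.nhdsNE_deriv (show ker w j =ᶠ[𝓝[≠] 0] _ from h)
    have hka : ∀ᶠ s in 𝓝[≠] (0 : ℂ), AnalyticAt ℂ k s :=
      hk.eventually_analyticAt.filter_mono nhdsWithin_le_nhds
    filter_upwards [hd, eventually_exp_ne_one hw, hka, self_mem_nhdsWithin] with s h1 h2 h3 h4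
    have hs0 : s ≠ 0 := h4
    rw [(hasDerivAt_ker h2 (by omega)).deriv] at h1
    have h5 : HasDerivAt (fun s : ℂ => (s ^ (j + 1))⁻¹ + k s)
        (-((j + 1 : ℕ) * s ^ j) / (s ^ (j + 1)) ^ 2 + deriv k s) s := by
      have := (hasDerivAt_pow (j + 1) s).inv (pow_ne_zero _ hs0)
      exact this.add h3.differentiableAt.hasDerivAt
    rw [h5.deriv] at h1
    have hj0 : (j + 1 : ℂ) ≠ 0 := by exact_mod_cast j.succ_ne_zero
    have h6 : ker w (j + 1) s = -(j + 1 : ℂ)⁻¹ *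
        (-((j + 1 : ℕ) * s ^ j) / (s ^ (j + 1)) ^ 2 + deriv k s) := by
      rw [← h1]
      field_simp
    rw [h6]
    push_cast
    field_simp
    ring

/-- Subtracting multiples of the kernels removes the pole at `0` of a kernel times an analytic
function. -/
lemma exists_analyticAt_mul_ker_sub {w : ℂ} (hw : w ≠ 0) {j : ℕ} (hj : j < 4) {H : ℂ → ℂ}
    (hH : AnalyticAt ℂ H 0) : ∃ k : ℂ → ℂ, AnalyticAt ℂ k 0 ∧ ∀ᶠ s in 𝓝[≠] (0 : ℂ),
      H s * ker w j s - ∑ i ∈ Finset.range (j + 1), coeff i (jet H) * ker w (j - i) s = k s := by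
  obtain ⟨F, hF, h1⟩ := jet_taylor hH (j + 1)
  have h2 : ∀ i, ∃ k : ℂ → ℂ, AnalyticAt ℂ k 0 ∧
      ∀ᶠ s in 𝓝[≠] (0 : ℂ), ker w (j - i) s = (s ^ (j - i + 1))⁻¹ + k s :=
    fun i => ker_principal_part hw (by omega)
  choose k hk h2 using h2
  refine ⟨fun s => F s + H s * k 0 s - ∑ i ∈ Finset.range (j + 1), coeff i (jet H) * k i s,
    (hF.add (hH.mul (hk 0))).sub (Finset.analyticAt_fun_sum _ fun i _ =>
      analyticAt_const.mul (hk i)), ?_⟩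
  have h3 : ∀ᶠ s in 𝓝[≠] (0 : ℂ), ∀ i ∈ Finset.range (j + 1),
      ker w (j - i) s = (s ^ (j - i + 1))⁻¹ + k i s :=
    (eventually_all_finset _).2 fun i _ => h2 i
  filter_upwards [h3, self_mem_nhdsWithin] with s hs hs0
  have hs0 : s ≠ 0 := hs0
  rw [Finset.sum_congr rfl fun i hi => by rw [hs i hi]]
  have h4 := hs 0 (by simp)
  simp only [Nat.sub_zero] at h4
  rw [h4]
  -- Only the Taylor coefficients of `H` through order `j` meet the pole; the rest of the expansion
  -- is the analytic part `F`.
  have h5 : H s * (s ^ (j + 1))⁻¹ =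
      (∑ i ∈ Finset.range (j + 1), coeff i (jet H) * (s ^ (j - i + 1))⁻¹) + F s := by
    rw [h1 s, add_mul, Finset.sum_mul]
    congr 1
    · refine Finset.sum_congr rfl fun i hi => ?_
      have hi' := Finset.mem_range.1 hi
      obtain ⟨m, rfl⟩ : ∃ m, j = i + m := ⟨j - i, by omega⟩
      rw [show i + m - i + 1 = m + 1 by omega, show i + m + 1 = i + (m + 1) by ring, pow_add]
      field_simp
    · field_simp
  simp only [mul_add, Finset.sum_add_distrib]
  rw [h5]
  ring

/-- The number `±2πi`, where `ε = ±1`. -/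
noncomputable def wt (ε : ℝ) : ℂ := 2 * Real.pi * ε * Complex.I

lemma wt_ne_zero {ε : ℝ} (hε : ε = 1 ∨ ε = -1) : wt ε ≠ 0 := by
  rcases hε with rfl | rfl <;> simp [wt, Real.pi_ne_zero]

lemma exp_wt {ε : ℝ} (hε : ε = 1 ∨ ε = -1) : Complex.exp (wt ε) = 1 := by
  rcases hε with rfl | rfl
  · simp [wt, Complex.exp_two_pi_mul_I]
  · rw [wt]
    push_cast
    rw [show (2 * Real.pi * -1 * Complex.I : ℂ) = -(2 * Real.pi * Complex.I) by ring,
      Complex.exp_neg, Complex.exp_two_pi_mul_I, inv_one]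

lemma kerE_add_nat {ε : ℝ} (hε : ε = 1 ∨ ε = -1) (s : ℂ) (n : ℕ) :
    kerE (wt ε) (s + n) = kerE (wt ε) s := by
  rw [kerE, kerE, mul_add, Complex.exp_add, mul_comm (wt ε) (n : ℂ), Complex.exp_nat_mul,
    exp_wt hε, one_pow, mul_one]

lemma ker_add_nat {ε : ℝ} (hε : ε = 1 ∨ ε = -1) (j : ℕ) (s : ℂ) (n : ℕ) :
    ker (wt ε) j (s + n) = ker (wt ε) j s := by
  rw [ker, ker, kerE_add_nat hε]

lemma exp_wt_mul_eq_one_iff {ε : ℝ} (hε : ε = 1 ∨ ε = -1) {s : ℂ} :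
    Complex.exp (wt ε * s) = 1 ↔ ∃ n : ℤ, s = n := by
  have h0 : (2 * Real.pi * Complex.I : ℂ) ≠ 0 := Complex.two_pi_I_ne_zero
  rw [Complex.exp_eq_one_iff]
  constructor
  · rintro ⟨n, hn⟩
    rcases hε with rfl | rfl
    · refine ⟨n, mul_left_cancel₀ h0 ?_⟩
      rw [wt] at hn
      push_cast at hn
      linear_combination hn
    · refine ⟨-n, mul_left_cancel₀ h0 ?_⟩
      rw [wt] at hn
      push_cast at hn ⊢
      linear_combination -hn
  · rintro ⟨n, rfl⟩
    rcases hε with rfl | rfl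
    · exact ⟨n, by rw [wt]; push_cast; ring⟩
    · exact ⟨-n, by rw [wt]; push_cast; ring⟩

lemma exp_wt_mul_ne_one {ε : ℝ} (hε : ε = 1 ∨ ε = -1) {s : ℂ} (h1 : -1 < s.re) (h2 : s.re < 1)
    (hs : s ≠ 0) : Complex.exp (wt ε * s) ≠ 1 := by
  rw [Ne, exp_wt_mul_eq_one_iff hε]
  rintro ⟨n, rfl⟩
  simp only [Complex.intCast_re] at h1 h2
  have h3 : -1 < n := by exact_mod_cast h1
  have h4 : n < 1 := by exact_mod_cast h2
  exact hs (by rw [show n = 0 by omega, Int.cast_zero])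

lemma norm_exp_wt (ε : ℝ) (s : ℂ) :
    ‖Complex.exp (wt ε * s)‖ = Real.exp (-(2 * Real.pi * ε * s.im)) := by
  rw [Complex.norm_exp]
  congr 1
  simp [wt]

lemma norm_kerPoly_le (w : ℂ) (j : ℕ) (D : ℝ) :
    ∃ K, 0 ≤ K ∧ ∀ E : ℂ, ‖E‖ ≤ D → ‖kerPoly w j E‖ ≤ K * ‖E‖ := by
  have key : ∃ g : ℂ → ℂ, Continuous g ∧ ∀ E, kerPoly w j E = g E * E := by
    rcases j with _ | _ | _ | _ | j
    · exact ⟨fun _ => w, by fun_prop, fun E => rfl⟩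
    · exact ⟨fun E => w ^ 2 * (1 + E), by fun_prop, fun E => by rw [kerPoly]; ring⟩
    · exact ⟨fun E => w ^ 3 / 2 * (1 + 3 * E + 2 * E ^ 2), by fun_prop, fun E => by
        rw [kerPoly]; ring⟩
    · exact ⟨fun E => w ^ 4 / 6 * (1 + 7 * E + 12 * E ^ 2 + 6 * E ^ 3), by fun_prop, fun E => by
        rw [kerPoly]; ring⟩
    · exact ⟨fun _ => 0, by fun_prop, fun E => by simp [kerPoly]⟩
  obtain ⟨g, hg, h⟩ := key
  obtain ⟨K, hK⟩ := (isCompact_closedBall (0 : ℂ) D).exists_bound_of_continuousOn hg.continuousOn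
  refine ⟨max K 0, le_max_right _ _, fun E hE => ?_⟩
  rw [h, norm_mul]
  gcongr
  exact (hK E (mem_closedBall_zero_iff.2 hE)).trans (le_max_left _ _)

/-- Each `kerPoly` is divisible by `E`. Where `e^{ws} - 1` is comparable with `max 1 |e^{ws}|`, the
kernel is therefore bounded towards one end of the strip and exponentially small towards the other.
-/
lemma norm_ker_le (ε : ℝ) (j : ℕ) {d : ℝ} (hd : 0 < d) :
    ∃ K, 0 ≤ K ∧ ∀ s : ℂ, d * max 1 ‖Complex.exp (wt ε * s)‖ ≤ ‖Complex.exp (wt ε * s) - 1‖ →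
      ‖ker (wt ε) j s‖ ≤ K * min 1 (Real.exp (2 * Real.pi * ε * s.im)) := by
  obtain ⟨K, hK0, hK⟩ := norm_kerPoly_le (wt ε) j d⁻¹
  refine ⟨K * d⁻¹, by positivity, fun s hs => ?_⟩
  have hm : 0 < max 1 ‖Complex.exp (wt ε * s)‖ := lt_max_of_lt_left one_pos
  have hE : ‖kerE (wt ε) s‖ ≤ d⁻¹ * (max 1 ‖Complex.exp (wt ε * s)‖)⁻¹ := by
    rw [kerE, norm_inv, ← mul_inv]
    exact inv_anti₀ (mul_pos hd hm) hs
  have h1 : (max 1 ‖Complex.exp (wt ε * s)‖)⁻¹ ≤ min 1 (Real.exp (2 * Real.pi * ε * s.im)) := by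
    refine le_min ?_ ?_
    · exact inv_le_one_of_one_le₀ (le_max_left _ _)
    · rw [norm_exp_wt, ← neg_neg (2 * Real.pi * ε * s.im), Real.exp_neg (-(2 * _ * _ * _)), neg_neg]
      exact inv_anti₀ (Real.exp_pos _) (le_max_right _ _)
  have hE' : ‖kerE (wt ε) s‖ ≤ d⁻¹ := hE.trans (mul_le_of_le_one_right (by positivity)
    (inv_le_one_of_one_le₀ (le_max_left _ _)))
  refine (hK _ hE').trans ?_
  rw [mul_assoc]
  gcongr
  exact hE.trans (by gcongr)

/-- On the line, `e^{ws}` stays on a fixed ray, which is not the positive real axis because `c` is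
not an integer. If `k` is the cosine of its angle and `R` the modulus, then `R² - 2Rk + 1 ≥ (1 - k)
/ 2 · (1 + R²)`. -/
lemma exp_sub_one_bound_vertical {ε : ℝ} (hε : ε = 1 ∨ ε = -1) {c : ℝ} (hc1 : -1 < c)
    (hc0 : c < 0) : ∃ d > 0, ∀ s : ℂ, s.re = c →
      d * max 1 ‖Complex.exp (wt ε * s)‖ ≤ ‖Complex.exp (wt ε * s) - 1‖ := by
  have hk : Real.cos (2 * Real.pi * c) < 1 := by
    refine lt_of_le_of_ne (Real.cos_le_one _) fun h => ?_
    obtain ⟨n, hn⟩ := (Real.cos_eq_one_iff _).1 h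
    have h1 : (n : ℝ) = c := by
      have := Real.pi_pos
      nlinarith [mul_left_cancel₀ (by positivity : 2 * Real.pi ≠ 0)
        (show 2 * Real.pi * (n : ℝ) = 2 * Real.pi * c by linarith)]
    rw [← h1] at hc1 hc0
    have h3 : -1 < n := by exact_mod_cast hc1
    have h4 : n < 0 := by exact_mod_cast hc0
    omega
  set k := Real.cos (2 * Real.pi * c) with hkdef
  have hk' : -1 ≤ k := Real.neg_one_le_cos _
  refine ⟨Real.sqrt ((1 - k) / 2), Real.sqrt_pos.2 (by linarith), fun s hs => ?_⟩
  set R := Real.exp (-(2 * Real.pi * ε * s.im)) with hR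
  have hR0 : 0 < R := Real.exp_pos _
  have hre : (Complex.exp (wt ε * s)).re = R * k := by
    rw [Complex.exp_re]
    have h1 : (wt ε * s).re = -(2 * Real.pi * ε * s.im) := by simp [wt]
    have h2 : (wt ε * s).im = 2 * Real.pi * ε * c := by simp [wt, hs]
    rw [h1, h2]
    rcases hε with rfl | rfl
    · rw [show 2 * Real.pi * 1 * c = 2 * Real.pi * c by ring]
    · rw [show 2 * Real.pi * -1 * c = -(2 * Real.pi * c) by ring, Real.cos_neg]
  rw [norm_exp_wt, ← hR, ← sq_le_sq₀ (by positivity) (norm_nonneg _), mul_pow,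
    Real.sq_sqrt (by linarith)]
  have h3 : ‖Complex.exp (wt ε * s) - 1‖ ^ 2 = R ^ 2 - 2 * (R * k) + 1 := by
    have h4 : ‖Complex.exp (wt ε * s)‖ ^ 2 = R ^ 2 := by rw [norm_exp_wt]
    rw [Complex.sq_norm, Complex.normSq_apply] at h4 ⊢
    simp only [Complex.sub_re, Complex.sub_im, Complex.one_re, Complex.one_im]
    rw [← hre]
    nlinarith
  rw [h3]
  have h5 : (max 1 R) ^ 2 ≤ 1 + R ^ 2 := by
    rcases max_cases 1 R with ⟨h, _⟩ | ⟨h, _⟩ <;> rw [h] <;> nlinarith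
  refine (mul_le_mul_of_nonneg_left h5 (by linarith)).trans ?_
  nlinarith [sq_nonneg (R - 1), mul_nonneg (by linarith : (0:ℝ) ≤ 1 + k) (sq_nonneg (R - 1))]

/-- At this height `|e^{ws}|` is at most `1/2` or at least `2`, whatever the real part. -/
lemma exp_sub_one_bound_horizontal {ε : ℝ} (hε : ε = 1 ∨ ε = -1) {s : ℂ} (hs : 1 ≤ |s.im|) :
    1 / 2 * max 1 ‖Complex.exp (wt ε * s)‖ ≤ ‖Complex.exp (wt ε * s) - 1‖ := by
  have h1 : |‖Complex.exp (wt ε * s)‖ - 1| ≤ ‖Complex.exp (wt ε * s) - 1‖ := by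
    simpa using abs_norm_sub_norm_le (Complex.exp (wt ε * s)) 1
  refine le_trans ?_ h1
  rw [norm_exp_wt]
  have hpi := Real.pi_gt_three
  have h2 : 1 ≤ |ε * s.im| := by
    rcases hε with rfl | rfl <;> simpa using hs
  rw [show 2 * Real.pi * ε * s.im = 2 * Real.pi * (ε * s.im) by ring]
  generalize ε * s.im = y at h2
  rcases le_abs.1 h2 with hy | hy
  · have h3 : Real.exp (-(2 * Real.pi * y)) ≤ 1 / 2 := by
      rw [Real.exp_neg, one_div]
      refine inv_anti₀ two_pos ?_
      have := Real.add_one_le_exp (2 * Real.pi * y)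
      nlinarith
    have h4 := Real.exp_pos (-(2 * Real.pi * y))
    rw [max_eq_left (by linarith), abs_of_nonpos (by linarith)]
    linarith
  · have h3 : 2 ≤ Real.exp (-(2 * Real.pi * y)) := by
      have := Real.add_one_le_exp (-(2 * Real.pi * y))
      nlinarith
    rw [max_eq_right (by linarith), abs_of_nonneg (by linarith)]
    linarith

/-- This governs the convergence of the integrals: a power `z^s` contributes `e^{-θt}` with `θ = arg
z`, and a kernel decays only where `εt < 0`, at the rate `2π`. The product decays in both directions
when `0 < εθ < 2π`. -/
lemma exp_neg_mul_min_le {ε θ t : ℝ} (hε : ε = 1 ∨ ε = -1) :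
    Real.exp (-(θ * t)) * min 1 (Real.exp (2 * Real.pi * ε * t)) ≤
      Real.exp (-(min (ε * θ) (2 * Real.pi - ε * θ) * |t|)) := by
  set δ := min (ε * θ) (2 * Real.pi - ε * θ) with hδ
  have h1 : δ ≤ ε * θ := min_le_left _ _
  have h2 : δ ≤ 2 * Real.pi - ε * θ := min_le_right _ _
  have hee : ε * ε = 1 := by rcases hε with rfl | rfl <;> norm_num
  have habs : |t| = |ε * t| := by rcases hε with rfl | rfl <;> simp
  have ht : θ * t = (ε * θ) * (ε * t) := by linear_combination -(θ * t) * hee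
  rw [habs, ht, show 2 * Real.pi * ε * t = 2 * Real.pi * (ε * t) by ring]
  generalize ε * t = y at *
  rcases le_total 0 y with hy | hy
  · rw [abs_of_nonneg hy]
    refine (mul_le_mul_of_nonneg_left (min_le_left _ _) (Real.exp_pos _).le).trans ?_
    rw [mul_one]
    exact Real.exp_le_exp.2 (by nlinarith)
  · rw [abs_of_nonpos hy]
    refine (mul_le_mul_of_nonneg_left (min_le_right _ _) (Real.exp_pos _).le).trans ?_
    rw [← Real.exp_add]
    exact Real.exp_le_exp.2 (by nlinarith)

lemma integrable_exp_neg_mul_abs {δ : ℝ} (hδ : 0 < δ) :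
    Integrable fun t : ℝ => Real.exp (-(δ * |t|)) := by
  have h1 : IntegrableOn (fun t : ℝ => Real.exp (-(δ * |t|))) (Set.Ioi 0) := by
    refine (exp_neg_integrableOn_Ioi 0 hδ).congr_fun (fun t ht => ?_) measurableSet_Ioi
    simp only [abs_of_pos (show 0 < t from ht), neg_mul]
  have h2 : IntegrableOn (fun t : ℝ => Real.exp (-(δ * |t|))) (Set.Iic 0) := by
    refine (integrableOn_exp_mul_Iic hδ 0).congr_fun (fun t ht => ?_) measurableSet_Iic
    simp only [abs_of_nonpos (show t ≤ 0 from ht), mul_neg, neg_neg]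
  rw [← integrableOn_univ, ← Set.Iic_union_Ioi (a := (0 : ℝ))]
  exact h2.union h1

lemma tendsto_ker_top {ε : ℝ} (hε : ε = 1 ∨ ε = -1) (j : ℕ) (x : ℝ) :
    Tendsto (fun T : ℝ => ker (wt ε) j (x + (ε * T : ℝ) * Complex.I)) atTop
      (𝓝 (kerPoly (wt ε) j (-1))) := by
  refine ((continuous_kerPoly _ j).tendsto _).comp ?_
  have h1 : Tendsto (fun T : ℝ => Complex.exp (wt ε * (x + (ε * T : ℝ) * Complex.I))) atTop
      (𝓝 0) := by
    rw [tendsto_zero_iff_norm_tendsto_zero]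
    simp only [norm_exp_wt]
    refine Real.tendsto_exp_atBot.comp ?_
    have h2 : (fun T : ℝ => -(2 * Real.pi * ε * ((x : ℂ) + (ε * T : ℝ) * Complex.I).im)) =
        fun T => -(2 * Real.pi) * T := by
      funext T
      rcases hε with rfl | rfl <;> simp
    rw [h2]
    exact tendsto_id.const_mul_atTop_of_neg (by linarith [Real.pi_pos])
  have h2 := (h1.sub_const 1).inv₀ (by norm_num)
  have h3 : ((0 : ℂ) - 1)⁻¹ = -1 := by norm_num
  rw [h3] at h2
  exact h2

lemma tendsto_ker_bot {ε : ℝ} (hε : ε = 1 ∨ ε = -1) (j : ℕ) (x : ℝ) :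
    Tendsto (fun T : ℝ => ker (wt ε) j (x + (-(ε * T) : ℝ) * Complex.I)) atTop (𝓝 0) := by
  have h0 : kerPoly (wt ε) j 0 = 0 := by rcases j with _ | _ | _ | _ | j <;> simp [kerPoly]
  rw [← h0]
  refine ((continuous_kerPoly _ j).tendsto _).comp ?_
  refine tendsto_inv₀_cobounded.comp ?_
  rw [← tendsto_norm_atTop_iff_cobounded]
  have h1 : Tendsto (fun T : ℝ => Real.exp (2 * Real.pi * T) - 1) atTop atTop :=
    tendsto_atTop_add_const_right _ _ (Real.tendsto_exp_atTop.comp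
      (tendsto_id.const_mul_atTop (by positivity)))
  refine tendsto_atTop_mono (fun T => ?_) h1
  have h2 := norm_sub_norm_le (Complex.exp (wt ε * (x + (-(ε * T) : ℝ) * Complex.I))) 1
  rw [norm_exp_wt, norm_one] at h2
  refine le_trans (le_of_eq ?_) h2
  congr 2
  rcases hε with rfl | rfl <;> simp

/-- For `j ≥ 1` the polynomial comes from a derivative and is divisible by `E + E²`. Consequently
only the kernel with a simple pole has a non-zero limit at the end where `e^{ws}` tends to `0`. -/
lemma kerPoly_neg_one (w : ℂ) (j : ℕ) : kerPoly w j (-1) = if j = 0 then -w else 0 := by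
  rcases j with _ | _ | _ | _ | j <;> simp [kerPoly] <;> norm_num

end CYPeriods

/-! ### The residue theorem on strips and on a right half-plane. -/

namespace CYPeriods

open Filter Topology PowerSeries MeasureTheory

/-- The point `c + it`. -/
noncomputable def vline (c t : ℝ) : ℂ := c + t * Complex.I

@[simp] lemma vline_re (c t : ℝ) : (vline c t).re = c := by simp [vline]

@[simp] lemma vline_im (c t : ℝ) : (vline c t).im = t := by simp [vline]

lemma continuous_vline (c : ℝ) : Continuous (vline c) := by unfold vline; fun_prop

lemma vline_add_nat (c t : ℝ) (n : ℕ) : vline (c + n) t = vline c t + n := by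
  simp only [vline]
  push_cast
  ring

/-- `∫ H(s) Q(s) dt` over the line `s = c + it`, where `Q` is the `j`-th kernel. -/
noncomputable def lineInt (ε : ℝ) (H : ℂ → ℂ) (j : ℕ) (c : ℝ) : ℂ :=
  ∫ t : ℝ, H (vline c t) * ker (wt ε) j (vline c t)

/-- Exponential bounds on a right half plane. -/
structure HalfPlaneBound (H : ℂ → ℂ) (c θ κ M : ℝ) : Prop where
  diff : ∃ c₀ < c, DifferentiableOn ℂ H {s | c₀ < s.re}
  bound : ∀ s : ℂ, c ≤ s.re → ‖H s‖ ≤ M * κ ^ s.re * Real.exp (-(θ * s.im))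

lemma HalfPlaneBound.differentiableAt {H : ℂ → ℂ} {c θ κ M : ℝ} (h : HalfPlaneBound H c θ κ M)
    {s : ℂ} (hs : c ≤ s.re) : DifferentiableAt ℂ H s := by
  obtain ⟨c₀, hc, hd⟩ := h.diff
  exact hd.differentiableAt ((isOpen_lt continuous_const Complex.continuous_re).mem_nhds
    (hc.trans_le hs))

lemma HalfPlaneBound.shift {H : ℂ → ℂ} {c θ κ M : ℝ} (hκ : 0 < κ) (h : HalfPlaneBound H c θ κ M)
    (n : ℕ) : HalfPlaneBound (fun s => H (s + n)) c θ κ (M * κ ^ n) := by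
  obtain ⟨c₀, hc, hd⟩ := h.diff
  have hn : (0 : ℝ) ≤ n := n.cast_nonneg
  refine ⟨⟨c₀, hc, ?_⟩, fun s hs => ?_⟩
  · refine hd.comp (by fun_prop) fun s hs => ?_
    simp only [Set.mem_ofPred_eq, Complex.add_re, Complex.natCast_re] at hs ⊢
    linarith
  · refine (h.bound (s + n) (by simp; linarith)).trans_eq ?_
    simp only [Complex.add_re, Complex.natCast_re, Complex.add_im, Complex.natCast_im, add_zero]
    rw [Real.rpow_add hκ, Real.rpow_natCast]
    ring

section

variable {ε c θ κ M : ℝ} {H : ℂ → ℂ}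

lemma differentiableAt_ker_of_re {s : ℂ} (hε : ε = 1 ∨ ε = -1) (hc1 : -1 < c) (hc0 : c < 0)
    (n : ℕ) (hs : s.re = c + n) (j : ℕ) : DifferentiableAt ℂ (ker (wt ε) j) s := by
  refine differentiableAt_ker (fun h => ?_) j
  obtain ⟨m, rfl⟩ := (exp_wt_mul_eq_one_iff hε).1 h
  simp only [Complex.intCast_re] at hs
  have h3 : (-1 : ℤ) < m - n := by exact_mod_cast (by linarith : (-1 : ℝ) < m - n)
  have h4 : m - n < (0 : ℤ) := by exact_mod_cast (by linarith : (m : ℝ) - n < 0)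
  omega

lemma continuous_ker_vline (hε : ε = 1 ∨ ε = -1) (hc1 : -1 < c) (hc0 : c < 0) (n : ℕ) (j : ℕ) :
    Continuous fun t => ker (wt ε) j (vline (c + n) t) :=
  continuous_iff_continuousAt.2 fun t =>
    (differentiableAt_ker_of_re hε hc1 hc0 n (vline_re _ t) j).continuousAt.comp
      (continuous_vline _).continuousAt

lemma HalfPlaneBound.continuous_vline (h : HalfPlaneBound H c θ κ M) (n : ℕ) :
    Continuous fun t => H (vline (c + n) t) :=
  continuous_iff_continuousAt.2 fun t => (h.differentiableAt (by simp)).continuousAt.comp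
    (CYPeriods.continuous_vline _).continuousAt

/-- The integrand of `lineInt` decays exponentially. -/
lemma exists_norm_mul_ker_le (hε : ε = 1 ∨ ε = -1) (hc1 : -1 < c) (hc0 : c < 0) (hM : 0 ≤ M)
    (hκ : 0 < κ) (h : HalfPlaneBound H c θ κ M) (j : ℕ) : ∃ K, 0 ≤ K ∧ ∀ (n : ℕ) (t : ℝ),
      ‖H (vline (c + n) t) * ker (wt ε) j (vline (c + n) t)‖ ≤
        K * κ ^ n * Real.exp (-(min (ε * θ) (2 * Real.pi - ε * θ) * |t|)) := by
  obtain ⟨d, hd, hd'⟩ := exp_sub_one_bound_vertical hε hc1 hc0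
  obtain ⟨K, hK0, hK⟩ := norm_ker_le ε j hd
  refine ⟨M * κ ^ c * K, by positivity, fun n t => ?_⟩
  rw [vline_add_nat, ker_add_nat hε, norm_mul]
  have h1 := (h.shift hκ n).bound (vline c t) (by simp)
  have h2 := hK (vline c t) (hd' _ (by simp))
  simp only [vline_re, vline_im] at h1 h2
  refine (mul_le_mul h1 h2 (norm_nonneg _) (by positivity)).trans ?_
  have h3 := exp_neg_mul_min_le (θ := θ) (t := t) hε
  calc M * κ ^ n * κ ^ c * Real.exp (-(θ * t)) * (K * min 1 (Real.exp (2 * Real.pi * ε * t)))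
      = M * κ ^ c * K * κ ^ n *
        (Real.exp (-(θ * t)) * min 1 (Real.exp (2 * Real.pi * ε * t))) := by ring
    _ ≤ _ := by gcongr

lemma integrable_mul_ker (hε : ε = 1 ∨ ε = -1) (hc1 : -1 < c) (hc0 : c < 0) (hM : 0 ≤ M)
    (hκ : 0 < κ) (hθ : 0 < ε * θ) (hθ' : ε * θ < 2 * Real.pi) (h : HalfPlaneBound H c θ κ M)
    (j n : ℕ) : Integrable fun t => H (vline (c + n) t) * ker (wt ε) j (vline (c + n) t) := by
  obtain ⟨K, hK0, hK⟩ := exists_norm_mul_ker_le hε hc1 hc0 hM hκ h j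
  refine Integrable.mono' ((integrable_exp_neg_mul_abs (lt_min hθ (sub_pos.2 hθ'))).const_mul
    (K * κ ^ n)) ?_ (ae_of_all _ (hK n))
  exact ((h.continuous_vline n).mul (continuous_ker_vline hε hc1 hc0 n j)).aestronglyMeasurable

/-- Cauchy's theorem on `[c, c + 1] × [-T, T]`, after the pole at `0` has been removed by
subtracting kernels. The subtracted sum has period one, so it cancels between the vertical sides and
survives on the horizontal ones only. -/
lemma rectangle_identity (hε : ε = 1 ∨ ε = -1) (hc1 : -1 < c) (hc0 : c < 0)
    (h : HalfPlaneBound H c θ κ M) {j : ℕ} (hj : j < 4) {T : ℝ} (hT : 0 < T) :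
    Complex.I * ((∫ y in (-T)..T, H (vline (c + 1) y) * ker (wt ε) j (vline (c + 1) y)) -
      ∫ y in (-T)..T, H (vline c y) * ker (wt ε) j (vline c y)) =
    ∫ x in c..(c + 1), ((H (vline x T) * ker (wt ε) j (vline x T) -
        ∑ i ∈ Finset.range (j + 1), coeff i (jet H) * ker (wt ε) (j - i) (vline x T)) -
      (H (vline x (-T)) * ker (wt ε) j (vline x (-T)) -
        ∑ i ∈ Finset.range (j + 1), coeff i (jet H) * ker (wt ε) (j - i) (vline x (-T)))) := by
  obtain ⟨k, hk, hkeq⟩ := exists_analyticAt_mul_ker_sub (wt_ne_zero hε) hj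
    (H := H) (by
      obtain ⟨c₀, hc, hd⟩ := h.diff
      exact hd.analyticAt ((isOpen_lt continuous_const Complex.continuous_re).mem_nhds
        (by simpa using hc.trans hc0)))
  set P : ℂ → ℂ := fun s => ∑ i ∈ Finset.range (j + 1),
    coeff i (jet H) * ker (wt ε) (j - i) s with hP
  set G : ℂ → ℂ := fun s => H s * ker (wt ε) j s - P s with hG
  -- The value `k 0` fills the removable singularity.
  set G' : ℂ → ℂ := Function.update G 0 (k 0) with hG'
  have hG'eq : ∀ s, s ≠ 0 → G' s = G s := fun s hs => Function.update_of_ne hs _ _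
  have hG'0 : G' =ᶠ[𝓝 0] k := by
    rw [← nhdsNE_sup_pure, EventuallyEq, eventually_sup]
    constructor
    · filter_upwards [hkeq, self_mem_nhdsWithin] with s hs hs0
      rw [hG'eq s hs0, ← hs]
    · simp [hG']
  have hPdiff : ∀ s : ℂ, -1 < s.re → s.re < 1 → s ≠ 0 → DifferentiableAt ℂ P s := by
    intro s h1 h2 hs0
    exact DifferentiableAt.fun_sum fun i _ => (differentiableAt_ker
      (exp_wt_mul_ne_one hε h1 h2 hs0) _).const_mul _
  have hGdiff : ∀ s : ℂ, c ≤ s.re → s.re < 1 → s ≠ 0 → DifferentiableAt ℂ G s := by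
    intro s h1 h2 hs0
    exact ((h.differentiableAt h1).mul (differentiableAt_ker
      (exp_wt_mul_ne_one hε (by linarith) h2 hs0) j)).sub (hPdiff s (by linarith) h2 hs0)
  have hG'diff : ∀ s : ℂ, c ≤ s.re → s.re < 1 → DifferentiableAt ℂ G' s := by
    intro s h1 h2
    by_cases hs : s = 0
    · subst hs
      exact hG'0.symm.differentiableAt_iff.1 hk.differentiableAt
    · have : G' =ᶠ[𝓝 s] G := by
        filter_upwards [isOpen_ne.mem_nhds hs] with y hy
        exact hG'eq y hy
      exact this.symm.differentiableAt_iff.1 (hGdiff s h1 h2 hs)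
  have hrect := Complex.integral_boundary_rect_eq_zero_of_differentiableOn G' (vline c (-T))
    (vline (c + 1) T) (by
      intro s hs
      rw [vline_re, vline_re, Set.uIcc_of_le (by linarith)] at hs
      exact (hG'diff s hs.1.1 (by linarith [hs.1.2])).differentiableWithinAt)
  simp only [vline_re, vline_im, smul_eq_mul] at hrect
  have hv : ∀ x y : ℝ, (x : ℂ) + y * Complex.I = vline x y := fun x y => rfl
  simp only [hv] at hrect
  have hne1 : ∀ x y : ℝ, x ≠ 0 → vline x y ≠ 0 := fun x y hx h0 => hx (by
    rw [← vline_re x y, h0, Complex.zero_re])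
  have hne2 : ∀ x y : ℝ, y ≠ 0 → vline x y ≠ 0 := fun x y hy h0 => hy (by
    rw [← vline_im x y, h0, Complex.zero_im])
  have hcont : ∀ c' : ℝ, c' = c ∨ c' = c + 1 → Continuous (fun y => G' (vline c' y)) := by
    intro c' hc'
    refine continuous_iff_continuousAt.2 fun y => (hG'diff _ ?_ ?_).continuousAt.comp
      (continuous_vline c').continuousAt
    · rcases hc' with rfl | rfl <;> simp
    · rcases hc' with rfl | rfl <;> simp <;> linarith
  have hconth : ∀ y : ℝ, ContinuousOn (fun x => G' (vline x y)) (Set.uIcc c (c + 1)) := by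
    intro y x hx
    rw [Set.uIcc_of_le (by linarith)] at hx
    refine ((hG'diff (vline x y) (by simpa using hx.1) (by simp; linarith [hx.2])).continuousAt.comp
      (f := fun x => vline x y) ?_).continuousWithinAt
    unfold vline
    fun_prop
  have hper : ∀ y, P (vline (c + 1) y) = P (vline c y) := by
    intro y
    have := vline_add_nat c y 1
    rw [Nat.cast_one] at this
    simp only [hP, this]
    refine Finset.sum_congr rfl fun i _ => ?_
    rw [ker_add_nat hε]
  have hside : (∫ y in (-T)..T, G' (vline (c + 1) y)) - ∫ y in (-T)..T, G' (vline c y) =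
      (∫ y in (-T)..T, H (vline (c + 1) y) * ker (wt ε) j (vline (c + 1) y)) -
      ∫ y in (-T)..T, H (vline c y) * ker (wt ε) j (vline c y) := by
    have hcP : Continuous fun y => P (vline c y) := continuous_iff_continuousAt.2 fun y =>
      (hPdiff _ (by simpa using hc1) (by simp; linarith) (hne1 _ _ hc0.ne)).continuousAt.comp
        (continuous_vline c).continuousAt
    have e1 : ∀ y, H (vline (c + 1) y) * ker (wt ε) j (vline (c + 1) y) =
        G' (vline (c + 1) y) + P (vline c y) := by
      intro y
      rw [hG'eq _ (hne1 _ _ (by linarith)), ← hper, hG]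
      ring
    have e2 : ∀ y, H (vline c y) * ker (wt ε) j (vline c y) =
        G' (vline c y) + P (vline c y) := by
      intro y
      rw [hG'eq _ (hne1 _ _ hc0.ne), hG]
      ring
    simp only [e1, e2]
    rw [intervalIntegral.integral_add ((hcont _ (Or.inr rfl)).intervalIntegrable _ _)
      (hcP.intervalIntegrable _ _), intervalIntegral.integral_add
      ((hcont _ (Or.inl rfl)).intervalIntegrable _ _) (hcP.intervalIntegrable _ _)]
    ring
  have htop : (∫ x in c..(c + 1), G' (vline x T)) - (∫ x in c..(c + 1), G' (vline x (-T))) =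
      ∫ x in c..(c + 1), (G (vline x T) - G (vline x (-T))) := by
    rw [← intervalIntegral.integral_sub (hconth T).intervalIntegrable
      (hconth (-T)).intervalIntegrable]
    refine intervalIntegral.integral_congr fun x _ => ?_
    rw [hG'eq _ (hne2 _ _ hT.ne'), hG'eq _ (hne2 _ _ (neg_ne_zero.2 hT.ne'))]
  rw [← hside, ← htop]
  linear_combination hrect

lemma tendsto_ker_diff (hε : ε = 1 ∨ ε = -1) (j : ℕ) (x : ℝ) :
    Tendsto (fun T : ℝ => ker (wt ε) j (vline x T) - ker (wt ε) j (vline x (-T))) atTop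
      (𝓝 (if j = 0 then -(2 * Real.pi * Complex.I) else 0)) := by
  have h1 := tendsto_ker_top hε j x
  have h2 := tendsto_ker_bot hε j x
  rw [kerPoly_neg_one] at h1
  rcases hε with rfl | rfl
  · convert! h1.sub h2 using 2
    · simp [vline]
    · split_ifs <;> simp [wt]
  · convert! h2.sub h1 using 2
    · simp [vline]
    · split_ifs <;> simp [wt]

/-- The residue appears through the subtracted kernels. The products `H · ker` decay at both ends,
and among the kernels only that of order zero, the term `i = j`, has different limits at the top and
at the bottom; they differ by `-2πi`. -/
lemma tendsto_horizontal (hε : ε = 1 ∨ ε = -1) (hc1 : -1 < c) (hc0 : c < 0) (hM : 0 ≤ M)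
    (hκ : 0 < κ) (hκ1 : κ < 1) (hθ : 0 < ε * θ) (hθ' : ε * θ < 2 * Real.pi)
    (h : HalfPlaneBound H c θ κ M) (j : ℕ) :
    Tendsto (fun T : ℝ => ∫ x in c..(c + 1), ((H (vline x T) * ker (wt ε) j (vline x T) -
        ∑ i ∈ Finset.range (j + 1), coeff i (jet H) * ker (wt ε) (j - i) (vline x T)) -
      (H (vline x (-T)) * ker (wt ε) j (vline x (-T)) -
        ∑ i ∈ Finset.range (j + 1), coeff i (jet H) * ker (wt ε) (j - i) (vline x (-T))))) atTop
      (𝓝 (2 * Real.pi * Complex.I * coeff j (jet H))) := by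
  have hK : ∀ i, ∃ K, 0 ≤ K ∧ ∀ s : ℂ, 1 ≤ |s.im| →
      ‖ker (wt ε) i s‖ ≤ K * min 1 (Real.exp (2 * Real.pi * ε * s.im)) := fun i => by
    obtain ⟨K, hK0, hK⟩ := norm_ker_le ε i one_half_pos
    exact ⟨K, hK0, fun s hs => hK s (exp_sub_one_bound_horizontal hε hs)⟩
  choose K hK0 hK using hK
  set δ := min (ε * θ) (2 * Real.pi - ε * θ) with hδdef
  have hδ : 0 < δ := lt_min hθ (sub_pos.2 hθ')
  have hHK : ∀ x y : ℝ, c ≤ x → 1 ≤ |y| → ‖H (vline x y) * ker (wt ε) j (vline x y)‖ ≤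
      M * κ ^ c * K j * Real.exp (-(δ * |y|)) := by
    intro x y hx hy
    have h1 := h.bound (vline x y) (by simpa using hx)
    have h2 := hK j (vline x y) (by simpa using hy)
    simp only [vline_re, vline_im] at h1 h2
    have h4 : κ ^ x ≤ κ ^ c := Real.rpow_le_rpow_of_exponent_ge hκ hκ1.le hx
    rw [norm_mul]
    have hKj := hK0 j
    calc _ ≤ M * κ ^ c * Real.exp (-(θ * y)) *
          (K j * min 1 (Real.exp (2 * Real.pi * ε * y))) := by
          refine mul_le_mul (h1.trans ?_) h2 (norm_nonneg _) (by positivity)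
          gcongr
      _ = M * κ ^ c * K j *
          (Real.exp (-(θ * y)) * min 1 (Real.exp (2 * Real.pi * ε * y))) := by ring
      _ ≤ _ := by
        gcongr
        exact exp_neg_mul_min_le hε
  have hP : ∀ x y : ℝ, 1 ≤ |y| → ‖∑ i ∈ Finset.range (j + 1),
      coeff i (jet H) * ker (wt ε) (j - i) (vline x y)‖ ≤
        ∑ i ∈ Finset.range (j + 1), ‖coeff i (jet H)‖ * K (j - i) := by
    intro x y hy
    refine (norm_sum_le _ _).trans (Finset.sum_le_sum fun i _ => ?_)
    rw [norm_mul]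
    gcongr
    refine (hK (j - i) (vline x y) (by simpa using hy)).trans ?_
    exact mul_le_of_le_one_right (hK0 _) (min_le_left _ _)
  have hlim : ∫ _ in c..(c + 1), (2 * Real.pi * Complex.I * coeff j (jet H) : ℂ) =
      2 * Real.pi * Complex.I * coeff j (jet H) := by simp
  rw [← hlim]
  set B := M * κ ^ c * K j + ∑ i ∈ Finset.range (j + 1), ‖coeff i (jet H)‖ * K (j - i) with hB
  refine intervalIntegral.tendsto_integral_filter_of_dominated_convergence (fun _ => B + B) ?_ ?_
    intervalIntegrable_const ?_
  · filter_upwards [eventually_gt_atTop 0] with T hT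
    have hcont : ∀ y : ℝ, y ≠ 0 → ContinuousOn (fun x => H (vline x y) *
        ker (wt ε) j (vline x y) - ∑ i ∈ Finset.range (j + 1),
          coeff i (jet H) * ker (wt ε) (j - i) (vline x y)) (Set.Icc c (c + 1)) := by
      intro y hy x hx
      have hv : ContinuousAt (fun x => vline x y) x := by unfold vline; fun_prop
      have hne : vline x y ≠ 0 := fun h0 => hy (by rw [← vline_im x y, h0, Complex.zero_im])
      have hexp := exp_wt_mul_ne_one hε (s := vline x y) (by simp; linarith [hx.1])
        (by simp; linarith [hx.2]) hne
      have hd : ContinuousAt (fun s => H s * ker (wt ε) j s - ∑ i ∈ Finset.range (j + 1),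
          coeff i (jet H) * ker (wt ε) (j - i) s) (vline x y) :=
        (((h.differentiableAt (by simpa using hx.1)).mul (differentiableAt_ker hexp j)).sub
          (DifferentiableAt.fun_sum fun i _ =>
            (differentiableAt_ker hexp _).const_mul _)).continuousAt
      exact (hd.comp (f := fun x => vline x y) hv).continuousWithinAt
    rw [Set.uIoc_of_le (by linarith)]
    refine (((hcont T hT.ne').sub (hcont (-T) (neg_ne_zero.2 hT.ne'))).mono
      Set.Ioc_subset_Icc_self).aestronglyMeasurable measurableSet_Ioc
  · filter_upwards [eventually_ge_atTop 1] with T hT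
    refine ae_of_all _ fun x hx => ?_
    rw [Set.uIoc_of_le (by linarith)] at hx
    have hb : ∀ y : ℝ, 1 ≤ |y| → ‖H (vline x y) * ker (wt ε) j (vline x y) -
        ∑ i ∈ Finset.range (j + 1), coeff i (jet H) * ker (wt ε) (j - i) (vline x y)‖ ≤ B := by
      intro y hy
      refine (norm_sub_le _ _).trans (add_le_add ((hHK x y hx.1.le hy).trans ?_) (hP x y hy))
      have := hK0 j
      refine mul_le_of_le_one_right (by positivity) (Real.exp_le_one_iff.2 ?_)
      have := mul_nonneg hδ.le (abs_nonneg y)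
      linarith
    have hT' : 1 ≤ |T| := hT.trans (le_abs_self T)
    exact (norm_sub_le _ _).trans (add_le_add (hb T hT') (hb (-T) (by rwa [abs_neg])))
  · refine ae_of_all _ fun x hx => ?_
    rw [Set.uIoc_of_le (by linarith)] at hx
    have hz : Tendsto (fun T : ℝ => M * κ ^ c * K j * Real.exp (-(δ * T))) atTop (𝓝 0) := by
      have h1 : Tendsto (fun T : ℝ => Real.exp (-(δ * T))) atTop (𝓝 0) :=
        Real.tendsto_exp_neg_atTop_nhds_zero.comp (tendsto_id.const_mul_atTop hδ)
      simpa using h1.const_mul (M * κ ^ c * K j)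
    have h1 : Tendsto (fun T : ℝ => H (vline x T) * ker (wt ε) j (vline x T)) atTop (𝓝 0) := by
      refine squeeze_zero_norm' ?_ hz
      filter_upwards [eventually_ge_atTop 1] with T hT
      have := hHK x T hx.1.le (hT.trans (le_abs_self T))
      rwa [abs_of_nonneg (by linarith)] at this
    have h2 : Tendsto (fun T : ℝ => H (vline x (-T)) * ker (wt ε) j (vline x (-T))) atTop
        (𝓝 0) := by
      refine squeeze_zero_norm' ?_ hz
      filter_upwards [eventually_ge_atTop 1] with T hT
      have := hHK x (-T) hx.1.le (by rw [abs_neg]; exact hT.trans (le_abs_self T))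
      rwa [abs_neg, abs_of_nonneg (by linarith)] at this
    have h3 : Tendsto (fun T : ℝ => ∑ i ∈ Finset.range (j + 1), coeff i (jet H) *
        (ker (wt ε) (j - i) (vline x T) - ker (wt ε) (j - i) (vline x (-T)))) atTop
        (𝓝 (∑ i ∈ Finset.range (j + 1), coeff i (jet H) *
          (if j - i = 0 then -(2 * Real.pi * Complex.I) else 0))) :=
      tendsto_finsetSum _ fun i _ => (tendsto_ker_diff hε (j - i) x).const_mul _
    have h4 : ∑ i ∈ Finset.range (j + 1), coeff i (jet H) *
          (if j - i = 0 then -(2 * Real.pi * Complex.I) else 0) =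
        -(2 * Real.pi * Complex.I * coeff j (jet H)) := by
      rw [Finset.sum_range_succ, Finset.sum_eq_zero]
      · simp
        ring
      · intro i hi
        have := Finset.mem_range.1 hi
        rw [if_neg (by omega), mul_zero]
    rw [h4] at h3
    have h5 := (h1.sub h2).sub h3
    rw [sub_zero, zero_sub, neg_neg] at h5
    refine h5.congr fun T => ?_
    simp only [mul_sub, Finset.sum_sub_distrib]
    ring

/-- The residue theorem for a strip. -/
lemma lineInt_sub (hε : ε = 1 ∨ ε = -1) (hc1 : -1 < c) (hc0 : c < 0) (hM : 0 ≤ M)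
    (hκ : 0 < κ) (hκ1 : κ < 1) (hθ : 0 < ε * θ) (hθ' : ε * θ < 2 * Real.pi)
    (h : HalfPlaneBound H c θ κ M) {j : ℕ} (hj : j < 4) :
    lineInt ε H j (c + 1) - lineInt ε H j c = 2 * Real.pi * coeff j (jet H) := by
  have i0 := integrable_mul_ker hε hc1 hc0 hM hκ hθ hθ' h j 0
  have i1 := integrable_mul_ker hε hc1 hc0 hM hκ hθ hθ' h j 1
  simp only [Nat.cast_zero, add_zero, Nat.cast_one] at i0 i1
  have t0 := intervalIntegral_tendsto_integral i0 tendsto_neg_atTop_atBot tendsto_id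
  have t1 := intervalIntegral_tendsto_integral i1 tendsto_neg_atTop_atBot tendsto_id
  have t2 := (t1.sub t0).const_mul Complex.I
  have t3 := tendsto_horizontal hε hc1 hc0 hM hκ hκ1 hθ hθ' h j
  have t4 : Complex.I * (lineInt ε H j (c + 1) - lineInt ε H j c) =
      2 * Real.pi * Complex.I * coeff j (jet H) := by
    refine tendsto_nhds_unique t2 (t3.congr' ?_)
    filter_upwards [eventually_gt_atTop 0] with T hT
    exact (rectangle_identity hε hc1 hc0 h hj hT).symm
  refine mul_left_cancel₀ Complex.I_ne_zero ?_
  rw [t4]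
  ring

lemma lineInt_add_nat (hε : ε = 1 ∨ ε = -1) (j n : ℕ) :
    lineInt ε H j (c + n) = lineInt ε (fun s => H (s + n)) j c := by
  simp only [lineInt, vline_add_nat, ker_add_nat hε]

/-- The residue theorem for a right half plane. -/
theorem tendsto_sum_coeff_jet (hε : ε = 1 ∨ ε = -1) (hc1 : -1 < c) (hc0 : c < 0) (hM : 0 ≤ M)
    (hκ : 0 < κ) (hκ1 : κ < 1) (hθ : 0 < ε * θ) (hθ' : ε * θ < 2 * Real.pi)
    (h : HalfPlaneBound H c θ κ M) {j : ℕ} (hj : j < 4) :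
    Tendsto (fun N => ∑ n ∈ Finset.range N, coeff j (jet fun s => H (s + n))) atTop
      (𝓝 (-(2 * Real.pi : ℂ)⁻¹ * lineInt ε H j c)) := by
  have hpi : (2 * Real.pi : ℂ) ≠ 0 := by exact_mod_cast Real.two_pi_pos.ne'
  -- Shifting `H` instead of the strip keeps the pole at `0` and leaves the periodic kernel
  -- unchanged, so the strips telescope.
  have hsum : ∀ N : ℕ, ∑ n ∈ Finset.range N, coeff j (jet fun s => H (s + n)) =
      (2 * Real.pi : ℂ)⁻¹ * (lineInt ε H j (c + N) - lineInt ε H j c) := by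
    intro N
    induction N with
    | zero => simp
    | succ N ih =>
      have h1 := lineInt_sub hε hc1 hc0 (by positivity) hκ hκ1 hθ hθ' (h.shift hκ N) hj
      have h2 : lineInt ε H j (c + (N + 1 : ℕ)) = lineInt ε (fun s => H (s + N)) j (c + 1) := by
        rw [show c + (N + 1 : ℕ) = (c + 1) + N by push_cast; ring, lineInt_add_nat hε]
      rw [Finset.sum_range_succ, ih, h2, lineInt_add_nat hε j N]
      linear_combination -(2 * Real.pi : ℂ)⁻¹ * h1 -
        coeff j (jet fun s => H (s + N)) * inv_mul_cancel₀ hpi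
  obtain ⟨K, hK0, hK⟩ := exists_norm_mul_ker_le hε hc1 hc0 hM hκ h j
  -- The far line carries the factor `κ ^ N`, with `κ < 1`.
  have hzero : Tendsto (fun N : ℕ => lineInt ε H j (c + N)) atTop (𝓝 0) := by
    have hI := integrable_exp_neg_mul_abs (lt_min hθ (sub_pos.2 hθ'))
    have h1 : Tendsto (fun N : ℕ => K * κ ^ N *
        ∫ t : ℝ, Real.exp (-(min (ε * θ) (2 * Real.pi - ε * θ) * |t|))) atTop (𝓝 0) := by
      simpa using ((tendsto_pow_atTop_nhds_zero_of_lt_one hκ.le hκ1).const_mul K).mul_const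
        (∫ t : ℝ, Real.exp (-(min (ε * θ) (2 * Real.pi - ε * θ) * |t|)))
    refine squeeze_zero_norm (fun N => ?_) h1
    refine (norm_integral_le_of_norm_le (hI.const_mul (K * κ ^ N)) (ae_of_all _ (hK N))).trans_eq ?_
    rw [integral_const_mul]
  have h2 := (hzero.sub_const (lineInt ε H j c)).const_mul (2 * Real.pi : ℂ)⁻¹
  rw [zero_sub, mul_neg, ← neg_mul] at h2
  exact h2.congr fun N => (hsum N).symm

end

end CYPeriods

/-! ### Gamma quotients and their Mellin-Barnes integrals. -/

namespace CYPeriods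

open Filter Topology PowerSeries MeasureTheory

/-- The quotient is `B(q + s, p - q) / Γ(p - q)`, and on `(0, 1]` the modulus of the Beta integrand
does not grow with `Re s`. This gives a bound on the entire half-plane without any asymptotics of
the Gamma function. -/
lemma exists_norm_Gamma_ratio_le {q p c : ℝ} (hqp : q < p) (hc : 0 < q + c) :
    ∃ K, 0 ≤ K ∧ ∀ s : ℂ, c ≤ s.re → ‖Complex.Gamma (q + s) * (Complex.Gamma (p + s))⁻¹‖ ≤ K := by
  have hv : 0 < ((p - q : ℝ) : ℂ).re := by simpa using hqp
  have hconv := Complex.betaIntegral_convergent (u := ((q + c : ℝ) : ℂ)) (by simpa using hc) hv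
  set I := ∫ x in (0 : ℝ)..1, ‖(x : ℂ) ^ (((q + c : ℝ) : ℂ) - 1) *
    (1 - (x : ℂ)) ^ (((p - q : ℝ) : ℂ) - 1)‖ with hI
  have hI0 : 0 ≤ I := intervalIntegral.integral_nonneg zero_le_one fun _ _ => norm_nonneg _
  have hG : Complex.Gamma ((p - q : ℝ) : ℂ) ≠ 0 := Complex.Gamma_ne_zero_of_re_pos hv
  refine ⟨I * ‖Complex.Gamma ((p - q : ℝ) : ℂ)‖⁻¹, by positivity, fun s hs => ?_⟩
  have hu : 0 < ((q : ℂ) + s).re := by simp; linarith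
  have hG2 : Complex.Gamma (p + s) ≠ 0 :=
    Complex.Gamma_ne_zero_of_re_pos (by simp; linarith)
  have h1 := Complex.Gamma_mul_Gamma_eq_betaIntegral hu hv
  rw [show (q : ℂ) + s + ((p - q : ℝ) : ℂ) = p + s by push_cast; ring] at h1
  have h2 : Complex.Gamma (q + s) * (Complex.Gamma (p + s))⁻¹ =
      Complex.betaIntegral (q + s) ((p - q : ℝ) : ℂ) * (Complex.Gamma ((p - q : ℝ) : ℂ))⁻¹ := by
    field_simp
    rw [h1]
  rw [h2, norm_mul, norm_inv]
  refine mul_le_mul_of_nonneg_right ?_ (by positivity)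
  rw [Complex.betaIntegral]
  refine intervalIntegral.norm_integral_le_of_norm_le zero_le_one ?_ hconv.norm
  refine ae_of_all _ fun x hx => ?_
  rw [norm_mul, norm_mul]
  refine mul_le_mul_of_nonneg_right ?_ (norm_nonneg _)
  rw [Complex.norm_cpow_eq_rpow_re_of_pos hx.1, Complex.norm_cpow_eq_rpow_re_of_pos hx.1]
  refine Real.rpow_le_rpow_of_exponent_ge hx.1 hx.2 ?_
  simp
  linarith

/-- The function `r^{-s} ∏ Γ(q_k + s) / Γ(p_k + s)`. -/
noncomputable def hypGamma (q p : Fin 4 → ℝ) (r : ℝ) (s : ℂ) : ℂ :=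
  (∏ k, Complex.Gamma (q k + s) * (Complex.Gamma (p k + s))⁻¹) *
    Complex.exp (-(s * (Real.log r : ℝ)))

lemma differentiableAt_hypGamma {q p : Fin 4 → ℝ} {r : ℝ} {s : ℂ} (h : ∀ k, 0 < q k + s.re) :
    DifferentiableAt ℂ (hypGamma q p r) s := by
  refine (DifferentiableAt.fun_finsetProd fun k _ => ?_).mul (by fun_prop)
  have h1 : DifferentiableAt ℂ (fun s => Complex.Gamma (q k + s)) s := by
    refine (Complex.differentiableAt_Gamma _ fun m hm => ?_).comp s (by fun_prop)
    have h2 := congrArg Complex.re hm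
    simp at h2
    have := h k
    have hm0 : (0 : ℝ) ≤ m := m.cast_nonneg
    linarith
  have h2 : DifferentiableAt ℂ (fun s => (Complex.Gamma (p k + s))⁻¹) s :=
    (Complex.differentiable_one_div_Gamma _).comp s
      (f := fun s => (p k : ℂ) + s) (by fun_prop)
  exact h1.mul h2

lemma norm_cpow_eq {Z : ℂ} (hZ : Z ≠ 0) (s : ℂ) :
    ‖Z ^ s‖ = ‖Z‖ ^ s.re * Real.exp (-(Z.arg * s.im)) := by
  rw [Complex.norm_cpow_of_ne_zero hZ, Real.exp_neg, div_eq_mul_inv]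

/-- Since the Gamma quotients are bounded, the growth is that of `(Z / r) ^ s`: `arg Z` governs the
vertical and `|Z| / r` the horizontal direction. -/
lemma halfPlaneBound_hypGamma {q p : Fin 4 → ℝ} {r c : ℝ} (hr : 0 < r) (h : Admissible q p)
    (hc : ∀ k, 0 < q k + c) {Z : ℂ} (hZ : Z ≠ 0) : ∃ M, 0 ≤ M ∧
      HalfPlaneBound (fun s => hypGamma q p r s * Z ^ s) c Z.arg (‖Z‖ / r) M := by
  have hK := fun k => exists_norm_Gamma_ratio_le (h k).2 (hc k)
  choose K hK0 hK using hK
  refine ⟨∏ k, K k, Finset.prod_nonneg fun k _ => hK0 k, ?_, fun s hs => ?_⟩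
  · obtain ⟨η, hη, hη'⟩ : ∃ η > 0, ∀ k, η < q k + c := by
      obtain ⟨η, h1, h2⟩ := exists_between ((Finset.lt_inf'_iff (Finset.univ_nonempty
        (α := Fin 4)) (f := fun k => q k + c)).2 fun k _ => hc k)
      exact ⟨η, h1, fun k => (Finset.lt_inf'_iff _).1 h2 k (Finset.mem_univ k)⟩
    refine ⟨c - η, by linarith, fun s hs => DifferentiableAt.differentiableWithinAt ?_⟩
    refine (differentiableAt_hypGamma fun k => ?_).mul
      (differentiableAt_id.const_cpow (Or.inl hZ))
    have := hη' k
    have hs' : c - η < s.re := hs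
    linarith
  · rw [norm_mul, hypGamma, norm_mul, norm_prod, norm_cpow_eq hZ, Complex.norm_exp]
    have h1 : (-(s * ((Real.log r : ℝ) : ℂ))).re = Real.log r * -s.re := by simp; ring
    rw [h1, Real.exp_mul, Real.exp_log hr, Real.rpow_neg hr.le, Real.div_rpow (norm_nonneg _) hr.le]
    have h2 : ∏ k, ‖Complex.Gamma (q k + s) * (Complex.Gamma (p k + s))⁻¹‖ ≤ ∏ k, K k :=
      Finset.prod_le_prod (fun _ _ => norm_nonneg _) fun k _ => hK k s hs
    have h3 : 0 ≤ (r ^ s.re)⁻¹ * (‖Z‖ ^ s.re * Real.exp (-(Z.arg * s.im))) := by positivity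
    calc _ = (∏ k, ‖Complex.Gamma (q k + s) * (Complex.Gamma (p k + s))⁻¹‖) *
          ((r ^ s.re)⁻¹ * (‖Z‖ ^ s.re * Real.exp (-(Z.arg * s.im)))) := by ring
      _ ≤ (∏ k, K k) * ((r ^ s.re)⁻¹ * (‖Z‖ ^ s.re * Real.exp (-(Z.arg * s.im)))) := by gcongr
      _ = _ := by ring

/-- The link between Gamma functions and the Frobenius method: the functional equation turns a shift
by `n` into the factor `hypRatio`, whose Taylor coefficients are the coefficients of the solutions.
-/
lemma hypGamma_add_nat {q p : Fin 4 → ℝ} {r δ : ℝ} (hr : 0 < r) (hq : ∀ k, δ ≤ q k)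
    (hp : ∀ k, δ ≤ p k) {s : ℂ} (hs : ‖s‖ < δ) (n : ℕ) :
    hypGamma q p r (s + n) = hypGamma q p r s * hypRatio q p r n s := by
  induction n with
  | zero => simp [hypRatio]
  | succ n ih =>
    have h1 : hypRatio q p r (n + 1) s = hypRatio q p r n s *
        ((r : ℂ)⁻¹ * ∏ k, ((q k + n : ℂ) + s) * ((p k + n : ℂ) + s)⁻¹) :=
      Finset.prod_range_succ _ _
    have h2 : ∀ (c : ℝ), δ ≤ c → Complex.Gamma (c + (s + (n + 1 : ℕ))) =
        ((c + n : ℂ) + s) * Complex.Gamma (c + (s + n)) := by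
      intro c hc
      rw [show (c : ℂ) + (s + (n + 1 : ℕ)) = (c + (s + n)) + 1 by push_cast; ring,
        Complex.Gamma_add_one _ (by
          rw [show (c : ℂ) + (s + n) = (c + n : ℂ) + s by ring]
          exact shift_ne_zero hc n hs)]
      ring
    have h3 : Complex.exp (-((s + (n + 1 : ℕ)) * (Real.log r : ℝ))) =
        Complex.exp (-((s + n) * (Real.log r : ℝ))) * (r : ℂ)⁻¹ := by
      rw [show -((s + (n + 1 : ℕ)) * ((Real.log r : ℝ) : ℂ)) =
        -((s + n) * (Real.log r : ℝ)) + -(Real.log r : ℝ) by push_cast; ring, Complex.exp_add,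
        Complex.exp_neg ((Real.log r : ℝ) : ℂ), ← Complex.ofReal_exp, Real.exp_log hr]
    rw [h1, ← mul_assoc, ← ih, hypGamma, hypGamma, h3]
    have h4 : ∏ k, Complex.Gamma (q k + (s + (n + 1 : ℕ))) *
        (Complex.Gamma (p k + (s + (n + 1 : ℕ))))⁻¹ =
        (∏ k, Complex.Gamma (q k + (s + n)) * (Complex.Gamma (p k + (s + n)))⁻¹) *
        ∏ k, ((q k + n : ℂ) + s) * ((p k + n : ℂ) + s)⁻¹ := by
      rw [← Finset.prod_mul_distrib]
      refine Finset.prod_congr rfl fun k _ => ?_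
      rw [h2 _ (hq k), h2 _ (hp k), mul_inv]
      ring
    rw [h4]
    ring

lemma analyticAt_hypGamma {q p : Fin 4 → ℝ} {r : ℝ} (h : Admissible q p) :
    AnalyticAt ℂ (hypGamma q p r) 0 := by
  obtain ⟨δ, hδ, hq⟩ := h.exists_radius
  have hd : DifferentiableOn ℂ (hypGamma q p r) {s | -δ < s.re} := fun s hs =>
    (differentiableAt_hypGamma fun k => by
      have h1 : -δ < s.re := hs
      have := hq k
      linarith).differentiableWithinAt
  exact hd.analyticAt ((isOpen_lt continuous_const Complex.continuous_re).mem_nhds (by simpa))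

lemma hypGamma_zero_ne_zero {q p : Fin 4 → ℝ} {r : ℝ} (h : Admissible q p) :
    hypGamma q p r 0 ≠ 0 := by
  refine mul_ne_zero (Finset.prod_ne_zero_iff.2 fun k _ => ?_) (Complex.exp_ne_zero _)
  refine mul_ne_zero (Complex.Gamma_ne_zero_of_re_pos ?_)
    (inv_ne_zero (Complex.Gamma_ne_zero_of_re_pos ?_))
  · simpa using (h k).1
  · simpa using (h k).1.trans (h k).2

lemma jet_hypGamma_mul_cpow {q p : Fin 4 → ℝ} {r : ℝ} (hr : 0 < r) (h : Admissible q p) {Z : ℂ}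
    (hZ : Z ≠ 0) (n : ℕ) : (jet fun s => hypGamma q p r (s + n) * Z ^ (s + n)) =
      C (Z ^ n) * (jet (hypGamma q p r) *
        (frobCoeff q p r n * jet fun s => Complex.exp (Complex.log Z * s))) := by
  obtain ⟨δ, hδ, hq⟩ := h.exists_radius
  have hp : ∀ k, δ ≤ p k := fun k => (hq k).trans (h k).2.le
  have hR := analyticAt_hypRatio (q := q) (r := r) hp n (s := 0) (by simpa using hδ)
  have hE : AnalyticAt ℂ (fun s => Complex.exp (Complex.log Z * s)) 0 := by fun_prop
  rw [frobCoeff, ← jet_mul hR hE, ← jet_mul (g := fun s => hypRatio q p r n s *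
      Complex.exp (Complex.log Z * s)) (analyticAt_hypGamma h) (hR.mul hE),
    ← jet_const_mul (f := fun s => hypGamma q p r s * (hypRatio q p r n s *
      Complex.exp (Complex.log Z * s))) _ ((analyticAt_hypGamma h).mul (hR.mul hE))]
  refine jet_congr ?_
  filter_upwards [Metric.ball_mem_nhds (0 : ℂ) hδ] with s hs
  rw [hypGamma_add_nat hr hq hp (mem_ball_zero_iff.1 hs) n, Complex.cpow_add _ _ hZ,
    Complex.cpow_natCast, Complex.cpow_def_of_ne_zero hZ s]
  ring

/-- The residue at `n` is a coefficient of a product of three power series, coming from the Gamma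
quotient, from `hypRatio` and from `exp (s log Z)`. The first is independent of `n`; summing the
other two gives the logarithmic Frobenius series. -/
lemma hasSum_coeff_jet {q p : Fin 4 → ℝ} {r : ℝ} (hr : 0 < r) (h : Admissible q p) {Z : ℂ}
    (hZ : Z ≠ 0) (hZr : ‖Z‖ < r) (j : ℕ) :
    HasSum (fun n : ℕ => coeff j (jet fun s => hypGamma q p r (s + n) * Z ^ (s + n)))
      (∑ i ∈ Finset.range (j + 1), coeff i (jet (hypGamma q p r)) *
        logSeries 0 (ser (frobCoeff q p r)) (j - i) Z) := by
  have hconv := conv_frobCoeff hr h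
  have h1 : ∀ N, HasSum (fun n => Z ^ n * coeff N (frobCoeff q p r n *
      jet fun s => Complex.exp (Complex.log Z * s)))
      (logSeries 0 (ser (frobCoeff q p r)) N Z) := by
    intro N
    have h2 := hasSum_sum (s := Finset.range (N + 1)) fun l _ =>
      (hconv.hasSum l hZr).mul_right (Complex.log Z ^ (N - l) / ((N - l).factorial : ℂ))
    convert! h2 using 1
    · funext n
      rw [coeff_mul, Finset.Nat.sum_antidiagonal_eq_sum_range_succ_mk, Finset.mul_sum]
      refine Finset.sum_congr rfl fun l _ => ?_
      rw [coeff_jet_exp]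
      ring
    · rw [logSeries, Complex.ofReal_zero, Complex.cpow_zero, one_mul]
      refine Finset.sum_congr rfl fun l _ => ?_
      rw [mul_div_assoc]
  have h3 := hasSum_sum (s := Finset.range (j + 1)) fun i _ =>
    (h1 (j - i)).mul_left (coeff i (jet (hypGamma q p r)))
  refine h3.congr_fun fun n => ?_
  rw [jet_hypGamma_mul_cpow hr h hZ n, coeff_C_mul, coeff_mul,
    Finset.Nat.sum_antidiagonal_eq_sum_range_succ_mk, Finset.mul_sum]
  refine Finset.sum_congr rfl fun i _ => ?_
  ring

lemma arg_bounds {ε : ℝ} (hε : ε = 1 ∨ ε = -1) {Z : ℂ} (hZ : 0 < ε * Z.im) :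
    0 < ε * Z.arg ∧ ε * Z.arg < Real.pi := by
  rcases hε with rfl | rfl
  · simp only [one_mul] at hZ ⊢
    have h1 : Z.arg ≠ Real.pi := fun h => by
      rw [Complex.arg_eq_pi_iff] at h
      linarith [h.2]
    have h2 : Z.arg ≠ 0 := fun h => by
      rw [Complex.arg_eq_zero_iff] at h
      linarith [h.2]
    exact ⟨lt_of_le_of_ne (Complex.arg_nonneg_iff.2 hZ.le) (Ne.symm h2),
      lt_of_le_of_ne (Complex.arg_le_pi Z) h1⟩
  · have h1 : Z.arg < 0 := Complex.arg_neg_iff.2 (by linarith)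
    have h2 := Complex.neg_pi_lt_arg Z
    exact ⟨by linarith, by linarith⟩

theorem lineInt_hypGamma {ε : ℝ} (hε : ε = 1 ∨ ε = -1) {q p : Fin 4 → ℝ} {r c : ℝ} (hr : 0 < r)
    (h : Admissible q p) (hc1 : -1 < c) (hc0 : c < 0) (hc : ∀ k, 0 < q k + c) {Z : ℂ}
    (hZ : 0 < ε * Z.im) (hZr : ‖Z‖ < r) {j : ℕ} (hj : j < 4) :
    -(2 * Real.pi : ℂ)⁻¹ * lineInt ε (fun s => hypGamma q p r s * Z ^ s) j c =
      ∑ i ∈ Finset.range (j + 1), coeff i (jet (hypGamma q p r)) *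
        logSeries 0 (ser (frobCoeff q p r)) (j - i) Z := by
  have hZ0 : Z ≠ 0 := fun h0 => by simp [h0] at hZ
  obtain ⟨h1, h2⟩ := arg_bounds hε hZ
  obtain ⟨M, hM, hb⟩ := halfPlaneBound_hypGamma hr h hc hZ0
  have h3 := tendsto_sum_coeff_jet hε hc1 hc0 hM (div_pos (norm_pos_iff.2 hZ0) hr)
    ((div_lt_one hr).2 hZr) h1 (by linarith [Real.pi_pos]) hb hj
  exact tendsto_nhds_unique h3 (hasSum_coeff_jet hr h hZ0 hZr j).tendsto_sum_nat

/-- Differentiating `Z ^ s` in `Z` brings down a factor `s`; half of the exponential decay absorbs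
it. -/
lemma add_abs_mul_exp_le {δ : ℝ} (hδ : 0 < δ) {A : ℝ} (hA : 0 ≤ A) (t : ℝ) :
    (A + |t|) * Real.exp (-(δ * |t|)) ≤ (A + 2 / δ) * Real.exp (-(δ / 2 * |t|)) := by
  have h1 : |t| ≤ 2 / δ * Real.exp (δ / 2 * |t|) := by
    have h2 := Real.add_one_le_exp (δ / 2 * |t|)
    calc |t| = 2 / δ * (δ / 2 * |t|) := by field_simp
      _ ≤ _ := by gcongr; linarith
  have h3 : 1 ≤ Real.exp (δ / 2 * |t|) := Real.one_le_exp (by positivity)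
  have h4 : Real.exp (-(δ * |t|)) = Real.exp (-(δ / 2 * |t|)) * Real.exp (-(δ / 2 * |t|)) := by
    rw [← Real.exp_add]
    ring_nf
  have h5 : Real.exp (δ / 2 * |t|) * Real.exp (-(δ / 2 * |t|)) = 1 := by
    rw [← Real.exp_add]
    simp
  have h6 : A + |t| ≤ (A + 2 / δ) * Real.exp (δ / 2 * |t|) := by
    nlinarith
  calc (A + |t|) * Real.exp (-(δ * |t|)) ≤
      ((A + 2 / δ) * Real.exp (δ / 2 * |t|)) * Real.exp (-(δ * |t|)) := by gcongr
    _ = _ := by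
      rw [h4]
      linear_combination (A + 2 / δ) * Real.exp (-(δ / 2 * |t|)) * h5

/-- Mellin-Barnes integrals are holomorphic. -/
theorem differentiableOn_integral_cpow {ε : ℝ} (hε : ε = 1 ∨ ε = -1) {c K : ℝ} {g : ℝ → ℂ}
    (hg : Continuous g) (hK0 : 0 ≤ K)
    (hK : ∀ t, ‖g t‖ ≤ K * min 1 (Real.exp (2 * Real.pi * ε * t))) :
    DifferentiableOn ℂ (fun Z => ∫ t, g t * Z ^ vline c t) {Z | 0 < ε * Z.im} := by
  intro Z₀ hZ₀
  have hZ₀' : 0 < ε * Z₀.im := hZ₀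
  have hne : ∀ Z : ℂ, 0 < ε * Z.im → Z ≠ 0 := fun Z hZ h0 => by simp [h0] at hZ
  have hslit : ∀ Z : ℂ, 0 < ε * Z.im → Z ∈ Complex.slitPlane := fun Z hZ => Or.inr fun h0 => by
    simp [h0] at hZ
  obtain ⟨hθ0, hθπ⟩ := arg_bounds hε hZ₀'
  -- Near `Z₀` the number `ε arg Z` stays above `θ₁` and below `π`, so one decay rate `δ` serves for
  -- a whole neighbourhood.
  set θ₁ := ε * Z₀.arg / 2 with hθ₁
  have hδ : 0 < min θ₁ Real.pi := lt_min (by positivity) Real.pi_pos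
  set δ := min θ₁ Real.pi with hδdef
  set R := ‖Z₀‖ / 2 with hR
  have hR0 : 0 < R := half_pos (norm_pos_iff.2 (hne _ hZ₀'))
  obtain ⟨S, hS, hSprop⟩ : ∃ S ∈ 𝓝 Z₀, ∀ Z ∈ S, 0 < ε * Z.im ∧ θ₁ < ε * Z.arg ∧ R < ‖Z‖ ∧
      ‖Z‖ < 3 * R := by
    have h1 : ∀ᶠ Z in 𝓝 Z₀, 0 < ε * Z.im :=
      (continuous_const.mul Complex.continuous_im).continuousAt.eventually (lt_mem_nhds hZ₀')
    have h2 : ∀ᶠ Z in 𝓝 Z₀, θ₁ < ε * Z.arg :=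
      (continuousAt_const.mul (Complex.continuousAt_arg (hslit _ hZ₀'))).eventually
        (lt_mem_nhds
          (show θ₁ < ε * Z₀.arg by rw [hθ₁]; linarith))
    have h3 : ∀ᶠ Z in 𝓝 Z₀, R < ‖Z‖ :=
      continuous_norm.continuousAt.eventually (lt_mem_nhds (by rw [hR] at hR0 ⊢; linarith))
    have h4 : ∀ᶠ Z in 𝓝 Z₀, ‖Z‖ < 3 * R :=
      continuous_norm.continuousAt.eventually (gt_mem_nhds (by rw [hR] at hR0 ⊢; linarith))
    exact ⟨_, h1.and (h2.and (h3.and h4)), fun Z hZ => hZ⟩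
  have hpow : ∀ e : ℝ, ∃ A, 0 ≤ A ∧ ∀ Z ∈ S, ‖Z‖ ^ e ≤ A := by
    intro e
    refine ⟨max (R ^ e) ((3 * R) ^ e), by positivity, fun Z hZ => ?_⟩
    obtain ⟨_, _, h3, h4⟩ := hSprop Z hZ
    rcases le_total 0 e with he | he
    · exact (Real.rpow_le_rpow (norm_nonneg _) h4.le he).trans (le_max_right _ _)
    · exact (Real.rpow_le_rpow_of_nonpos hR0 h3.le he).trans (le_max_left _ _)
  have hdecay : ∀ Z ∈ S, ∀ t : ℝ, Real.exp (-(Z.arg * t)) * min 1 (Real.exp (2 * Real.pi * ε * t))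
      ≤ Real.exp (-(δ * |t|)) := by
    intro Z hZ t
    obtain ⟨h1, h2, _, _⟩ := hSprop Z hZ
    refine (exp_neg_mul_min_le hε).trans (Real.exp_le_exp.2 ?_)
    have h3 : δ ≤ min (ε * Z.arg) (2 * Real.pi - ε * Z.arg) := by
      refine le_min ((min_le_left _ _).trans h2.le) ((min_le_right _ _).trans ?_)
      linarith [(arg_bounds hε h1).2]
    have := mul_le_mul_of_nonneg_right h3 (abs_nonneg t)
    linarith
  obtain ⟨A₀, hA₀, hA₀'⟩ := hpow c
  obtain ⟨A₁, hA₁, hA₁'⟩ := hpow (c - 1)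
  have hcont : ∀ Z : ℂ, 0 < ε * Z.im → ∀ e : ℂ, Continuous fun t => Z ^ (vline c t + e) := by
    intro Z hZ e
    exact Continuous.const_cpow ((continuous_vline c).add continuous_const) (Or.inl (hne Z hZ))
  have hcont0 : ∀ Z : ℂ, 0 < ε * Z.im → Continuous fun t => Z ^ (vline c t) := by
    intro Z hZ
    exact Continuous.const_cpow (continuous_vline c) (Or.inl (hne Z hZ))
  have hmain := hasDerivAt_integral_of_dominated_loc_of_deriv_le (μ := volume)
    (F := fun Z t => g t * Z ^ vline c t) (x₀ := Z₀) (s := S)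
    (F' := fun Z t => g t * (vline c t * Z ^ (vline c t + (-1 : ℂ))))
    (bound := fun t => K * A₁ * (|c| + 2 / δ) * Real.exp (-(δ / 2 * |t|))) hS ?_ ?_ ?_ ?_ ?_ ?_
  · exact hmain.2.differentiableAt.differentiableWithinAt
  · filter_upwards [hS] with Z hZ
    exact (hg.mul (hcont0 Z (hSprop Z hZ).1)).aestronglyMeasurable
  · refine Integrable.mono' ((integrable_exp_neg_mul_abs hδ).const_mul (K * A₀))
      (hg.mul (hcont0 Z₀ hZ₀')).aestronglyMeasurable (ae_of_all _ fun t => ?_)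
    have hZS : Z₀ ∈ S := mem_of_mem_nhds hS
    rw [norm_mul, norm_cpow_eq (hne _ hZ₀'), vline_re, vline_im]
    calc ‖g t‖ * (‖Z₀‖ ^ c * Real.exp (-(Z₀.arg * t)))
        ≤ (K * min 1 (Real.exp (2 * Real.pi * ε * t))) * (A₀ * Real.exp (-(Z₀.arg * t))) := by
          gcongr
          · exact hK t
          · exact hA₀' _ hZS
      _ = K * A₀ * (Real.exp (-(Z₀.arg * t)) * min 1 (Real.exp (2 * Real.pi * ε * t))) := by ring
      _ ≤ _ := by
        gcongr
        exact hdecay _ hZS t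
  · exact (hg.mul ((continuous_vline c).mul (hcont Z₀ hZ₀' (-1)))).aestronglyMeasurable
  · refine ae_of_all _ fun t Z hZ => ?_
    have hZ' := (hSprop Z hZ).1
    rw [norm_mul, norm_mul, norm_cpow_eq (hne _ hZ')]
    have e1 : (vline c t + (-1 : ℂ)).re = c - 1 := by simp; ring
    have e2 : (vline c t + (-1 : ℂ)).im = t := by simp
    have e3 : ‖vline c t‖ ≤ |c| + |t| := by
      simpa using Complex.norm_le_abs_re_add_abs_im (vline c t)
    rw [e1, e2]
    calc ‖g t‖ * (‖vline c t‖ * (‖Z‖ ^ (c - 1) * Real.exp (-(Z.arg * t))))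
        ≤ (K * min 1 (Real.exp (2 * Real.pi * ε * t))) *
          ((|c| + |t|) * (A₁ * Real.exp (-(Z.arg * t)))) := by
          gcongr
          · exact hK t
          · exact hA₁' _ hZ
      _ = K * A₁ * ((|c| + |t|) *
          (Real.exp (-(Z.arg * t)) * min 1 (Real.exp (2 * Real.pi * ε * t)))) := by ring
      _ ≤ K * A₁ * ((|c| + |t|) * Real.exp (-(δ * |t|))) := by
        gcongr
        exact hdecay _ hZ t
      _ ≤ K * A₁ * ((|c| + 2 / δ) * Real.exp (-(δ / 2 * |t|))) := by
        gcongr K * A₁ * ?_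
        exact add_abs_mul_exp_le hδ (abs_nonneg c) t
      _ = _ := by ring
  · exact (integrable_exp_neg_mul_abs (half_pos hδ)).const_mul _
  · refine ae_of_all _ fun t Z hZ => ?_
    have h1 := ((hasDerivAt_id Z).cpow_const (c := vline c t)
      (hslit Z (hSprop Z hZ).1)).const_mul (g t)
    refine h1.congr_deriv ?_
    simp only [id_eq, mul_one, sub_eq_add_neg]

end CYPeriods

/-! ### The reflection formula and the continuation across `|z| = μ`. -/

namespace CYPeriods

open Filter Topology PowerSeries MeasureTheory

/-- Two reflection formulas produce the factor `-sin π(a + s) / sin πs`. Written with exponentials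
it is, up to the constant `e^{-wt ε a / 2}`, a rational function of `u = e^{wt ε s}`. -/
lemma Gamma_ratio_reflection {ε : ℝ} (hε : ε = 1 ∨ ε = -1) (a : ℝ) {s : ℂ}
    (h1 : ∀ n : ℤ, s ≠ n) (h2 : ∀ n : ℤ, (a : ℂ) + s ≠ n) :
    Complex.Gamma (-s) * (Complex.Gamma (1 - a - s))⁻¹ =
      -(Complex.Gamma (a + s) * (Complex.Gamma (1 + s))⁻¹) *
        ((Complex.exp (wt ε * a) * Complex.exp (wt ε * s) - 1) *
          Complex.exp (-(wt ε / 2 * a)) / (Complex.exp (wt ε * s) - 1)) := by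
  have hu1 : Complex.exp (wt ε * s) - 1 ≠ 0 := sub_ne_zero.2 fun h => by
    obtain ⟨n, hn⟩ := (exp_wt_mul_eq_one_iff hε).1 h
    exact h1 n hn
  have hs1 := Complex.Gamma_mul_Gamma_one_sub (-s)
  have hs2 := Complex.Gamma_mul_Gamma_one_sub (a + s)
  rw [sub_neg_eq_add] at hs1
  rw [← sub_sub] at hs2
  have hG1 : Complex.Gamma (1 + s) ≠ 0 := Complex.Gamma_ne_zero fun m hm =>
    h1 (-(m + 1 : ℤ)) (by push_cast; linear_combination hm)
  have hsin : ∀ y : ℂ, Complex.sin (Real.pi * y) =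
      ε * (Complex.exp (wt ε * y) - 1) * Complex.exp (-(wt ε / 2 * y)) / (2 * Complex.I) := by
    intro y
    have e1 : Complex.exp (wt ε * y) = Complex.exp (wt ε / 2 * y) * Complex.exp (wt ε / 2 * y) := by
      rw [← Complex.exp_add]
      ring_nf
    have e2 : Complex.exp (wt ε / 2 * y) * Complex.exp (-(wt ε / 2 * y)) = 1 := by
      rw [← Complex.exp_add]
      simp
    have e3 : (Complex.exp (wt ε * y) - 1) * Complex.exp (-(wt ε / 2 * y)) =
        Complex.exp (wt ε / 2 * y) - Complex.exp (-(wt ε / 2 * y)) := by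
      rw [e1]
      linear_combination Complex.exp (wt ε / 2 * y) * e2
    rw [mul_assoc, e3, Complex.sin]
    have hI := Complex.I_sq
    rcases hε with rfl | rfl
    · rw [show wt 1 / 2 * y = Real.pi * y * Complex.I by rw [wt]; push_cast; ring]
      field_simp
      rw [hI]
      push_cast
      ring_nf
    · rw [show wt (-1) / 2 * y = -(Real.pi * y * Complex.I) by rw [wt]; push_cast; ring]
      field_simp
      rw [hI]
      push_cast
      ring_nf
  have hGa : Complex.Gamma (a + s) ≠ 0 := Complex.Gamma_ne_zero fun m hm =>
    h2 (-m) (by push_cast; exact hm)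
  have hu2 : Complex.exp (wt ε * a) * Complex.exp (wt ε * s) - 1 ≠ 0 := sub_ne_zero.2 fun h => by
    rw [← Complex.exp_add, ← mul_add] at h
    obtain ⟨n, hn⟩ := (exp_wt_mul_eq_one_iff hε).1 h
    exact h2 n hn
  have hpi : (Real.pi : ℂ) ≠ 0 := by exact_mod_cast Real.pi_ne_zero
  have hε0 : (ε : ℂ) ≠ 0 := by rcases hε with rfl | rfl <;> simp
  have e1 : Complex.sin (Real.pi * -s) = -(ε * (Complex.exp (wt ε * s) - 1) *
      Complex.exp (-(wt ε / 2 * s)) / (2 * Complex.I)) := by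
    rw [← hsin, ← Complex.sin_neg, mul_neg]
  have e2 : Complex.sin (Real.pi * (a + s)) = ε * (Complex.exp (wt ε * a) *
      Complex.exp (wt ε * s) - 1) * (Complex.exp (-(wt ε / 2 * a)) * Complex.exp (-(wt ε / 2 * s))) /
        (2 * Complex.I) := by
    rw [hsin, mul_add, Complex.exp_add, mul_add, neg_add, Complex.exp_add]
  have hA := Complex.exp_ne_zero (-(wt ε / 2 * a))
  have hS := Complex.exp_ne_zero (-(wt ε / 2 * s))
  rw [e1] at hs1
  rw [e2] at hs2
  have hB : Complex.Gamma (1 - a - s) ≠ 0 := fun h0 => by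
    rw [h0, mul_zero] at hs2
    exact absurd hs2.symm (div_ne_zero hpi (div_ne_zero (mul_ne_zero (mul_ne_zero hε0 hu2)
      (mul_ne_zero hA hS)) (by simp)))
  have hI := Complex.I_ne_zero
  rw [eq_div_of_mul_eq hG1 hs1, eq_div_of_mul_eq hGa ((mul_comm _ _).trans hs2)]
  field_simp

lemma cpow_ofReal_div {lam : ℝ} (hlam : 0 < lam) {z : ℂ} (hz : z.im ≠ 0) (s : ℂ) :
    ((lam : ℂ) / z) ^ s = Complex.exp (s * Real.log lam) * z ^ (-s) := by
  have hz0 : z ≠ 0 := fun h => hz (by simp [h])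
  have harg : z.arg ≠ Real.pi := fun h => hz (Complex.arg_eq_pi_iff.1 h).2
  have hl : (lam : ℂ) ≠ 0 := by exact_mod_cast hlam.ne'
  rw [Complex.cpow_def_of_ne_zero (div_ne_zero hl hz0), Complex.cpow_def_of_ne_zero hz0,
    div_eq_mul_inv, Complex.log_ofReal_mul hlam (inv_ne_zero hz0), Complex.log_inv _ harg,
    ← Complex.exp_add]
  congr 1
  ring

/-- The function `r^{-s} ∏ Γ(ρ + β_k + s) / Γ(1 + ρ + α_k + s)`. -/
noncomputable def frobGamma (α β : Fin 4 → ℝ) (r ρ : ℝ) : ℂ → ℂ :=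
  hypGamma (fun k => ρ + β k) (fun k => 1 + ρ + α k) r

/-- The key to the continuation: after `s ↦ -a - s` the Gamma quotient at infinity becomes the one
at zero times a rational function of `u = e^{wt ε s}` and exponential factors. The constants `e^{-wt
ε b_k / 2}` multiply to `1` because the `b_k` add up to `2`, and the four signs cancel. -/
lemma frobGamma_neg_sub {ε : ℝ} (hε : ε = 1 ∨ ε = -1) {b : Fin 4 → ℝ} (hb : ∑ k, b k = 2)
    {mu lam : ℝ} (hmu : 0 < mu) (hlam : 0 < lam) (a : ℝ) {s : ℂ} (h1 : ∀ n : ℤ, s ≠ n)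
    (h2 : ∀ k, ∀ n : ℤ, (b k : ℂ) + s ≠ n) :
    frobGamma (fun k => -b k) 0 (lam / mu) a (-a - s) =
      frobGamma 0 b mu 0 s * ((∏ k, (Complex.exp (wt ε * b k) * Complex.exp (wt ε * s) - 1)) /
        (Complex.exp (wt ε * s) - 1) ^ 4) * (((lam / mu : ℝ) : ℂ) ^ (a : ℂ) *
        Complex.exp (s * Real.log lam)) := by
  have hp : ∀ k, Complex.Gamma (-s) * (Complex.Gamma (1 - b k - s))⁻¹ = _ := fun k =>
    Gamma_ratio_reflection hε (b k) h1 (h2 k)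
  have hL : ∏ k, Complex.Gamma (((a + (0 : Fin 4 → ℝ) k : ℝ) : ℂ) + (-a - s)) *
      (Complex.Gamma (((1 + a + -b k : ℝ) : ℂ) + (-a - s)))⁻¹ =
      ∏ k, Complex.Gamma (-s) * (Complex.Gamma (1 - b k - s))⁻¹ := by
    refine Finset.prod_congr rfl fun k _ => ?_
    rw [show ((a + (0 : Fin 4 → ℝ) k : ℝ) : ℂ) + (-a - s) = -s by
        simp only [Pi.zero_apply, add_zero]; ring,
      show ((1 + a + -b k : ℝ) : ℂ) + (-a - s) = 1 - b k - s by push_cast; ring]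
  have hR : ∏ k, Complex.Gamma (((0 + b k : ℝ) : ℂ) + s) *
      (Complex.Gamma (((1 + 0 + (0 : Fin 4 → ℝ) k : ℝ) : ℂ) + s))⁻¹ =
      ∏ k, Complex.Gamma (b k + s) * (Complex.Gamma (1 + s))⁻¹ := by simp
  have hE : ∏ k, Complex.exp (-(wt ε / 2 * b k)) = 1 := by
    rw [← Complex.exp_sum, Finset.sum_neg_distrib, ← Finset.mul_sum, ← Complex.ofReal_sum, hb,
      Complex.exp_neg]
    simp [exp_wt hε]
  have hP : ∏ k, (-(Complex.Gamma (b k + s) * (Complex.Gamma (1 + s))⁻¹) *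
        ((Complex.exp (wt ε * b k) * Complex.exp (wt ε * s) - 1) *
          Complex.exp (-(wt ε / 2 * b k)) / (Complex.exp (wt ε * s) - 1))) =
      (∏ k, Complex.Gamma (b k + s) * (Complex.Gamma (1 + s))⁻¹) *
      ((∏ k, (Complex.exp (wt ε * b k) * Complex.exp (wt ε * s) - 1)) /
        (Complex.exp (wt ε * s) - 1) ^ 4) * ∏ k, Complex.exp (-(wt ε / 2 * b k)) := by
    simp only [Finset.prod_mul_distrib, Finset.prod_div_distrib, Finset.prod_neg,
      Finset.prod_const, Finset.card_univ, Fintype.card_fin]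
    ring
  have hr0 : ((lam / mu : ℝ) : ℂ) ≠ 0 := by exact_mod_cast (div_pos hlam hmu).ne'
  rw [frobGamma, frobGamma, hypGamma, hypGamma, hL, Finset.prod_congr rfl fun k _ => hp k, hP, hE,
    hR, mul_one, Complex.cpow_def_of_ne_zero hr0, ← Complex.ofReal_log (div_pos hlam hmu).le,
    ← Complex.exp_add]
  have e : Complex.exp (-((-a - s) * ((Real.log (lam / mu) : ℝ) : ℂ))) =
      Complex.exp (-(s * ((Real.log mu : ℝ) : ℂ))) *
        Complex.exp (((Real.log (lam / mu) : ℝ) : ℂ) * a + s * ((Real.log lam : ℝ) : ℂ)) := by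
    rw [← Complex.exp_add, Real.log_div hlam.ne' hmu.ne']
    congr 1
    push_cast
    ring
  rw [e]
  ring

lemma logSeries_eq_cpow_mul (ρ : ℝ) (g : ℕ → ℂ → ℂ) (n : ℕ) (x : ℂ) :
    logSeries ρ g n x = x ^ (ρ : ℂ) * logSeries 0 g n x := by
  simp [logSeries]

/-- Residues deliver the solutions convolved with the Taylor series of the Gamma quotient; the
inverse series `γ` isolates a single member of the basis. -/
lemma sum_convolution_eq {G : ℂ⟦X⟧} {γ : ℕ → ℂ} (hγ : G * PowerSeries.mk γ = 1) (Λ : ℕ → ℂ)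
    (N : ℕ) : ∑ j ∈ Finset.range (N + 1), γ j *
      ∑ i ∈ Finset.range (N - j + 1), coeff i G * Λ (N - j - i) = Λ N := by
  have h : PowerSeries.mk γ * (G * PowerSeries.mk Λ) = PowerSeries.mk Λ := by
    rw [← mul_assoc, mul_comm (PowerSeries.mk γ), hγ, one_mul]
  have h2 := congrArg (coeff N) h
  rw [PowerSeries.coeff_mul, Finset.Nat.sum_antidiagonal_eq_sum_range_succ_mk,
    PowerSeries.coeff_mk] at h2
  rw [← h2]
  refine Finset.sum_congr rfl fun j _ => ?_
  rw [PowerSeries.coeff_mk, PowerSeries.coeff_mul,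
    Finset.Nat.sum_antidiagonal_eq_sum_range_succ_mk]
  simp only [PowerSeries.coeff_mk]

lemma vline_neg (a c t : ℝ) : vline (-a - c) (-t) = -a - vline c t := by
  simp only [vline]
  push_cast
  ring

/-- The Mellin-Barnes integral which continues a solution from `|z| > μ` to `|z| < μ`. -/
theorem exists_continuation {ε : ℝ} (hε : ε = 1 ∨ ε = -1) {b : Fin 4 → ℝ} (hb : ∑ k, b k = 2)
    (hb0 : ∀ k, 0 < b k) (hb1 : ∀ k, b k < 1) {mu lam : ℝ} (hmu : 0 < mu) (hlam : 0 < lam)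
    (i : Fin 4) {N : ℕ} (hN : N < 4) {γ D : ℕ → ℂ}
    (hγ : jet (frobGamma (fun k => -b k) 0 (lam / mu) (b i)) * PowerSeries.mk γ = 1)
    (hker : ∀ u : ℂ, u ≠ 1 → Complex.exp (wt ε * b i) * u ≠ 1 →
      (∏ k, (Complex.exp (wt ε * b k) * u - 1)) * ∑ j ∈ Finset.range (N + 1),
        γ j * kerPoly (wt (-ε)) (N - j) ((Complex.exp (wt ε * b i) * u - 1)⁻¹) =
      (u - 1) ^ 4 * ∑ m ∈ Finset.range 4, D m * kerPoly (wt ε) m ((u - 1)⁻¹)) :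
    ∃ F : ℂ → ℂ, DifferentiableOn ℂ F {z | 0 < ε * z.im} ∧
      (∀ z, 0 < ε * z.im → ‖z‖ < mu → F z = ((lam / mu : ℝ) : ℂ) ^ (b i : ℂ) *
        ∑ m ∈ Finset.range 4, D m * ∑ l ∈ Finset.range (m + 1),
          coeff l (jet (frobGamma 0 b mu 0)) * logSeries 0 (frobSeries 0 b mu 0) (m - l) z) ∧
      ∀ z, 0 < ε * z.im → mu < ‖z‖ → F z =
        logSeries (b i) (frobSeries (fun k => -b k) 0 (lam / mu) (b i)) N (lam / z) := by
  have hadm0 : Admissible (fun k => 0 + b k) (fun k => 1 + 0 + (0 : Fin 4 → ℝ) k) := fun k =>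
    ⟨by simpa using hb0 k, by simpa using hb1 k⟩
  have hadm1 : Admissible (fun k => b i + (0 : Fin 4 → ℝ) k) (fun k => 1 + b i + -b k) := fun k =>
    ⟨by simpa using hb0 i, by simp only [Pi.zero_apply]; linarith [hb1 k]⟩
  obtain ⟨δ, hδ0, hδ⟩ := hadm0.exists_radius
  simp only [zero_add] at hδ
  -- The line runs between the poles of `Γ(b_k + s)` and those of the kernels at `0, 1, 2, …`. Since
  -- `δ ≤ b_i < 1`, its mirror image `-b_i - c` lies in `(-1, 0)` too.
  set c := -(δ / 2) with hc
  have hci : -1 < c := by linarith [hδ i, hb1 i]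
  have hc0 : c < 0 := by linarith
  have hck : ∀ k, 0 < b k + c := fun k => by linarith [hδ k]
  have hn1 : ∀ t, ∀ n : ℤ, vline c t ≠ n := fun t n h => by
    have h1 := congrArg Complex.re h
    simp only [vline_re, Complex.intCast_re] at h1
    have h3 : (-1 : ℤ) < n := by exact_mod_cast (by linarith : (-1 : ℝ) < n)
    have h4 : n < (0 : ℤ) := by exact_mod_cast (by linarith : (n : ℝ) < 0)
    omega
  have hn2 : ∀ t k, ∀ n : ℤ, (b k : ℂ) + vline c t ≠ n := fun t k n h => by
    have h1 := congrArg Complex.re h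
    simp only [Complex.add_re, Complex.ofReal_re, vline_re, Complex.intCast_re] at h1
    have h3 : (0 : ℤ) < n := by exact_mod_cast (by linarith [hck k] : (0 : ℝ) < n)
    have h4 : n < (1 : ℤ) := by exact_mod_cast (by linarith [hb1 k] : (n : ℝ) < 1)
    omega
  set G := frobGamma 0 b mu 0 with hG
  set A := ((lam / mu : ℝ) : ℂ) ^ (b i : ℂ) with hA
  set g : ℝ → ℂ := fun t => ∑ m ∈ Finset.range 4, D m *
    (G (vline c t) * ker (wt ε) m (vline c t)) with hg
  have hgc : ∀ m, Continuous fun t => G (vline c t) * ker (wt ε) m (vline c t) := by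
    intro m
    have h1 : Continuous fun t => G (vline c t) := continuous_iff_continuousAt.2 fun t =>
      (differentiableAt_hypGamma fun k => by simpa using hck k).continuousAt.comp
        (continuous_vline c).continuousAt
    have h2 := continuous_ker_vline hε hci hc0 0 m
    simp only [Nat.cast_zero, add_zero] at h2
    exact h1.mul h2
  have hgb : ∃ K, 0 ≤ K ∧ ∀ t, ‖g t‖ ≤ K * min 1 (Real.exp (2 * Real.pi * ε * t)) := by
    obtain ⟨M, hM, hMb⟩ := halfPlaneBound_hypGamma hmu hadm0 (c := c) (by simpa using hck)
      (one_ne_zero (α := ℂ))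
    obtain ⟨d, hd, hd'⟩ := exp_sub_one_bound_vertical hε hci hc0
    choose K hK0 hK using fun m => norm_ker_le ε m hd
    refine ⟨∑ m ∈ Finset.range 4, ‖D m‖ * (M * (‖(1 : ℂ)‖ / mu) ^ c * K m),
      Finset.sum_nonneg fun m _ => by have := hK0 m; positivity, fun t => ?_⟩
    rw [Finset.sum_mul]
    refine (norm_sum_le _ _).trans (Finset.sum_le_sum fun m _ => ?_)
    have h1 := hMb.bound (vline c t) (by simp)
    have h2 := hK m (vline c t) (hd' _ (by simp))
    simp only [vline_re, vline_im, Complex.one_cpow, mul_one, Complex.arg_one, zero_mul, neg_zero,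
      Real.exp_zero] at h1 h2
    rw [norm_mul, norm_mul, mul_assoc, mul_assoc]
    refine mul_le_mul_of_nonneg_left ?_ (norm_nonneg _)
    exact mul_le_mul h1 h2 (norm_nonneg _) (by positivity)
  obtain ⟨K, hK0, hK⟩ := hgb
  have hpi := Real.pi_pos
  refine ⟨fun z => A * (-(2 * Real.pi : ℂ)⁻¹ * ∫ t, g t * z ^ vline c t),
    ((differentiableOn_integral_cpow hε (continuous_finsetSum _ fun m _ =>
      continuous_const.mul (hgc m)) hK0 hK).const_mul _).const_mul _, fun z hz hzmu => ?_,
    fun z hz hzmu => ?_⟩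
  · dsimp only
    congr 1
    have hz0 : z ≠ 0 := fun h0 => by simp [h0] at hz
    obtain ⟨h1, h2⟩ := arg_bounds hε hz
    obtain ⟨M, hM, hMb⟩ := halfPlaneBound_hypGamma hmu hadm0 (c := c) (by simpa using hck) hz0
    have hint := fun m => integrable_mul_ker hε hci hc0 hM
      (div_pos (norm_pos_iff.2 hz0) hmu) h1 (by linarith) hMb m 0
    rw [show c + ((0 : ℕ) : ℝ) = c by simp] at hint
    have e1 : ∀ t, g t * z ^ vline c t = ∑ m ∈ Finset.range 4, D m *
        (hypGamma (fun k => 0 + b k) (fun k => 1 + 0 + (0 : Fin 4 → ℝ) k) mu (vline c t) *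
          z ^ vline c t * ker (wt ε) m (vline c t)) := by
      intro t
      rw [hg, Finset.sum_mul]
      refine Finset.sum_congr rfl fun m _ => ?_
      rw [hG, frobGamma]
      ring
    simp only [e1]
    rw [integral_finsetSum _ fun m _ => (hint m).const_mul _, Finset.mul_sum]
    refine Finset.sum_congr rfl fun m hm => ?_
    rw [integral_const_mul, mul_left_comm]
    congr 1
    exact lineInt_hypGamma hε hmu hadm0 hci hc0 (by simpa using hck) hz hzmu (Finset.mem_range.1 hm)
  · dsimp only
    have hε' : -ε = 1 ∨ -ε = -1 := by rcases hε with rfl | rfl <;> simp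
    have hzim : z.im ≠ 0 := fun h0 => by simp [h0] at hz
    have hz0 : z ≠ 0 := fun h0 => by simp [h0] at hz
    have hr : 0 < lam / mu := div_pos hlam hmu
    set x := (lam : ℂ) / z with hx
    -- Inversion exchanges the half-planes, hence the sign `-ε` in the kernels at infinity.
    have hxim : 0 < -ε * x.im := by
      have h1 : x.im = -(lam * z.im / Complex.normSq z) := by
        rw [hx, div_eq_mul_inv, Complex.im_ofReal_mul, Complex.inv_im]
        ring
      rw [h1, show -ε * -(lam * z.im / Complex.normSq z) = lam * (ε * z.im) / Complex.normSq z by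
        ring]
      exact div_pos (mul_pos hlam hz) (Complex.normSq_pos.2 hz0)
    have hxr : ‖x‖ < lam / mu := by
      rw [hx, norm_div, Complex.norm_real, Real.norm_of_nonneg hlam.le]
      exact div_lt_div_of_pos_left hlam hmu hzmu
    have hx0 : x ≠ 0 := fun h0 => by simp [h0] at hxim
    have hci' : -1 < -b i - c := by linarith [hb1 i]
    have hc0' : -b i - c < 0 := by linarith [hck i]
    have hck' : ∀ k, 0 < b i + (0 : Fin 4 → ℝ) k + (-b i - c) := fun k => by
      simp only [Pi.zero_apply]
      linarith
    obtain ⟨h1, h2⟩ := arg_bounds hε' hxim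
    obtain ⟨M, hM, hMb⟩ := halfPlaneBound_hypGamma hr hadm1 hck' hx0
    have hint := fun m => integrable_mul_ker hε' hci' hc0' hM
      (div_pos (norm_pos_iff.2 hx0) hr) h1 (by linarith) hMb m 0
    rw [show -b i - c + ((0 : ℕ) : ℝ) = -b i - c by simp] at hint
    rw [logSeries_eq_cpow_mul, ← sum_convolution_eq hγ
      (fun n => logSeries 0 (frobSeries (fun k => -b k) 0 (lam / mu) (b i)) n x) N]
    have e2 : ∀ j ∈ Finset.range (N + 1), γ j * ∑ l ∈ Finset.range (N - j + 1),
        coeff l (jet (frobGamma (fun k => -b k) 0 (lam / mu) (b i))) *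
          logSeries 0 (frobSeries (fun k => -b k) 0 (lam / mu) (b i)) (N - j - l) x =
        -(2 * Real.pi : ℂ)⁻¹ * ∫ t, γ j *
          (hypGamma (fun k => b i + (0 : Fin 4 → ℝ) k) (fun k => 1 + b i + -b k) (lam / mu)
            (vline (-b i - c) t) * x ^ vline (-b i - c) t *
              ker (wt (-ε)) (N - j) (vline (-b i - c) t)) := by
      intro j hj
      rw [integral_const_mul, mul_left_comm]
      congr 1
      exact (lineInt_hypGamma hε' hr hadm1 hci' hc0' hck' hxim hxr (by omega)).symm
    rw [Finset.sum_congr rfl e2, ← Finset.mul_sum,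
      ← integral_finsetSum _ fun j _ => (hint (N - j)).const_mul _, mul_left_comm A,
      mul_left_comm (x ^ (b i : ℂ))]
    congr 1
    rw [← integral_const_mul, ← integral_const_mul]
    -- The change `t ↦ -t` matches the point `s` of the first line with `-b_i - s` on the second.
    refine Eq.trans ?_ (integral_neg_eq_self _ volume)
    refine integral_congr_ae (ae_of_all _ fun t => ?_)
    dsimp only
    rw [vline_neg]
    set s := vline c t with hs
    have hu : Complex.exp (wt ε * s) ≠ 1 := fun h => by
      obtain ⟨n, hn⟩ := (exp_wt_mul_eq_one_iff hε).1 h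
      exact hn1 t n hn
    have hbu : Complex.exp (wt ε * b i) * Complex.exp (wt ε * s) ≠ 1 := fun h => by
      rw [← Complex.exp_add, ← mul_add] at h
      obtain ⟨n, hn⟩ := (exp_wt_mul_eq_one_iff hε).1 h
      exact hn2 t i n hn
    have hk := hker _ hu hbu
    -- The two sign changes compensate: `wt (-ε) * (-b_i - s) = wt ε * (b_i + s)`.
    have hkerx : ∀ j, ker (wt (-ε)) j (-b i - s) =
        kerPoly (wt (-ε)) j ((Complex.exp (wt ε * b i) * Complex.exp (wt ε * s) - 1)⁻¹) := by
      intro j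
      rw [ker, kerE, ← Complex.exp_add]
      congr 4
      simp only [wt]
      push_cast
      ring
    have hxp : x ^ (b i : ℂ) * x ^ (-(b i : ℂ) - s) * Complex.exp (s * Real.log lam) = z ^ s := by
      rw [← Complex.cpow_add _ _ hx0, show (b i : ℂ) + (-(b i : ℂ) - s) = -s by ring, hx,
        cpow_ofReal_div hlam hzim, neg_neg, mul_right_comm, ← Complex.exp_add]
      simp
    have hu1 : Complex.exp (wt ε * s) - 1 ≠ 0 := sub_ne_zero.2 hu
    have hGr := frobGamma_neg_sub hε hb hmu hlam (b i) (hn1 t) (hn2 t)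
    rw [frobGamma] at hGr
    simp only [hkerx]
    rw [hGr, ← hxp, hg]
    simp only [ker, kerE] at hk ⊢
    rw [← hs, ← hG, ← hA]
    generalize x ^ (b i : ℂ) = y1 at *
    generalize x ^ (-(b i : ℂ) - s) = y2 at *
    generalize Complex.exp (s * Real.log lam) = y3 at *
    have e3 : ∑ m ∈ Finset.range 4, D m * (G s * kerPoly (wt ε) m ((Complex.exp (wt ε * s) - 1)⁻¹)) =
        G s * ∑ m ∈ Finset.range 4, D m * kerPoly (wt ε) m ((Complex.exp (wt ε * s) - 1)⁻¹) := by
      rw [Finset.mul_sum]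
      exact Finset.sum_congr rfl fun m _ => by ring
    have e4 : ∀ B : ℂ, ∑ j ∈ Finset.range (N + 1), γ j * (B * y2 * kerPoly (wt (-ε)) (N - j)
        ((Complex.exp (wt ε * b i) * Complex.exp (wt ε * s) - 1)⁻¹)) =
        B * y2 * ∑ j ∈ Finset.range (N + 1), γ j * kerPoly (wt (-ε)) (N - j)
          ((Complex.exp (wt ε * b i) * Complex.exp (wt ε * s) - 1)⁻¹) := by
      intro B
      rw [Finset.mul_sum]
      exact Finset.sum_congr rfl fun m _ => by ring
    rw [e3, e4]
    generalize (∑ m ∈ Finset.range 4, D m * kerPoly (wt ε) m ((Complex.exp (wt ε * s) - 1)⁻¹)) = S1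
      at *
    generalize (∑ j ∈ Finset.range (N + 1), γ j * kerPoly (wt (-ε)) (N - j)
      ((Complex.exp (wt ε * b i) * Complex.exp (wt ε * s) - 1)⁻¹)) = S2 at *
    generalize (∏ k, (Complex.exp (wt ε * b k) * Complex.exp (wt ε * s) - 1)) = P at *
    field_simp
    linear_combination -(A * G s * y1 * y2 * y3) * hk

end CYPeriods

/-! ### Linear independence at infinity and the transition matrix. -/

namespace CYPeriods

open Filter Topology Matrix

lemma tendsto_exp_mul_pow {d : ℝ} (hd : 0 < d) (k : ℕ) (c : ℂ) :
    Tendsto (fun y : ℝ => Complex.exp (d * (-(y : ℂ) - c)) * (-(y : ℂ) - c) ^ k) atTop (𝓝 0) := by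
  have h1 : Tendsto (fun y : ℝ => Real.exp (-(d * c.re)) * 2 ^ k * (y ^ k / Real.exp (d * y)))
      atTop (𝓝 0) := by
    simpa using ((isLittleO_pow_exp_pos_mul_atTop k hd).tendsto_div_nhds_zero).const_mul
      (Real.exp (-(d * c.re)) * 2 ^ k)
  refine squeeze_zero_norm' ?_ h1
  filter_upwards [eventually_ge_atTop ‖c‖, eventually_ge_atTop 0] with y hy hy0
  have h2 : ‖-(y : ℂ) - c‖ ≤ 2 * y := by
    refine (norm_sub_le _ _).trans ?_
    rw [norm_neg, Complex.norm_real, Real.norm_of_nonneg hy0]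
    linarith
  have h3 : ((d : ℂ) * (-(y : ℂ) - c)).re = -(d * c.re) + -(d * y) := by simp; ring
  rw [norm_mul, norm_pow, Complex.norm_exp, h3, Real.exp_add, Real.exp_neg (d * y)]
  calc _ ≤ Real.exp (-(d * c.re)) * (Real.exp (d * y))⁻¹ * (2 * y) ^ k := by gcongr
    _ = _ := by rw [mul_pow]; ring

lemma tendsto_inv_neg_sub (c : ℂ) :
    Tendsto (fun y : ℝ => (-(y : ℂ) - c)⁻¹) atTop (𝓝 0) := by
  refine tendsto_inv₀_cobounded.comp ?_
  rw [← tendsto_norm_atTop_iff_cobounded]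
  refine tendsto_atTop_mono (fun y => ?_) (tendsto_atTop_add_const_right atTop (-‖c‖) tendsto_id)
  have h := norm_sub_norm_le (-(y : ℂ)) c
  rw [norm_neg, Complex.norm_real] at h
  have := le_abs_self y
  simp only [id_eq, Real.norm_eq_abs] at h ⊢
  linarith

/-- Frobenius bases at infinity are linearly independent on a half plane. -/
theorem IsBasisAtInfinity.linearIndependent {M : Model} {lam ε : ℝ} {n : Fin 4 → ℕ}
    {B : Fin 4 → ℂ → ℂ} (hε : ε = 1 ∨ ε = -1) (hmu : 0 < M.mu) (hlam : 0 < lam)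
    (hB : IsBasisAtInfinity M lam n B) (hinj : ∀ i j, M.a i = M.a j → n i = n j → i = j)
    {v : Fin 4 → ℂ} (hv : ∀ z : ℂ, 0 < ε * z.im → M.mu < ‖z‖ → ∑ i, v i * B i z = 0) : v = 0 := by
  obtain ⟨g, hg1, hg2, hg3, hg4⟩ := hB
  by_contra hne
  obtain ⟨i₀, hi₀⟩ := Function.ne_iff.1 hne
  -- The dominant member as `x → 0` has the smallest exponent and, among those, the highest power of
  -- the logarithm; hence the sign in the second component.
  obtain ⟨i, hi, hmin⟩ := Finset.exists_min_image (Finset.univ.filter fun i => v i ≠ 0)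
    (fun i => toLex (M.a i, -(n i : ℤ))) ⟨i₀, by simpa using hi₀⟩
  simp only [Finset.mem_filter_univ] at hi hmin
  -- The point `x = e^{l(y)}` runs down the imaginary half-axis for which `ε Im z > 0`, and its
  -- principal logarithm is `l(y)`.
  set c : ℂ := ε * (Real.pi / 2) * Complex.I with hc
  set l : ℝ → ℂ := fun y => -(y : ℂ) - c with hl
  have hcim : c.im = ε * (Real.pi / 2) := by simp [hc]
  have hpi := Real.pi_pos
  have hlog : ∀ y, Complex.log (Complex.exp (l y)) = l y := fun y => by
    have h1 : (l y).im = -(ε * (Real.pi / 2)) := by simp [hl, hcim]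
    refine Complex.log_exp ?_ ?_ <;> rw [h1] <;> rcases hε with rfl | rfl <;> linarith
  have hexp : ∀ y : ℝ, Complex.exp (l y) = Real.exp (-y) * (-ε * Complex.I) := fun y => by
    rw [show l y = -(y : ℂ) + -c from sub_eq_add_neg _ _, Complex.exp_add]
    push_cast
    congr 1
    rcases hε with rfl | rfl
    · rw [hc, show -(((1 : ℝ) : ℂ) * (Real.pi / 2) * Complex.I) = -(Real.pi / 2 * Complex.I) by
        push_cast; ring, Complex.exp_neg, Complex.exp_pi_div_two_mul_I]
      simp
    · rw [hc, show -(((-1 : ℝ) : ℂ) * (Real.pi / 2) * Complex.I) = Real.pi / 2 * Complex.I by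
        push_cast; ring, Complex.exp_pi_div_two_mul_I]
      simp
  set z : ℝ → ℂ := fun y => lam / Complex.exp (l y) with hz
  have hlam0 : (lam : ℂ) ≠ 0 := by exact_mod_cast hlam.ne'
  have hx : ∀ y, (lam : ℂ) / z y = Complex.exp (l y) := fun y => by
    rw [hz]
    field_simp
  have hze : ∀ y, z y = ((lam * Real.exp y * ε : ℝ) : ℂ) * Complex.I := fun y => by
    rw [hz]
    dsimp only
    rw [hexp, div_eq_iff (by rw [← hexp]; exact Complex.exp_ne_zero _)]
    have h1 : (Real.exp y : ℂ) * Real.exp (-y) = 1 := by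
      rw [← Complex.ofReal_mul, ← Real.exp_add]
      simp
    have h2 : (ε : ℂ) * ε = 1 := by rcases hε with rfl | rfl <;> simp
    push_cast at h1 ⊢
    linear_combination (-(lam : ℂ) * ε * ε * h1 - lam * h2) + (lam * Complex.exp y *
      Complex.exp (-y) * ε * ε) * Complex.I_sq
  have hzim : ∀ y, 0 < ε * (z y).im := fun y => by
    rw [hze, Complex.im_ofReal_mul, Complex.I_im]
    have := Real.exp_pos y
    rcases hε with rfl | rfl <;> nlinarith [mul_pos hlam this]
  have hznorm : ∀ᶠ y in atTop, M.mu < ‖z y‖ := by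
    have h1 : ∀ y, ‖z y‖ = lam * Real.exp y := fun y => by
      rw [hze, norm_mul, Complex.norm_I, Complex.norm_real, norm_mul, Real.norm_of_nonneg
        (by positivity)]
      rcases hε with rfl | rfl <;> simp
    simp only [h1]
    exact (Real.tendsto_exp_atTop.const_mul_atTop hlam).eventually_gt_atTop _
  have hx0 : Tendsto (fun y => Complex.exp (l y)) atTop (𝓝 0) := by
    simpa using tendsto_exp_mul_pow one_pos 0 c
  have hl0 : Tendsto (fun y => (l y)⁻¹) atTop (𝓝 0) := tendsto_inv_neg_sub c
  have hlne : ∀ y, l y ≠ 0 := fun y h => by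
    have h1 : (l y).im = 0 := by rw [h]; rfl
    have h2 : (l y).im = -(ε * (Real.pi / 2)) := by simp [hl, hcim]
    rw [h1] at h2
    rcases hε with rfl | rfl <;> linarith
  have hr : 0 < lam / M.mu := div_pos hlam hmu
  -- What is left of the member `j` after `x ^ a_j (log x) ^ n_j` is split off; it tends to `1 /
  -- n_j!`.
  set h : Fin 4 → ℝ → ℂ := fun j y => ∑ m ∈ Finset.range (n j + 1),
    g (M.a j) m (Complex.exp (l y)) * (l y)⁻¹ ^ m / ((n j - m).factorial : ℂ) with hh
  have hlim : ∀ j, Tendsto (h j) atTop (𝓝 (1 / (n j).factorial)) := by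
    intro j
    have h1 : ∀ m ∈ Finset.range (n j + 1), Tendsto (fun y => g (M.a j) m (Complex.exp (l y)) *
        (l y)⁻¹ ^ m / ((n j - m).factorial : ℂ)) atTop
        (𝓝 (g (M.a j) m 0 * 0 ^ m / ((n j - m).factorial : ℂ))) := fun m _ =>
      ((((hg1 _ m).continuousOn.continuousAt (Metric.ball_mem_nhds 0 hr)).tendsto.comp hx0).mul
        (hl0.pow m)).div_const _
    refine (tendsto_finsetSum _ h1).congr' .rfl |>.trans (le_of_eq ?_)
    rw [Finset.sum_range_succ', Finset.sum_eq_zero fun m _ => by simp]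
    simp [hg2]
  have hBh : ∀ᶠ y in atTop, ∀ j, B j (z y) =
      Complex.exp (M.a j * l y) * l y ^ n j * h j y := by
    filter_upwards [hznorm] with y hy j
    have hmem : z y ∈ {z | z ∈ Complex.slitPlane ∧ M.mu < ‖z‖} :=
      ⟨Or.inr fun h0 => by have := hzim y; simp [h0] at this, hy⟩
    rw [(hg4 j).2 _ hmem]
    beta_reduce
    rw [logSeries, hx, hlog, Complex.cpow_def_of_ne_zero (Complex.exp_ne_zero _),
      hlog, mul_comm (l y), mul_assoc, hh]
    congr 1
    dsimp only
    rw [Finset.mul_sum]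
    refine Finset.sum_congr rfl fun m hm => ?_
    have h2 : l y ^ n j * (l y)⁻¹ ^ m = l y ^ (n j - m) := by
      rw [inv_pow, ← pow_sub₀ _ (hlne y) (by
        have := Finset.mem_range.1 hm; omega)]
    rw [← h2]
    ring
  have hterm : ∀ j, j ≠ i → Tendsto (fun y => v j * (Complex.exp (((M.a j - M.a i : ℝ) : ℂ) * l y) *
      (l y ^ n j * (l y)⁻¹ ^ n i) * h j y)) atTop (𝓝 0) := by
    intro j hji
    by_cases hvj : v j = 0
    · simp [hvj]
    have h1 := hmin j hvj
    rw [Prod.Lex.le_iff] at h1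
    simp only [ofLex_toLex] at h1
    have h2 : Tendsto (fun y => Complex.exp (((M.a j - M.a i : ℝ) : ℂ) * l y) *
        (l y ^ n j * (l y)⁻¹ ^ n i)) atTop (𝓝 0) := by
      rcases h1 with h1 | ⟨h1, h2⟩
      · have h3 := (tendsto_exp_mul_pow (sub_pos.2 h1) (n j) c).mul (hl0.pow (n i))
        rw [zero_mul] at h3
        exact h3.congr fun y => by simp only [hl]; ring
      · have h3 : n j < n i := lt_of_le_of_ne (by omega) fun h4 => hji (hinj j i h1.symm h4)
        have h4 := hl0.pow (n i - n j)
        rw [zero_pow (by omega)] at h4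
        refine h4.congr fun y => ?_
        rw [← h1, sub_self, Complex.ofReal_zero, zero_mul, Complex.exp_zero, one_mul]
        obtain ⟨k, hk⟩ := Nat.exists_eq_add_of_lt h3
        rw [show n i - n j = k + 1 by omega, show n i = n j + (k + 1) by omega, pow_add _ (n j),
          ← mul_assoc, ← mul_pow, mul_inv_cancel₀ (hlne y), one_pow, one_mul]
    simpa using (h2.mul (hlim j)).const_mul (v j)
  have hsum := tendsto_finsetSum Finset.univ (f := fun j y => v j *
      (Complex.exp (((M.a j - M.a i : ℝ) : ℂ) * l y) * (l y ^ n j * (l y)⁻¹ ^ n i) * h j y))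
    (a := fun j => if j = i then v i * (1 / (n i).factorial) else 0) (x := atTop) fun j _ => by
      by_cases hji : j = i
      · subst hji
        simp only [sub_self, Complex.ofReal_zero, zero_mul, Complex.exp_zero, one_mul, if_true]
        refine ((hlim j).const_mul _).congr fun y => ?_
        rw [← mul_pow, mul_inv_cancel₀ (hlne y), one_pow, one_mul]
      · rw [if_neg hji]
        exact hterm j hji
  rw [Finset.sum_ite_eq' Finset.univ i, if_pos (Finset.mem_univ i)] at hsum
  have hzero : Tendsto (fun _ : ℝ => (0 : ℂ)) atTop (𝓝 (v i * (1 / (n i).factorial))) := by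
    refine hsum.congr' ?_
    filter_upwards [hBh, hznorm] with y hy hy'
    have h1 := hv (z y) (hzim y) hy'
    have h2 : ∑ j, v j * (Complex.exp (((M.a j - M.a i : ℝ) : ℂ) * l y) *
        (l y ^ n j * (l y)⁻¹ ^ n i) * h j y) =
        (Complex.exp (-(M.a i * l y)) * (l y)⁻¹ ^ n i) * ∑ j, v j * B j (z y) := by
      rw [Finset.mul_sum]
      refine Finset.sum_congr rfl fun j _ => ?_
      rw [hy j, show ((M.a j - M.a i : ℝ) : ℂ) * l y = M.a j * l y + -(M.a i * l y) by
        push_cast; ring, Complex.exp_add]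
      ring
    rw [h2, h1, mul_zero]
  have := tendsto_nhds_unique tendsto_const_nhds hzero
  have hf : ((n i).factorial : ℂ) ≠ 0 := by exact_mod_cast (n i).factorial_ne_zero
  exact hi (by simpa [hf] using this.symm)

lemma eqOn_zero_of_halfPlane {ε r : ℝ} (hε : ε = 1 ∨ ε = -1) (hr : 0 < r) {f : ℂ → ℂ}
    (hf : DifferentiableOn ℂ f {z | 0 < ε * z.im}) (h0 : ∀ z, 0 < ε * z.im → ‖z‖ < r → f z = 0) :
    ∀ z, 0 < ε * z.im → f z = 0 := by
  have hopen : IsOpen {z : ℂ | 0 < ε * z.im} :=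
    isOpen_lt continuous_const (continuous_const.mul Complex.continuous_im)
  have hconv : Convex ℝ {z : ℂ | 0 < ε * z.im} := by
    intro x hx y hy a b ha hb hab
    have hx' : 0 < ε * x.im := hx
    have hy' : 0 < ε * y.im := hy
    simp only [Set.mem_ofPred_eq, Complex.add_im, Complex.smul_im, smul_eq_mul]
    rw [show ε * (a * x.im + b * y.im) = a * (ε * x.im) + b * (ε * y.im) by ring]
    rcases ha.eq_or_lt with rfl | ha
    · rw [zero_add] at hab
      simpa [hab] using hy'
    · exact add_pos_of_pos_of_nonneg (mul_pos ha hx') (mul_nonneg hb hy'.le)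
  set z₀ : ℂ := (r / 2 * ε : ℝ) * Complex.I with hz₀
  have hz₀im : 0 < ε * z₀.im := by
    rw [hz₀, Complex.im_ofReal_mul, Complex.I_im]
    rcases hε with rfl | rfl <;> linarith
  have hz₀n : ‖z₀‖ < r := by
    rw [hz₀, norm_mul, Complex.norm_I, Complex.norm_real, norm_mul, Real.norm_of_nonneg
      (by positivity)]
    rcases hε with rfl | rfl <;> simp <;> linarith
  refine (hf.analyticOnNhd hopen).eqOn_zero_of_preconnected_of_eventuallyEq_zero
    hconv.isPreconnected hz₀im ?_
  filter_upwards [hopen.mem_nhds hz₀im, (isOpen_lt continuous_norm continuous_const).mem_nhds hz₀n]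
    with z hz1 hz2
  exact h0 z hz1 hz2

/-- If the members of a basis at infinity continue to the combinations `S (periodMatrix M) B₀` of
the basis at zero then `S` is the inverse of the transition matrix. -/
theorem hasInverseTransitionMatrix {M : Model} {ε : ℝ} (hε : ε = 1 ∨ ε = -1) (hmu : 0 < M.mu)
    {B₀ B F : Fin 4 → ℂ → ℂ} {S : Matrix (Fin 4) (Fin 4) ℂ}
    (hF : ∀ i, DifferentiableOn ℂ (F i) {z | 0 < ε * z.im})
    (hF0 : ∀ i z, 0 < ε * z.im → ‖z‖ < M.mu →
      F i z = ((S * periodMatrix M) *ᵥ fun i => B₀ i z) i)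
    (hF1 : ∀ i z, 0 < ε * z.im → M.mu < ‖z‖ → F i z = B i z)
    (hB : ∀ v : Fin 4 → ℂ, (∀ z : ℂ, 0 < ε * z.im → M.mu < ‖z‖ → ∑ i, v i * B i z = 0) → v = 0) :
    HasInverseTransitionMatrix M {z | 0 < ε * z.im} B₀ B S := by
  have hcomb : ∀ v : Fin 4 → ℂ, DifferentiableOn ℂ (fun z => ∑ j, v j * F j z)
      {z | 0 < ε * z.im} := fun v => DifferentiableOn.fun_sum fun j _ => (hF j).const_mul (v j)
  have hS : IsUnit S.det := by
    rw [isUnit_iff_ne_zero]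
    intro h
    -- A left null vector of `S` would annihilate the continuations near `0`, hence on the whole
    -- half-plane, against the independence of `B`.
    obtain ⟨v, hv, hvS⟩ := Matrix.exists_vecMul_eq_zero_iff.2 h
    refine hv (hB v fun z hz hz' => ?_)
    have h1 := eqOn_zero_of_halfPlane hε hmu (hcomb v) (fun z hz hz' => ?_) z hz
    · rw [← h1]
      exact Finset.sum_congr rfl fun i _ => by rw [hF1 i z hz hz']
    · have h2 : ∑ j, v j * F j z = v ⬝ᵥ ((S * periodMatrix M) *ᵥ fun i => B₀ i z) :=
        Finset.sum_congr rfl fun i _ => by rw [hF0 i z hz hz']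
      rw [h2, ← Matrix.mulVec_mulVec, Matrix.dotProduct_mulVec, hvS, zero_dotProduct]
  have hvec : ∀ z, 0 < ε * z.im → M.mu < ‖z‖ → (fun i => F i z) = fun i => B i z :=
    fun z hz hz' => funext fun i => hF1 i z hz hz'
  have hT : IsTransitionMatrix M {z | 0 < ε * z.im} B₀ B S⁻¹ := by
    refine ⟨fun i z => (S⁻¹ *ᵥ fun i => F i z) i, fun i => hcomb (S⁻¹ i), fun z hz hz' => ?_,
      fun z hz hz' => ?_⟩
    · have h1 : (fun i => F i z) = (S * periodMatrix M) *ᵥ fun i => B₀ i z :=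
        funext fun i => hF0 i z hz hz'
      change S⁻¹ *ᵥ (fun i => F i z) = _
      rw [h1, Matrix.mulVec_mulVec, ← Matrix.mul_assoc, Matrix.nonsing_inv_mul _ hS, Matrix.one_mul]
    · change S⁻¹ *ᵥ (fun i => F i z) = _
      rw [hvec z hz hz']
  refine ⟨S⁻¹, hT, fun T' hT' => ?_, (Matrix.isUnit_nonsing_inv_iff).2
    ((Matrix.isUnit_iff_isUnit_det S).2 hS), Matrix.nonsing_inv_nonsing_inv S hS⟩
  obtain ⟨P, hP, hP0, hP1⟩ := hT
  obtain ⟨P', hP', hP0', hP1'⟩ := hT'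
  -- Two continuations of the same periods coincide, so rows of two transition matrices differ by a
  -- linear relation within `B`.
  have hrow : ∀ i, T' i - S⁻¹ i = 0 := by
    intro i
    refine hB _ fun z hz hz' => ?_
    have h1 := eqOn_zero_of_halfPlane hε hmu ((hP' i).sub (hP i)) (fun z hz hz' => by
      have h2 := congrFun ((hP0' z hz hz').trans (hP0 z hz hz').symm) i
      simpa [sub_eq_zero] using h2) z hz
    have h3 := congrFun (hP1 z hz hz') i
    have h4 := congrFun (hP1' z hz hz') i
    simp only [Pi.sub_apply] at h1 ⊢
    rw [h3, h4] at h1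
    simp only [sub_mul, Finset.sum_sub_distrib]
    exact h1
  ext i j
  exact sub_eq_zero.1 (congrFun (hrow i) j)

end CYPeriods

/-! ### Third-order expansions of logarithms at the origin. -/

namespace CYPeriods

open Filter Topology PowerSeries Asymptotics

/-- Near `0` the function `f` equals `C exp (c₁ s + c₂ s² + c₃ s³ + O(s⁴))`. -/
def LogJet (f : ℂ → ℂ) (C c₁ c₂ c₃ : ℂ) : Prop :=
  ∃ h : ℂ → ℂ, h =O[𝓝 0] (fun s => s ^ 4) ∧
    ∀ᶠ s in 𝓝 0, f s = C * Complex.exp (c₁ * s + c₂ * s ^ 2 + c₃ * s ^ 3 + h s)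

lemma apply_zero_of_isBigO {h : ℂ → ℂ} (hh : h =O[𝓝 0] (fun s => s ^ 4)) : h 0 = 0 := by
  obtain ⟨c, hc⟩ := hh.bound
  simpa using hc.self_of_nhds

section

variable {f g : ℂ → ℂ} {C c₁ c₂ c₃ D d₁ d₂ d₃ : ℂ}

lemma LogJet.mul (hf : LogJet f C c₁ c₂ c₃) (hg : LogJet g D d₁ d₂ d₃) :
    LogJet (fun s => f s * g s) (C * D) (c₁ + d₁) (c₂ + d₂) (c₃ + d₃) := by
  obtain ⟨h, hh, hf⟩ := hf
  obtain ⟨k, hk, hg⟩ := hg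
  refine ⟨fun s => h s + k s, hh.add hk, ?_⟩
  filter_upwards [hf, hg] with s h1 h2
  rw [h1, h2, mul_mul_mul_comm, ← Complex.exp_add]
  ring_nf

lemma LogJet.inv (hf : LogJet f C c₁ c₂ c₃) :
    LogJet (fun s => (f s)⁻¹) C⁻¹ (-c₁) (-c₂) (-c₃) := by
  obtain ⟨h, hh, hf⟩ := hf
  refine ⟨fun s => -h s, hh.neg_left, ?_⟩
  filter_upwards [hf] with s h1
  rw [h1, mul_inv, ← Complex.exp_neg]
  ring_nf

lemma LogJet.congr (hf : LogJet f C c₁ c₂ c₃) (hfg : f =ᶠ[𝓝 0] g) (h0 : C = D) (h1 : c₁ = d₁)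
    (h2 : c₂ = d₂) (h3 : c₃ = d₃) : LogJet g D d₁ d₂ d₃ := by
  subst h0 h1 h2 h3
  obtain ⟨h, hh, hf⟩ := hf
  exact ⟨h, hh, by filter_upwards [hf, hfg] with s h1 h2 using h2 ▸ h1⟩

lemma logJet_exp (c : ℂ) : LogJet (fun s => Complex.exp (c * s)) 1 c 0 0 :=
  ⟨fun _ => 0, isBigO_zero _ _, Eventually.of_forall fun s => by simp⟩

lemma logJet_const (c : ℂ) : LogJet (fun _ => c) c 0 0 0 :=
  ⟨fun _ => 0, isBigO_zero _ _, Eventually.of_forall fun s => by simp⟩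

lemma LogJet.pow (hf : LogJet f C c₁ c₂ c₃) (n : ℕ) :
    LogJet (fun s => f s ^ n) (C ^ n) (n * c₁) (n * c₂) (n * c₃) := by
  induction n with
  | zero => simpa using logJet_const 1
  | succ n ih =>
    exact (ih.mul hf).congr (Eventually.of_forall fun s => (pow_succ _ _).symm)
      (pow_succ _ _).symm (by push_cast; ring) (by push_cast; ring) (by push_cast; ring)

lemma LogJet.comp_mul (hf : LogJet f C c₁ c₂ c₃) (m : ℂ) :
    LogJet (fun s => f (m * s)) C (m * c₁) (m ^ 2 * c₂) (m ^ 3 * c₃) := by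
  obtain ⟨h, hh, hf⟩ := hf
  have ht : Tendsto (fun s : ℂ => m * s) (𝓝 0) (𝓝 0) := by
    simpa using (continuous_const_mul m).tendsto 0
  refine ⟨fun s => h (m * s), (hh.comp_tendsto ht).trans ?_, ?_⟩
  · simp only [Function.comp_def, mul_pow]
    exact isBigO_const_mul_self _ _ _
  · filter_upwards [ht.eventually hf] with s h1
    rw [h1]
    ring_nf

lemma LogJet.apply_zero (hf : LogJet f C c₁ c₂ c₃) : f 0 = C := by
  obtain ⟨h, hh, hf⟩ := hf
  have h0 : h 0 = 0 := apply_zero_of_isBigO hh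
  simpa [h0] using hf.self_of_nhds

/-- The Taylor coefficients of order at most three. -/
lemma LogJet.coeff_jet (hf : LogJet f C c₁ c₂ c₃) (ha : AnalyticAt ℂ f 0) {c : ℕ → ℂ}
    (h0 : c 0 = C) (h1 : c 1 = C * c₁) (h2 : c 2 = C * (c₂ + c₁ ^ 2 / 2))
    (h3 : c 3 = C * (c₃ + c₁ * c₂ + c₁ ^ 3 / 6)) {i : ℕ} (hi : i < 4) : coeff i (jet f) = c i := by
  obtain ⟨h, hh, hf⟩ := hf
  set q : ℂ → ℂ := fun s => c₁ * s + c₂ * s ^ 2 + c₃ * s ^ 3 with hq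
  set F : ℂ → ℂ := fun s => Complex.exp (q s) with hF
  have hqd : ∀ s, HasDerivAt q (c₁ + 2 * c₂ * s + 3 * c₃ * s ^ 2) s := fun s => by
    have := (((hasDerivAt_id s).const_mul c₁).add ((hasDerivAt_pow 2 s).const_mul c₂)).add
      ((hasDerivAt_pow 3 s).const_mul c₃)
    refine this.congr_deriv ?_
    push_cast
    ring
  have hF0 : F 0 = 1 := by simp [hF, hq]
  have hFd : ∀ s, HasDerivAt F (F s * (c₁ + 2 * c₂ * s + 3 * c₃ * s ^ 2)) s := fun s =>
    (hqd s).cexp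
  have e1 : deriv F = fun s => F s * (c₁ + 2 * c₂ * s + 3 * c₃ * s ^ 2) :=
    funext fun s => (hFd s).deriv
  have hp : ∀ s, HasDerivAt (fun s : ℂ => c₁ + 2 * c₂ * s + 3 * c₃ * s ^ 2)
      (2 * c₂ + 6 * c₃ * s) s := fun s => by
    have := (((hasDerivAt_id s).const_mul (2 * c₂)).const_add c₁).add
      ((hasDerivAt_pow 2 s).const_mul (3 * c₃))
    refine this.congr_deriv ?_
    push_cast
    ring
  have e2 : deriv (deriv F) = fun s => F s *
      ((c₁ + 2 * c₂ * s + 3 * c₃ * s ^ 2) ^ 2 + (2 * c₂ + 6 * c₃ * s)) := by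
    rw [e1]
    funext s
    refine ((hFd s).mul (hp s)).deriv.trans ?_
    ring
  have e3 : deriv (deriv (deriv F)) 0 = c₁ ^ 3 + 6 * c₁ * c₂ + 6 * c₃ := by
    rw [e2]
    have hp2 : HasDerivAt (fun s : ℂ => (c₁ + 2 * c₂ * s + 3 * c₃ * s ^ 2) ^ 2 +
      (2 * c₂ + 6 * c₃ * s)) (4 * c₁ * c₂ + 6 * c₃) 0 := by
      have := ((hp 0).pow 2).add (((hasDerivAt_id (0 : ℂ)).const_mul (6 * c₃)).const_add (2 * c₂))
      refine this.congr_deriv ?_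
      push_cast
      ring
    refine ((hFd 0).mul hp2).deriv.trans ?_
    simp only [hF, hq]
    simp
    ring
  have hFa : AnalyticAt ℂ F 0 := by
    have : Differentiable ℂ F := fun s => (hFd s).differentiableAt
    exact this.analyticAt 0
  have hc : ∀ i < 4, C * coeff i (jet F) = c i := by
    intro i hi
    rw [CYPeriods.coeff_jet]
    interval_cases i
    · rw [iteratedDeriv_zero, hF0, h0]
      simp
    · rw [iteratedDeriv_one, e1, h1]
      dsimp only
      rw [hF0]
      simp
    · rw [iteratedDeriv_succ, iteratedDeriv_one, e2, h2]
      dsimp only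
      rw [hF0]
      norm_num [Nat.factorial]
      ring_nf
      simp
    · rw [iteratedDeriv_succ, iteratedDeriv_succ, iteratedDeriv_one, e3, h3]
      norm_num [Nat.factorial]
      ring_nf
      simp
  refine coeff_jet_of_isBigO ha (n := 4) ?_ i hi
  obtain ⟨R, hR, hRF⟩ := jet_taylor hFa 4
  -- Dropping the remainder `h` from the exponent costs `O(s⁴)`, so the coefficients through order
  -- three are those of `C * F`.
  have b1 : (fun s => C * F s * (Complex.exp (h s) - 1)) =O[𝓝 0] (fun s : ℂ => s ^ 4) := by
    have h0 : h 0 = 0 := apply_zero_of_isBigO hh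
    have ht : Tendsto h (𝓝 0) (𝓝 0) := hh.trans_tendsto (by
      simpa using (continuous_pow 4).tendsto (0 : ℂ))
    have h5 : (fun s => Complex.exp (h s) - 1) =O[𝓝 0] h := by
      have h6 := (Complex.hasDerivAt_exp 0).isBigO_sub
      simp only [Complex.exp_zero, sub_zero] at h6
      exact h6.comp_tendsto ht
    have hFc : Continuous fun s => C * F s :=
      continuous_const.mul (Differentiable.continuous fun s => (hFd s).differentiableAt)
    have h7 := ((hFc.tendsto 0).isBigO_one ℂ).mul (h5.trans hh)
    simpa using h7
  have b2 : (fun s => C * (s ^ 4 * R s)) =O[𝓝 0] (fun s : ℂ => s ^ 4) := by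
    have h7 := (isBigO_refl (fun s : ℂ => s ^ 4) (𝓝 0)).mul (hR.continuousAt.tendsto.isBigO_one ℂ)
    simpa using h7.const_mul_left C
  refine (b1.add b2).congr' ?_ .rfl
  filter_upwards [hf] with s h1
  rw [h1, Complex.exp_add]
  change _ = C * (F s * Complex.exp (h s)) - _
  have h8 : ∑ i ∈ Finset.range 4, c i * s ^ i = C * ∑ i ∈ Finset.range 4, coeff i (jet F) * s ^ i := by
    rw [Finset.mul_sum]
    exact Finset.sum_congr rfl fun i hi => by rw [← hc i (Finset.mem_range.1 hi)]; ring
  rw [h8]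
  linear_combination -C * hRF s

end

end CYPeriods

/-! ### The expansion of `Γ` at `1` and Gauss' multiplication formula. -/

namespace CYPeriods

open Filter Topology PowerSeries Asymptotics

lemma hasSum_zeta {k : ℕ} (hk : 1 < k) :
    HasSum (fun i : ℕ => 1 / ((i + 1 : ℕ) : ℂ) ^ k) (riemannZeta k) := by
  have h1 : Summable fun i : ℕ => 1 / ((i : ℕ) : ℂ) ^ k := by
    rw [← summable_norm_iff]
    simpa using Real.summable_one_div_nat_pow.2 hk
  have h2 := (summable_nat_add_iff 1).2 h1
  rw [zeta_nat_eq_tsum_of_gt_one hk, h1.tsum_eq_zero_add]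
  simp only [Nat.cast_zero, zero_pow (by omega : k ≠ 0), div_zero, zero_add]
  exact h2.hasSum

/-- The remainder of third order of the logarithm. -/
noncomputable def logRem (i : ℕ) (s : ℂ) : ℂ :=
  s / (i + 1 : ℕ) - Complex.log (1 + s / (i + 1 : ℕ)) - s ^ 2 / 2 * (1 / ((i + 1 : ℕ) : ℂ) ^ 2) +
    s ^ 3 / 3 * (1 / ((i + 1 : ℕ) : ℂ) ^ 3)

/-- The fourth-order Taylor remainder of `log (1 + s / (i + 1))`. Its decay `(i + 1)⁻⁴` is weakened
to `(i + 1)⁻²`, since only summability matters. -/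
lemma norm_logRem_le (i : ℕ) {s : ℂ} (hs : ‖s‖ ≤ 1 / 2) :
    ‖logRem i s‖ ≤ ‖s‖ ^ 4 * (1 / ((i + 1 : ℕ) : ℝ) ^ 2) := by
  have hi : (1 : ℝ) ≤ (i + 1 : ℕ) := by exact_mod_cast Nat.succ_pos i
  have hz : ‖s / ((i + 1 : ℕ) : ℂ)‖ = ‖s‖ / (i + 1 : ℕ) := by
    rw [norm_div, Complex.norm_natCast]
  have hz1 : ‖s / ((i + 1 : ℕ) : ℂ)‖ ≤ 1 / 2 := by
    rw [hz]
    exact (div_le_self (norm_nonneg _) hi).trans hs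
  have h := Complex.norm_log_sub_logTaylor_le 3 (z := s / ((i + 1 : ℕ) : ℂ)) (by linarith)
  have e : logRem i s = -(Complex.log (1 + s / ((i + 1 : ℕ) : ℂ)) -
      Complex.logTaylor (3 + 1) (s / ((i + 1 : ℕ) : ℂ))) := by
    rw [logRem, Complex.logTaylor]
    generalize ((i + 1 : ℕ) : ℂ) = q
    simp only [Finset.sum_range_succ, Finset.sum_range_zero]
    push_cast
    ring
  rw [e, norm_neg]
  refine h.trans ?_
  have h2 : (1 - ‖s / ((i + 1 : ℕ) : ℂ)‖)⁻¹ ≤ 2 := by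
    rw [inv_le_comm₀ (by linarith) two_pos]
    linarith
  have h3 : (((i + 1 : ℕ) : ℝ) ^ 4)⁻¹ ≤ (((i + 1 : ℕ) : ℝ) ^ 2)⁻¹ :=
    inv_anti₀ (by positivity) (pow_le_pow_right₀ hi (by norm_num))
  calc ‖s / ((i + 1 : ℕ) : ℂ)‖ ^ (3 + 1) * (1 - ‖s / ((i + 1 : ℕ) : ℂ)‖)⁻¹ / ((3 : ℕ) + 1)
      ≤ ‖s / ((i + 1 : ℕ) : ℂ)‖ ^ (3 + 1) * 2 / ((3 : ℕ) + 1) := by gcongr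
    _ = ‖s‖ ^ 4 * (((i + 1 : ℕ) : ℝ) ^ 4)⁻¹ * (1 / 2) := by
      rw [hz, div_pow]
      push_cast
      ring
    _ ≤ ‖s‖ ^ 4 * (((i + 1 : ℕ) : ℝ) ^ 2)⁻¹ * 1 := by gcongr; norm_num
    _ = _ := by ring

lemma hasSum_sub_log {s : ℂ} (hs : ‖s‖ ≤ 1 / 2) :
    HasSum (fun i : ℕ => s / (i + 1 : ℕ) - Complex.log (1 + s / (i + 1 : ℕ)))
      (s ^ 2 / 2 * riemannZeta 2 - s ^ 3 / 3 * riemannZeta 3 + ∑' i, logRem i s) := by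
  have h2 : HasSum (fun i : ℕ => 1 / ((i + 1 : ℕ) : ℂ) ^ 2) (riemannZeta 2) := by
    exact_mod_cast hasSum_zeta (k := 2) (by norm_num)
  have h3 : HasSum (fun i : ℕ => 1 / ((i + 1 : ℕ) : ℂ) ^ 3) (riemannZeta 3) := by
    exact_mod_cast hasSum_zeta (k := 3) (by norm_num)
  have hR : Summable fun i => logRem i s := by
    refine Summable.of_norm_bounded ?_ fun i => norm_logRem_le i hs
    exact ((summable_nat_add_iff 1).2 (Real.summable_one_div_nat_pow.2 one_lt_two)).mul_left _
  refine (((h2.mul_left (s ^ 2 / 2)).sub (h3.mul_left (s ^ 3 / 3))).add hR.hasSum).congr_fun ?_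
  intro i
  rw [logRem]
  ring

/-- Logarithms of the factors of Euler's product. Adding and subtracting `s / (i + 1)` makes two
convergent pieces: a multiple of `s` that tends to `-s` times Euler's constant, and a series
starting at order `s²`. -/
lemma GammaSeq_one_add {s : ℂ} (hs : ‖s‖ < 1) {n : ℕ} (hn : n ≠ 0) :
    Complex.GammaSeq (1 + s) n = ((n : ℂ) / (n + 1 : ℕ)) *
      Complex.exp (s * (Real.log n - harmonic (n + 1) : ℝ) +
        ∑ i ∈ Finset.range (n + 1), (s / (i + 1 : ℕ) - Complex.log (1 + s / (i + 1 : ℕ)))) := by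
  have hn0 : (n : ℂ) ≠ 0 := by exact_mod_cast hn
  have hne : ∀ i : ℕ, 1 + s / (i + 1 : ℕ) ≠ 0 := fun i h => by
    have h1 : ‖s / ((i + 1 : ℕ) : ℂ)‖ < 1 := by
      rw [norm_div, Complex.norm_natCast]
      exact (div_le_self (norm_nonneg _) (by exact_mod_cast Nat.succ_pos i)).trans_lt hs
    rw [show s / ((i + 1 : ℕ) : ℂ) = -1 by linear_combination h] at h1
    simp at h1
  have h1 : ∏ j ∈ Finset.range (n + 1), (1 + s + j) =
      (n + 1).factorial * ∏ j ∈ Finset.range (n + 1), (1 + s / (j + 1 : ℕ)) := by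
    rw [← Finset.prod_range_add_one_eq_factorial, Nat.cast_prod, ← Finset.prod_mul_distrib]
    refine Finset.prod_congr rfl fun j _ => ?_
    have : ((j + 1 : ℕ) : ℂ) ≠ 0 := by exact_mod_cast Nat.succ_ne_zero j
    field_simp
    push_cast
    ring
  have h2 : ∑ i ∈ Finset.range (n + 1), (s / (i + 1 : ℕ) - Complex.log (1 + s / (i + 1 : ℕ))) =
      s * (harmonic (n + 1) : ℝ) -
        ∑ i ∈ Finset.range (n + 1), Complex.log (1 + s / (i + 1 : ℕ)) := by
    rw [Finset.sum_sub_distrib, harmonic]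
    push_cast
    rw [Finset.mul_sum]
    simp only [div_eq_mul_inv]
  have h3 : Complex.exp (∑ i ∈ Finset.range (n + 1), Complex.log (1 + s / (i + 1 : ℕ))) =
      ∏ j ∈ Finset.range (n + 1), (1 + s / (j + 1 : ℕ)) := by
    rw [Complex.exp_sum]
    exact Finset.prod_congr rfl fun j _ => Complex.exp_log (hne j)
  have h4 : Complex.exp (s * Real.log n) = (n : ℂ) ^ s := by
    rw [Complex.cpow_def_of_ne_zero hn0, Complex.natCast_log, mul_comm]
  have hprod : ∏ j ∈ Finset.range (n + 1), (1 + s / (j + 1 : ℕ)) ≠ 0 :=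
    Finset.prod_ne_zero_iff.2 fun j _ => hne j
  rw [Complex.GammaSeq, h1, h2, show s * ((Real.log n - harmonic (n + 1) : ℝ) : ℂ) +
    (s * ((harmonic (n + 1) : ℝ) : ℂ) - ∑ i ∈ Finset.range (n + 1), Complex.log (1 + s / (i + 1 : ℕ))) =
    s * Real.log n - ∑ i ∈ Finset.range (n + 1), Complex.log (1 + s / (i + 1 : ℕ)) by
      push_cast; ring, Complex.exp_sub, h3, h4, Complex.cpow_add _ _ hn0, Complex.cpow_one,
      Nat.factorial_succ]
  have hf : (n.factorial : ℂ) ≠ 0 := by exact_mod_cast n.factorial_ne_zero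
  have hn1 : ((n + 1 : ℕ) : ℂ) ≠ 0 := by exact_mod_cast Nat.succ_ne_zero n
  push_cast at hn1 hprod ⊢
  field_simp

/-- The expansion of the Gamma function at `1`. -/
theorem logJet_Gamma_one_add : LogJet (fun s => Complex.Gamma (1 + s)) 1
    (-Real.eulerMascheroniConstant) (riemannZeta 2 / 2) (-riemannZeta 3 / 3) := by
  have hball : ∀ᶠ s : ℂ in 𝓝 0, ‖s‖ ≤ 1 / 2 := by
    filter_upwards [Metric.ball_mem_nhds (0 : ℂ) (by norm_num : (0 : ℝ) < 1 / 2)] with s hs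
    exact (mem_ball_zero_iff.1 hs).le
  refine ⟨fun s => ∑' i, logRem i s, ?_, ?_⟩
  · have hS : Summable fun i : ℕ => 1 / ((i + 1 : ℕ) : ℝ) ^ 2 :=
      (summable_nat_add_iff 1).2 (Real.summable_one_div_nat_pow.2 one_lt_two)
    refine IsBigO.of_bound (∑' i : ℕ, 1 / ((i + 1 : ℕ) : ℝ) ^ 2) ?_
    filter_upwards [hball] with s hs
    rw [norm_pow, mul_comm, ← tsum_mul_left]
    exact tsum_of_norm_bounded (hS.mul_left _).hasSum fun i => norm_logRem_le i hs
  · filter_upwards [hball] with s hs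
    have h1 := Complex.GammaSeq_tendsto_Gamma (1 + s)
    have h2 : Tendsto (fun n : ℕ => (n : ℂ) / (n + 1 : ℕ)) atTop (𝓝 1) := by
      simpa using tendsto_natCast_div_add_atTop (1 : ℂ)
    have h3 : Tendsto (fun n : ℕ => Real.log n - harmonic (n + 1)) atTop
        (𝓝 (-Real.eulerMascheroniConstant)) := by
      -- `GammaSeq` has `n + 1` factors, whence `harmonic (n + 1)`; the surplus `1 / (n + 1)` tends
      -- to `0`.
      have h4 := (Real.tendsto_eulerMascheroniSeq'.add
        (tendsto_one_div_add_atTop_nhds_zero_nat (𝕜 := ℝ))).neg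
      rw [add_zero] at h4
      refine h4.congr' ?_
      filter_upwards [eventually_ne_atTop 0] with n hn
      rw [Real.eulerMascheroniSeq', if_neg hn, harmonic_succ]
      push_cast
      ring
    have h5 := (hasSum_sub_log hs).tendsto_sum_nat.comp (tendsto_add_atTop_nat 1)
    have h6 := h2.mul ((((Complex.continuous_ofReal.tendsto _).comp h3).const_mul s).add h5).cexp
    refine tendsto_nhds_unique (h1.congr' ?_) (h6.trans (le_of_eq ?_))
    · filter_upwards [eventually_ne_atTop 0] with n hn
      exact GammaSeq_one_add (by linarith) hn
    · congr 3
      push_cast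
      ring

lemma prod_range_mul_range (f : ℕ → ℂ) (m n : ℕ) :
    ∏ j ∈ Finset.range n, ∏ k ∈ Finset.range m, f (m * j + k) = ∏ i ∈ Finset.range (m * n), f i := by
  induction n with
  | zero => simp
  | succ n ih => rw [Finset.prod_range_succ, ih, Nat.mul_succ, Finset.prod_range_add]

/-- Gauss' multiplication formula. -/
theorem prod_Gamma_div_add {m : ℕ} (hm : m ≠ 0) (s : ℂ) :
    ∏ k ∈ Finset.range m, Complex.Gamma ((k + 1 : ℂ) / m + s) =
      (∏ k ∈ Finset.range m, Complex.Gamma ((k + 1 : ℂ) / m)) *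
        (Complex.exp (-(m * s * Real.log m)) * Complex.Gamma (1 + m * s)) := by
  have hm0 : (m : ℂ) ≠ 0 := by exact_mod_cast hm
  have hden : ∀ (s : ℂ) (n : ℕ), ∏ k ∈ Finset.range m, ∏ j ∈ Finset.range (n + 1),
      ((k + 1 : ℂ) / m + s + j) = ((m : ℂ) ^ (m * (n + 1)))⁻¹ *
        ∏ i ∈ Finset.range (m * (n + 1)), (1 + m * s + i) := by
    intro s n
    have h1 : ∀ k j : ℕ, (k + 1 : ℂ) / m + s + j = (m : ℂ)⁻¹ * (1 + m * s + (m * j + k : ℕ)) := by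
      intro k j
      push_cast
      field_simp
      ring
    simp only [h1]
    rw [Finset.prod_comm, ← prod_range_mul_range]
    simp only [Finset.prod_mul_distrib, Finset.prod_const, Finset.card_range]
    rw [pow_mul, inv_pow, inv_pow]
  set A : ℂ → ℕ → ℂ := fun s n => ∏ k ∈ Finset.range m, Complex.GammaSeq ((k + 1 : ℂ) / m + s) n
    with hA
  -- The `m` products of `n + 1` factors interlace to one product of `m (n + 1) = N n + 1` factors,
  -- the length of `GammaSeq` at `N n`.
  set N : ℕ → ℕ := fun n => m * (n + 1) - 1 with hN
  have hN1 : ∀ n, N n + 1 = m * (n + 1) := fun n =>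
    Nat.sub_add_cancel (Nat.mul_pos (Nat.pos_of_ne_zero hm) n.succ_pos)
  set E : ℕ → ℂ := fun n => Complex.exp (-(m * s * (Real.log (N n) - Real.log n : ℝ))) with hE
  -- Comparison with `s = 0` removes the factorials and the powers of `m`, so the constant in Gauss'
  -- formula need not be evaluated.
  have key : ∀ᶠ n in atTop, A s n * Complex.GammaSeq 1 (N n) =
      A 0 n * (E n * Complex.GammaSeq (1 + m * s) (N n)) := by
    filter_upwards [eventually_ne_atTop 0] with n hn
    have hn0 : (n : ℂ) ≠ 0 := by exact_mod_cast hn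
    have hNn : N n ≠ 0 := fun h => by
      have h1 := hN1 n
      rw [h] at h1
      have h2 : 2 ≤ m * (n + 1) := by
        have : 1 ≤ m := Nat.pos_of_ne_zero hm
        have : 1 ≤ n := Nat.pos_of_ne_zero hn
        nlinarith
      omega
    have hNn0 : (N n : ℂ) ≠ 0 := by exact_mod_cast hNn
    have e1 : ∀ s, A s n = (∏ k ∈ Finset.range m, (n : ℂ) ^ ((k + 1 : ℂ) / m)) * n.factorial ^ m *
        ((m : ℂ) ^ (m * (n + 1))) * ((n : ℂ) ^ s) ^ m *
          (∏ i ∈ Finset.range (m * (n + 1)), (1 + m * s + i))⁻¹ := by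
      intro s
      simp only [hA, Complex.GammaSeq]
      rw [Finset.prod_div_distrib, hden]
      simp only [Complex.cpow_add _ _ hn0, Finset.prod_mul_distrib, Finset.prod_const,
        Finset.card_range]
      rw [div_eq_mul_inv, mul_inv, inv_inv]
      ring
    have e2 : ∀ s, Complex.GammaSeq (1 + m * s) (N n) = (N n : ℂ) * (N n : ℂ) ^ (m * s) *
        (N n).factorial * (∏ i ∈ Finset.range (m * (n + 1)), (1 + m * s + i))⁻¹ := by
      intro s
      rw [Complex.GammaSeq, hN1, Complex.cpow_add _ _ hNn0, Complex.cpow_one, div_eq_mul_inv]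
    have e3 := e2 0
    rw [mul_zero, add_zero, Complex.cpow_zero] at e3
    have e4 : ((n : ℂ) ^ s) ^ m = E n * (N n : ℂ) ^ (m * s) := by
      rw [hE, Complex.cpow_def_of_ne_zero hn0, Complex.cpow_def_of_ne_zero hNn0,
        ← Complex.exp_nat_mul, ← Complex.exp_add, ← Complex.natCast_log, ← Complex.natCast_log]
      congr 1
      push_cast
      ring
    rw [e1, e1, e2, e3, e4, Complex.cpow_zero, one_pow, mul_zero, add_zero]
    ring
  have hNtop : Tendsto N atTop atTop := by
    refine tendsto_atTop_mono (fun n => ?_) tendsto_id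
    have : 1 ≤ m := Nat.pos_of_ne_zero hm
    have h1 := hN1 n
    simp only [id_eq]
    nlinarith
  have hElim : Tendsto E atTop (𝓝 (Complex.exp (-(m * s * Real.log m)))) := by
    have h1 : Tendsto (fun n : ℕ => Real.log (N n) - Real.log n) atTop (𝓝 (Real.log m)) := by
      have h2 : Tendsto (fun n : ℕ => (m : ℝ) + (m - 1) / n) atTop (𝓝 m) := by
        simpa using (tendsto_const_div_atTop_nhds_zero_nat ((m : ℝ) - 1)).const_add (m : ℝ)
      have h3 := h2.log (by exact_mod_cast hm)
      refine h3.congr' ?_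
      filter_upwards [eventually_ne_atTop 0, hNtop.eventually_ne_atTop 0] with n hn hNn
      have hn0 : (n : ℝ) ≠ 0 := by exact_mod_cast hn
      rw [← Real.log_div (by exact_mod_cast hNn) hn0]
      congr 1
      have h4 : (N n : ℝ) + 1 = m * (n + 1) := by exact_mod_cast hN1 n
      field_simp
      linarith
    exact (((Complex.continuous_ofReal.tendsto _).comp h1).const_mul (m * s : ℂ)).neg.cexp
  have hAlim : ∀ s, Tendsto (A s) atTop (𝓝 (∏ k ∈ Finset.range m,
      Complex.Gamma ((k + 1 : ℂ) / m + s))) := fun s =>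
    tendsto_finsetProd _ fun k _ => Complex.GammaSeq_tendsto_Gamma _
  have hB := fun s => (Complex.GammaSeq_tendsto_Gamma s).comp hNtop
  have h1 := (hAlim s).mul (hB 1)
  have h2 := (hAlim 0).mul (hElim.mul (hB (1 + m * s)))
  have h3 := tendsto_nhds_unique (h1.congr' key) h2
  simpa using h3

end CYPeriods

/-! ### From kernel identities to the transition matrix. -/

namespace CYPeriods

open Filter Topology PowerSeries Matrix

/-- The operator of `M` has its exponents in `(0, 1)` and they sum to `2`; the pairs `(a_i, n_i)`
enumerate the exponents with their multiplicities. -/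
structure Regular (M : Model) (lam : ℝ) (n : Fin 4 → ℕ) : Prop where
  mu_pos : 0 < M.mu
  lam_pos : 0 < lam
  a_pos : ∀ k, 0 < M.a k
  a_lt_one : ∀ k, M.a k < 1
  sum_a : ∑ k, M.a k = 2
  inj : ∀ i j, M.a i = M.a j → n i = n j → i = j
  lower : ∀ i, ∀ j < n i, ∃ i', M.a i' = M.a i ∧ n i' = j
  n_lt : ∀ i, n i < 4

lemma Regular.exists_isBasisAtZero {M : Model} {lam : ℝ} {n : Fin 4 → ℕ}
    (hM : Regular M lam n) : ∃ B₀, IsBasisAtZero M B₀ := by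
  refine ⟨fun i z => logSeries ((![0, 0, 0, 0] : Fin 4 → ℝ) i)
    (frobSeries 0 M.a M.mu ((![0, 0, 0, 0] : Fin 4 → ℝ) i)) ((![0, 1, 2, 3] : Fin 4 → ℕ) i) z,
    (isCoord_zero M).isFrobeniusBasis hM.mu_pos (fun i k => ?_) (fun i j hj => ?_)
      fun i z _ => rfl⟩
  · have h1 := hM.a_pos k
    have h2 := hM.a_lt_one k
    fin_cases i <;> simpa using ⟨h1, h2⟩
  · have h1 : (![0, 0, 0, 0] : Fin 4 → ℝ) i = 0 := by fin_cases i <;> rfl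
    have h2 : (![0, 1, 2, 3] : Fin 4 → ℕ) i < 4 := by fin_cases i <;> simp
    simp only [h1, Pi.zero_apply, add_zero, Complex.ofReal_zero, map_zero, zero_add,
      Finset.prod_const, Finset.card_univ, Fintype.card_fin, coeff_X_pow]
    rw [if_neg (by omega)]

-- The indicial polynomial at `a_i` is `∏ (a_i - a_k + T)`. The orders `0, …, n_i` of this exponent
-- occur at different indices, so `T ^ (n_i + 1)` divides it, as logarithms of order `n_i` require.
open Classical in
lemma Regular.isBasisAtInfinity {M : Model} {lam : ℝ} {n : Fin 4 → ℕ}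
    (hM : Regular M lam n) {B : Fin 4 → ℂ → ℂ}
    (hB : ∀ i z, z ∈ Complex.slitPlane → M.mu < ‖z‖ → B i z = logSeries (M.a i)
      (frobSeries (fun k => -M.a k) 0 (lam / M.mu) (M.a i)) (n i) (lam / z)) :
    IsBasisAtInfinity M lam n B := by
  refine (isCoord_infinity hM.mu_pos hM.lam_pos).isFrobeniusBasis (div_pos hM.lam_pos hM.mu_pos)
    (fun i k => ?_) (fun i j hj => ?_) fun i z hz => hB i z hz.1 hz.2
  · have h1 := hM.a_pos i
    have h2 := hM.a_lt_one k
    simp only [Pi.zero_apply, add_zero]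
    exact ⟨h1, by linarith⟩
  · set s := Finset.univ.filter fun k => M.a k = M.a i ∧ n k ≤ n i with hs
    have hcard : n i + 1 ≤ s.card := by
      rw [← Finset.card_range (n i + 1)]
      refine Finset.card_le_card_of_surjOn n fun j hj => ?_
      simp only [Finset.coe_range, Set.mem_Iio] at hj
      rcases Nat.lt_succ_iff_lt_or_eq.1 hj with h | h
      · obtain ⟨i', h1, h2⟩ := hM.lower i j h
        exact ⟨i', by simp [hs, h1, h2, h.le], h2⟩
      · exact ⟨i, by simp [hs], h.symm⟩
    have hdvd : (X : ℂ⟦X⟧) ^ s.card ∣ ∏ k, (C ((M.a i + -M.a k : ℝ) : ℂ) + X) := by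
      rw [← Finset.prod_const]
      refine dvd_trans (dvd_of_eq ?_) (Finset.prod_dvd_prod_of_subset s Finset.univ _
        (Finset.subset_univ _))
      refine Finset.prod_congr rfl fun k hk => ?_
      rw [(Finset.mem_filter.1 hk).2.1]
      simp
    exact X_pow_dvd_iff.1 hdvd j (by omega)

/-- Uniqueness replaces an arbitrary normalized basis by explicit series, to which the integrals
apply. -/
lemma Regular.eq_logSeries_infinity {M : Model} {lam : ℝ} {n : Fin 4 → ℕ}
    (hM : Regular M lam n) {B : Fin 4 → ℂ → ℂ} (hB : IsBasisAtInfinity M lam n B)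
    (i : Fin 4) {z : ℂ} (hz : z ∈ Complex.slitPlane) (hz' : M.mu < ‖z‖) :
    B i z = logSeries (M.a i) (frobSeries (fun k => -M.a k) 0 (lam / M.mu) (M.a i)) (n i)
      (lam / z) :=
  (isCoord_infinity hM.mu_pos hM.lam_pos).eqOn_of_isFrobeniusBasis
    (div_pos hM.lam_pos hM.mu_pos) (fun i k => by linarith [hM.a_pos i, hM.a_lt_one k]) hM.lower hB
    (hM.isBasisAtInfinity (B := fun i z => logSeries (M.a i)
      (frobSeries (fun k => -M.a k) 0 (lam / M.mu) (M.a i)) (n i) (lam / z))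
      fun _ _ _ _ => rfl) i ⟨hz, hz'⟩

lemma Regular.eq_logSeries_zero {M : Model} {lam : ℝ} {n : Fin 4 → ℕ}
    (hM : Regular M lam n) {B₀ : Fin 4 → ℂ → ℂ} (hB₀ : IsBasisAtZero M B₀)
    (i : Fin 4) {z : ℂ} (hz : z ∈ Complex.slitPlane) (hz' : ‖z‖ < M.mu) :
    B₀ i z = logSeries 0 (frobSeries 0 M.a M.mu 0) i z := by
  have hzero : ∀ i, (![0, 0, 0, 0] : Fin 4 → ℝ) i = 0 := fun i => by fin_cases i <;> rfl
  have hnat : ∀ i : Fin 4, (![0, 1, 2, 3] : Fin 4 → ℕ) i = i := fun i => by fin_cases i <;> rfl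
  have hcan : IsBasisAtZero M fun i z => logSeries 0 (frobSeries 0 M.a M.mu 0) i z := by
    refine (isCoord_zero M).isFrobeniusBasis hM.mu_pos (fun i k => ?_) (fun i j hj => ?_)
      fun i z _ => by rw [hzero, hnat]
    · simpa [hzero] using ⟨hM.a_pos k, hM.a_lt_one k⟩
    · have h2 := i.isLt
      rw [hnat] at hj
      simp only [hzero, Pi.zero_apply, add_zero, Complex.ofReal_zero, map_zero, zero_add,
        Finset.prod_const, Finset.card_univ, Fintype.card_fin, coeff_X_pow]
      rw [if_neg (by omega)]
  refine (isCoord_zero M).eqOn_of_isFrobeniusBasis hM.mu_pos (fun i k => by simp [hzero])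
    (fun i j hj => ⟨⟨j, ?_⟩, ?_, ?_⟩) hB₀ hcan i ⟨hz, hz'⟩
  · have h2 := i.isLt
    rw [hnat] at hj
    omega
  · rw [hzero, hzero]
  · rw [hnat]

/-- The polynomial in `u = e^{±2πis}` attached to the row `m` of a connection matrix. -/
noncomputable def rowPoly (M : Model) (ε : ℝ) (m : Fin 4 → ℂ) (u : ℂ) : ℂ :=
  ε * m 2 * (u - 1) ^ 3 + (m 3 + m 0 * M.c2D / 12 + m 1 * sigma M) * (u * (u - 1) ^ 2) -
    ε * m 1 * M.kappa / 2 * (u * (u + 1) * (u - 1)) +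
    m 0 * M.kappa / 6 * (u * (u ^ 2 + 4 * u + 1))

/-- The periods are normalized by the Gamma class: `κ` times the expansion of the Gamma quotient at
zero has the coefficients `0`, `c₂π²/6`, `χζ(3)`. -/
structure GammaClass (M : Model) (g₀ : ℂ) : Prop where
  ne_zero : g₀ ≠ 0
  kappa_ne_zero : M.kappa ≠ 0
  logJet : LogJet (frobGamma 0 M.a M.mu 0) g₀ 0 (M.c2D * Real.pi ^ 2 / 6 / M.kappa)
    (M.chi * riemannZeta 3 / M.kappa)

lemma twoPiI_ne_zero : twoPiI ≠ 0 := Complex.two_pi_I_ne_zero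

lemma wt_eq (ε : ℝ) : wt ε = ε * twoPiI := by
  rw [wt, twoPiI]
  ring

/-- The weights of the kernels become coefficients in the Frobenius basis at `0`, and the Gamma
class supplies the `χζ(3)` entry and the `c₂` corrections of `periodMatrix`. All that remains of the
connection problem is the algebraic identity `hker`. -/
theorem Regular.exists_row {M : Model} {lam : ℝ} {n : Fin 4 → ℕ} (hM : Regular M lam n) {ε : ℝ}
    (hε : ε = 1 ∨ ε = -1) {g₀ : ℂ} (hg : GammaClass M g₀) (i : Fin 4) {γ : ℕ → ℂ}
    (hγ : jet (frobGamma (fun k => -M.a k) 0 (lam / M.mu) (M.a i)) * PowerSeries.mk γ = 1)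
    {m : Fin 4 → ℂ}
    (hker : ∀ u v : ℂ, v = Complex.exp (wt ε * M.a i) * u - 1 → v ≠ 0 →
      ((lam / M.mu : ℝ) : ℂ) ^ (M.a i : ℂ) * g₀ * (∏ k, (Complex.exp (wt ε * M.a k) * u - 1)) *
        ∑ j ∈ Finset.range (n i + 1), γ j * kerPoly (wt (-ε)) (n i - j) v⁻¹ =
      twoPiI * rowPoly M ε m u) :
    ∃ F : ℂ → ℂ, DifferentiableOn ℂ F {z | 0 < ε * z.im} ∧
      (∀ z, 0 < ε * z.im → ‖z‖ < M.mu → F z = (((twoPiI ^ 3)⁻¹ • m) ᵥ* periodMatrix M) ⬝ᵥ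
        fun l : Fin 4 => logSeries 0 (frobSeries 0 M.a M.mu 0) l z) ∧
      ∀ z, 0 < ε * z.im → M.mu < ‖z‖ → F z =
        logSeries (M.a i) (frobSeries (fun k => -M.a k) 0 (lam / M.mu) (M.a i)) (n i) (lam / z) := by
  set A : ℂ := ((lam / M.mu : ℝ) : ℂ) ^ (M.a i : ℂ) with hA
  have htp := twoPiI_ne_zero
  have hk : (M.kappa : ℂ) ≠ 0 := by exact_mod_cast hg.kappa_ne_zero
  have hA0 : A ≠ 0 := by
    rw [hA, Ne, Complex.cpow_eq_zero_iff]
    intro h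
    exact (div_pos hM.lam_pos hM.mu_pos).ne' (by exact_mod_cast h.1)
  have hg0 := hg.ne_zero
  have hεε : (ε : ℂ) * ε = 1 := by rcases hε with rfl | rfl <;> simp
  -- Solved from a triangular system. The coefficient `1/12` of `c₂` is the `1/24` of `periodMatrix`
  -- plus another `1/24` that offsets the second-order Gamma-class term of the kernel of order
  -- three.
  set D' : ℕ → ℂ := fun j => match j with
    | 0 => m 2
    | 1 => (m 3 + m 0 * M.c2D / 12 + m 1 * sigma M) / twoPiI
    | 2 => -m 1 * M.kappa / twoPiI ^ 2
    | _ => m 0 * M.kappa / twoPiI ^ 3 with hD'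
  obtain ⟨F, hF, hF0, hF1⟩ := exists_continuation hε hM.sum_a hM.a_pos hM.a_lt_one hM.mu_pos
    hM.lam_pos i (hM.n_lt i) (D := fun j => (A * g₀)⁻¹ * D' j) hγ (fun u hu hbu => by
      have h1 := hker u _ rfl (sub_ne_zero.2 hbu)
      have hu1 := sub_ne_zero.2 hu
      -- With `E = 1 / (u - 1)` the kernels of order one to three have the Eulerian numerators `u`,
      -- `u (u + 1)` and `u (u² + 4u + 1)`, which are the ones in `rowPoly`.
      have h2 : (u - 1) ^ 4 * ∑ m ∈ Finset.range 4, (A * g₀)⁻¹ * D' m * kerPoly (wt ε) m ((u - 1)⁻¹) =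
          (A * g₀)⁻¹ * (twoPiI * rowPoly M ε m u) := by
        simp only [Finset.sum_range_succ, Finset.sum_range_zero, zero_add, hD', kerPoly, wt_eq,
          rowPoly]
        clear_value A
        clear hker h1 hbu
        rcases hε with rfl | rfl <;> push_cast <;> field_simp <;> ring
      rw [h2, ← h1, mul_assoc (A * g₀), inv_mul_cancel_left₀ (mul_ne_zero hA0 hg0)])
  refine ⟨F, hF, fun z hz hz' => ?_, hF1⟩
  rw [hF0 z hz hz']
  have han : AnalyticAt ℂ (frobGamma 0 M.a M.mu 0) 0 := analyticAt_hypGamma fun k =>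
    ⟨by simpa using hM.a_pos k, by simpa using hM.a_lt_one k⟩
  have hc := fun l (hl : l < 4) => hg.logJet.coeff_jet han (c := fun l => match l with
    | 0 => g₀
    | 1 => 0
    | 2 => g₀ * (M.c2D * Real.pi ^ 2 / 6 / M.kappa)
    | _ => g₀ * (M.chi * riemannZeta 3 / M.kappa)) rfl (by simp) (by simp) (by simp) hl
  have hpi : (Real.pi : ℂ) ^ 2 = -twoPiI ^ 2 / 4 := by
    rw [twoPiI]
    linear_combination Real.pi ^ 2 * Complex.I_sq
  simp only [Finset.sum_range_succ, Finset.sum_range_zero, zero_add, hD', hc 0 (by norm_num),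
    hc 1 (by norm_num), hc 2 (by norm_num), hc 3 (by norm_num), hpi, dotProduct,
    Fin.sum_univ_four, Matrix.vecMul, periodMatrix, Matrix.smul_apply, Pi.smul_apply, smul_eq_mul]
  rw [← hA]
  clear_value A
  simp
  field_simp
  ring

theorem Regular.hasInverseTransitionMatrix {M : Model} {lam : ℝ} {n : Fin 4 → ℕ}
    (hM : Regular M lam n) {ε : ℝ} (hε : ε = 1 ∨ ε = -1) {g₀ : ℂ} (hg : GammaClass M g₀)
    {S : Matrix (Fin 4) (Fin 4) ℂ}
    (hrow : ∀ i, ∃ γ : ℕ → ℂ,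
      jet (frobGamma (fun k => -M.a k) 0 (lam / M.mu) (M.a i)) * PowerSeries.mk γ = 1 ∧
      ∀ u v : ℂ, v = Complex.exp (wt ε * M.a i) * u - 1 → v ≠ 0 →
        ((lam / M.mu : ℝ) : ℂ) ^ (M.a i : ℂ) * g₀ * (∏ k, (Complex.exp (wt ε * M.a k) * u - 1)) *
          ∑ j ∈ Finset.range (n i + 1), γ j * kerPoly (wt (-ε)) (n i - j) v⁻¹ =
        twoPiI * rowPoly M ε (S i) u)
    {B₀ B : Fin 4 → ℂ → ℂ} (hB₀ : IsBasisAtZero M B₀) (hB : IsBasisAtInfinity M lam n B) :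
    HasInverseTransitionMatrix M {z | 0 < ε * z.im} B₀ B ((twoPiI ^ 3)⁻¹ • S) := by
  choose γ hγ hker using hrow
  choose F hF hF0 hF1 using fun i => hM.exists_row hε hg i (hγ i) (hker i)
  have hslit : ∀ z : ℂ, 0 < ε * z.im → z ∈ Complex.slitPlane := fun z hz => Or.inr fun h0 => by
    simp [h0] at hz
  refine CYPeriods.hasInverseTransitionMatrix hε hM.mu_pos hF (fun i z hz hz' => ?_)
    (fun i z hz hz' => ?_) fun v hv =>
      hB.linearIndependent hε hM.mu_pos hM.lam_pos hM.inj hv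
  · rw [hF0 i z hz hz', Matrix.mulVec, Matrix.mul_apply_eq_vecMul]
    congr 1
    ext l
    exact (hM.eq_logSeries_zero hB₀ l (hslit z hz) hz').symm
  · rw [hF1 i z hz hz', hM.eq_logSeries_infinity hB i (hslit z hz) hz']

end CYPeriods

/-! ### Expansions of products of Gamma functions at rational points. -/

namespace CYPeriods

open Filter Topology PowerSeries

/-- Gauss' formula for `m + 1` with its last factor `Γ(1 + s)` divided out, which leaves only
expansions at `1`. -/
lemma logJet_prod_Gamma (m : ℕ) :
    LogJet (fun s => ∏ k ∈ Finset.range m, Complex.Gamma ((k + 1 : ℂ) / (m + 1 : ℕ) + s))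
      (∏ k ∈ Finset.range m, Complex.Gamma ((k + 1 : ℂ) / (m + 1 : ℕ)))
      (-((m + 1 : ℕ) * Real.log (m + 1 : ℕ)) - m * Real.eulerMascheroniConstant)
      (riemannZeta 2 / 2 * ((m + 1 : ℕ) ^ 2 - 1)) (-riemannZeta 3 / 3 * ((m + 1 : ℕ) ^ 3 - 1)) := by
  have h1 := ((logJet_const (∏ k ∈ Finset.range m, Complex.Gamma ((k + 1 : ℂ) / (m + 1 : ℕ)))).mul
    ((logJet_exp (-((m + 1 : ℕ) * Real.log (m + 1 : ℕ)))).mul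
      (logJet_Gamma_one_add.comp_mul (m + 1 : ℕ)))).mul logJet_Gamma_one_add.inv
  have hm : ((m + 1 : ℕ) : ℂ) ≠ 0 := by exact_mod_cast m.succ_ne_zero
  refine h1.congr ?_ (by simp) (by push_cast; ring) (by push_cast; ring) (by push_cast; ring)
  have hne : ∀ᶠ s : ℂ in 𝓝 0, Complex.Gamma (1 + s) ≠ 0 := by
    obtain ⟨h, -, hh⟩ := logJet_Gamma_one_add
    filter_upwards [hh] with s hs
    rw [hs]
    exact mul_ne_zero one_ne_zero (Complex.exp_ne_zero _)
  filter_upwards [hne] with s hs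
  have h2 := prod_Gamma_div_add (m := m + 1) m.succ_ne_zero s
  have h3 : (m + 1 : ℂ) / (m + 1 : ℕ) = 1 := by
    push_cast at hm ⊢
    exact div_self hm
  rw [Finset.prod_range_succ, Finset.prod_range_succ, h3, Complex.Gamma_one, mul_one] at h2
  rw [← div_eq_mul_inv, div_eq_iff hs, h2]
  congr 3
  ring

lemma logJet_Gamma_half : LogJet (fun s => Complex.Gamma (1 / 2 + s)) (Complex.Gamma (1 / 2))
    (-(2 * Real.log 2) - Real.eulerMascheroniConstant) (3 / 2 * riemannZeta 2)
    (-(7 / 3 * riemannZeta 3)) := by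
  refine (logJet_prod_Gamma 1).congr (Eventually.of_forall fun s => ?_) ?_ ?_ ?_ ?_ <;>
    push_cast [Finset.prod_range_succ, Finset.prod_range_zero] <;> norm_num <;> ring

lemma logJet_Gamma_thirds : LogJet (fun s => Complex.Gamma (1 / 3 + s) * Complex.Gamma (2 / 3 + s))
    (Complex.Gamma (1 / 3) * Complex.Gamma (2 / 3))
    (-(3 * Real.log 3) - 2 * Real.eulerMascheroniConstant) (4 * riemannZeta 2)
    (-(26 / 3 * riemannZeta 3)) := by
  refine (logJet_prod_Gamma 2).congr (Eventually.of_forall fun s => ?_) ?_ ?_ ?_ ?_ <;>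
    push_cast [Finset.prod_range_succ, Finset.prod_range_zero] <;> norm_num <;> ring

lemma logJet_Gamma_fifths : LogJet (fun s => Complex.Gamma (1 / 5 + s) * Complex.Gamma (2 / 5 + s) *
      Complex.Gamma (3 / 5 + s) * Complex.Gamma (4 / 5 + s))
    (Complex.Gamma (1 / 5) * Complex.Gamma (2 / 5) * Complex.Gamma (3 / 5) * Complex.Gamma (4 / 5))
    (-(5 * Real.log 5) - 4 * Real.eulerMascheroniConstant) (12 * riemannZeta 2)
    (-(124 / 3 * riemannZeta 3)) := by
  refine (logJet_prod_Gamma 4).congr (Eventually.of_forall fun s => ?_) ?_ ?_ ?_ ?_ <;>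
    push_cast [Finset.prod_range_succ, Finset.prod_range_zero] <;> norm_num <;> ring

lemma Gamma_half_ne_zero : Complex.Gamma (1 / 2) ≠ 0 :=
  Complex.Gamma_ne_zero_of_re_pos (by norm_num)

/-- The formula for denominator four also contains `Γ(1/2 + s)`, which is divided out. -/
lemma logJet_Gamma_quarters : LogJet
    (fun s => Complex.Gamma (1 / 4 + s) * Complex.Gamma (3 / 4 + s))
    (Complex.Gamma (1 / 4) * Complex.Gamma (3 / 4))
    (-(6 * Real.log 2) - 2 * Real.eulerMascheroniConstant) (6 * riemannZeta 2)
    (-(56 / 3 * riemannZeta 3)) := by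
  have hlog : Real.log 4 = 2 * Real.log 2 := by
    rw [show (4 : ℝ) = 2 ^ 2 by norm_num, Real.log_pow]
    norm_num
  have hne : ∀ᶠ s : ℂ in 𝓝 0, Complex.Gamma (1 / 2 + s) ≠ 0 := by
    obtain ⟨h, -, hh⟩ := logJet_Gamma_half
    filter_upwards [hh] with s hs
    rw [hs]
    exact mul_ne_zero Gamma_half_ne_zero (Complex.exp_ne_zero _)
  refine ((logJet_prod_Gamma 3).mul logJet_Gamma_half.inv).congr ?_ ?_ ?_ ?_ ?_
  · filter_upwards [hne] with s hs
    simp only [Finset.prod_range_succ, Finset.prod_range_zero]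
    push_cast
    norm_num at hs ⊢
    linear_combination (Complex.Gamma (1 / 4 + s) * Complex.Gamma (3 / 4 + s)) * mul_inv_cancel₀ hs
  · simp only [Finset.prod_range_succ, Finset.prod_range_zero]
    have := Gamma_half_ne_zero
    push_cast
    norm_num at this ⊢
    field_simp
  · rw [show Real.log ((3 + 1 : ℕ) : ℝ) = 2 * Real.log 2 by rw [← hlog]; norm_num]
    push_cast
    ring
  · push_cast
    ring
  · push_cast
    ring

end CYPeriods

/-! ### The Gamma class of the five families. -/

namespace CYPeriods

open Filter Topology PowerSeries

lemma frobGamma_zero_eq (M : Model) (s : ℂ) : frobGamma 0 M.a M.mu 0 s =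
    (∏ k, Complex.Gamma (M.a k + s)) * (Complex.Gamma (1 + s))⁻¹ ^ 4 *
      Complex.exp (-Real.log M.mu * s) := by
  rw [frobGamma, hypGamma]
  simp only [Pi.zero_apply, add_zero, zero_add, Complex.ofReal_one, Finset.prod_mul_distrib,
    Finset.prod_const, Finset.card_univ, Fintype.card_fin]
  rw [mul_comm s, neg_mul]

/-- The normalization by the Gamma class follows from the expansion of `∏ Γ(a_k + s)`. -/
lemma gammaClass_of_logJet {M : Model} {g₀ c₁ c₂ c₃ : ℂ} (h0 : g₀ ≠ 0) (hk : M.kappa ≠ 0)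
    (hJ : LogJet (fun s => ∏ k, Complex.Gamma (M.a k + s)) g₀ c₁ c₂ c₃)
    (h1 : c₁ = Real.log M.mu - 4 * Real.eulerMascheroniConstant)
    (h2 : M.kappa * (c₂ - 2 * riemannZeta 2) = M.c2D * riemannZeta 2)
    (h3 : M.kappa * (c₃ + 4 / 3 * riemannZeta 3) = M.chi * riemannZeta 3) : GammaClass M g₀ := by
  have hk' : (M.kappa : ℂ) ≠ 0 := by exact_mod_cast hk
  refine ⟨h0, hk, ((hJ.mul (logJet_Gamma_one_add.inv.pow 4)).mul
    (logJet_exp (-Real.log M.mu))).congr (Eventually.of_forall fun s =>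
      (frobGamma_zero_eq M s).symm) (by simp) ?_ ?_ ?_⟩
  · rw [h1]
    push_cast
    ring
  · rw [riemannZeta_two] at h2 ⊢
    rw [eq_div_iff hk']
    push_cast
    linear_combination h2
  · rw [eq_div_iff hk']
    push_cast
    linear_combination h3

lemma Gamma_ne_zero_of_pos {q : ℝ} (hq : 0 < q) : Complex.Gamma q ≠ 0 :=
  Complex.Gamma_ne_zero_of_re_pos (by simpa using hq)

lemma log_one_div_pow (x : ℝ) (n : ℕ) : Real.log (1 / x ^ n) = -(n * Real.log x) := by
  rw [one_div, Real.log_inv, Real.log_pow]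

/-- The topological numbers come out of the expansion: `5 (12 - 2) = 50` and `5 (-124/3 + 4/3) =
-200`, while `log μ = -5 log 5` cancels the logarithm in Gauss' formula. -/
lemma gammaClass_modelX5 : GammaClass modelX5 (∏ k, Complex.Gamma (modelX5.a k)) := by
  refine gammaClass_of_logJet (Finset.prod_ne_zero_iff.2 fun k _ => Gamma_ne_zero_of_pos ?_)
    (by simp [modelX5]) (logJet_Gamma_fifths.congr (Eventually.of_forall fun s => ?_) ?_ rfl rfl rfl)
    ?_ ?_ ?_
  · fin_cases k <;> norm_num [modelX5]
  · simp [modelX5, Fin.prod_univ_four]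
  · simp [modelX5, Fin.prod_univ_four]
  · rw [show modelX5.mu = 1 / 5 ^ 5 from rfl, log_one_div_pow]
    push_cast
    ring
  · norm_num [modelX5]
    ring
  · norm_num [modelX5]
    ring

lemma gammaClass_modelX43 : GammaClass modelX43 (∏ k, Complex.Gamma (modelX43.a k)) := by
  refine gammaClass_of_logJet (Finset.prod_ne_zero_iff.2 fun k _ => Gamma_ne_zero_of_pos ?_)
    (by simp [modelX43]) ((logJet_Gamma_quarters.mul logJet_Gamma_thirds).congr
      (Eventually.of_forall fun s => ?_) ?_ rfl rfl rfl) ?_ ?_ ?_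
  · fin_cases k <;> norm_num [modelX43]
  · simp [modelX43, Fin.prod_univ_four]
    ring
  · simp [modelX43, Fin.prod_univ_four]
    ring
  · rw [show modelX43.mu = 1 / (2 ^ 6 * 3 ^ 3) from rfl, one_div, mul_inv,
      Real.log_mul (by norm_num) (by norm_num), ← one_div, ← one_div, log_one_div_pow,
      log_one_div_pow]
    push_cast
    ring
  · norm_num [modelX43]
    ring
  · norm_num [modelX43]
    ring

lemma gammaClass_modelX42 : GammaClass modelX42 (∏ k, Complex.Gamma (modelX42.a k)) := by
  refine gammaClass_of_logJet (Finset.prod_ne_zero_iff.2 fun k _ => Gamma_ne_zero_of_pos ?_)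
    (by simp [modelX42]) ((logJet_Gamma_quarters.mul (logJet_Gamma_half.pow 2)).congr
      (Eventually.of_forall fun s => ?_) ?_ rfl rfl rfl) ?_ ?_ ?_
  · fin_cases k <;> norm_num [modelX42]
  · simp [modelX42, Fin.prod_univ_four]
    ring
  · simp [modelX42, Fin.prod_univ_four]
    ring
  · rw [show modelX42.mu = 1 / 2 ^ 10 from rfl, log_one_div_pow]
    push_cast
    ring
  · norm_num [modelX42]
    ring
  · norm_num [modelX42]
    ring

lemma gammaClass_modelX44 : GammaClass modelX44 (∏ k, Complex.Gamma (modelX44.a k)) := by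
  refine gammaClass_of_logJet (Finset.prod_ne_zero_iff.2 fun k _ => Gamma_ne_zero_of_pos ?_)
    (by simp [modelX44]) ((logJet_Gamma_quarters.pow 2).congr
      (Eventually.of_forall fun s => ?_) ?_ rfl rfl rfl) ?_ ?_ ?_
  · fin_cases k <;> norm_num [modelX44]
  · simp [modelX44, Fin.prod_univ_four]
    ring
  · simp [modelX44, Fin.prod_univ_four]
    ring
  · rw [show modelX44.mu = 1 / 2 ^ 12 from rfl, log_one_div_pow]
    push_cast
    ring
  · norm_num [modelX44]
    ring
  · norm_num [modelX44]
    ring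

lemma gammaClass_modelX2222 : GammaClass modelX2222 (∏ k, Complex.Gamma (modelX2222.a k)) := by
  refine gammaClass_of_logJet (Finset.prod_ne_zero_iff.2 fun k _ => Gamma_ne_zero_of_pos ?_)
    (by simp [modelX2222]) ((logJet_Gamma_half.pow 4).congr
      (Eventually.of_forall fun s => ?_) ?_ rfl rfl rfl) ?_ ?_ ?_
  · fin_cases k <;> norm_num [modelX2222]
  · simp [modelX2222, Fin.prod_univ_four]
    ring
  · simp [modelX2222, Fin.prod_univ_four]
    ring
  · rw [show modelX2222.mu = 1 / 2 ^ 8 from rfl, log_one_div_pow]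
    push_cast
    ring
  · norm_num [modelX2222]
    ring
  · norm_num [modelX2222]
    ring

end CYPeriods

/-! ### Digamma values and the rows with at most one logarithm. -/

namespace CYPeriods

open Filter Topology PowerSeries Asymptotics

/-- Taylor expansion of `log (f / f 0)`. The higher coefficients may stay unspecified, because rows
with at most one logarithm do not involve them. -/
lemma exists_logJet {f : ℂ → ℂ} (hf : AnalyticAt ℂ f 0) (h0 : f 0 ≠ 0) :
    ∃ c₂ c₃, LogJet f (f 0) (deriv f 0 / f 0) c₂ c₃ := by
  set L : ℂ → ℂ := fun s => Complex.log (f s / f 0) with hL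
  have hL0 : L 0 = 0 := by simp [hL]
  have hLa : AnalyticAt ℂ L 0 := (hf.div analyticAt_const h0).clog (by simp [div_self h0])
  have hd : deriv L 0 = deriv f 0 / f 0 := by
    have h1 := (hf.differentiableAt.hasDerivAt.div_const (f 0)).clog (by simp [div_self h0])
    simpa [div_self h0] using h1.deriv
  obtain ⟨F, hF, hFe⟩ := jet_taylor hLa 4
  refine ⟨coeff 2 (jet L), coeff 3 (jet L), fun s => s ^ 4 * F s, ?_, ?_⟩
  · simpa using (isBigO_refl (fun s : ℂ => s ^ 4) (𝓝 0)).mul (hF.continuousAt.tendsto.isBigO_one ℂ)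
  · filter_upwards [hf.continuousAt.eventually_ne h0] with s hs
    have h1 : deriv f 0 / f 0 * s + coeff 2 (jet L) * s ^ 2 + coeff 3 (jet L) * s ^ 3 +
        s ^ 4 * F s = L s := by
      rw [hFe s]
      simp only [Finset.sum_range_succ, Finset.sum_range_zero]
      rw [coeff_zero_jet, coeff_one_jet, hL0, hd]
      ring
    rw [h1, hL, Complex.exp_log (div_ne_zero hs h0)]
    field_simp

lemma LogJet.deriv_eq {f : ℂ → ℂ} {C c₁ c₂ c₃ : ℂ} (hJ : LogJet f C c₁ c₂ c₃)
    (hf : AnalyticAt ℂ f 0) : deriv f 0 = C * c₁ := by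
  rw [← coeff_one_jet]
  exact hJ.coeff_jet hf (c := fun j => match j with
    | 0 => C
    | 1 => C * c₁
    | 2 => C * (c₂ + c₁ ^ 2 / 2)
    | _ => C * (c₃ + c₁ * c₂ + c₁ ^ 3 / 6)) rfl rfl rfl rfl (by norm_num : 1 < 4)

lemma analyticAt_Gamma_add {q : ℝ} (hq : 0 < q) :
    AnalyticAt ℂ (fun s => Complex.Gamma (q + s)) 0 := by
  have hopen : IsOpen {s : ℂ | -q < s.re} := isOpen_lt continuous_const Complex.continuous_re
  refine DifferentiableOn.analyticAt (s := {s : ℂ | -q < s.re}) (fun s hs => ?_)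
    (hopen.mem_nhds (by simpa using hq))
  refine ((Complex.differentiableAt_Gamma _ fun m hm => ?_).comp s
    (by fun_prop)).differentiableWithinAt
  have h2 := congrArg Complex.re hm
  have hs' : -q < s.re := hs
  simp at h2
  have hm0 : (0 : ℝ) ≤ m := m.cast_nonneg
  linarith

lemma exists_logJet_Gamma {q : ℝ} (hq : 0 < q) : ∃ c₂ c₃,
    LogJet (fun s => Complex.Gamma (q + s)) (Complex.Gamma q) (Complex.digamma q) c₂ c₃ := by
  obtain ⟨c₂, c₃, h⟩ := exists_logJet (analyticAt_Gamma_add hq)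
    (by simpa using Gamma_ne_zero_of_pos hq)
  refine ⟨c₂, c₃, h.congr .rfl (by simp) ?_ rfl rfl⟩
  rw [deriv_comp_const_add (f := Complex.Gamma), Complex.digamma_def, logDeriv_apply]
  simp

/-- The sum of the two values is the linear coefficient in `logJet_Gamma_quarters`. Their difference
is the logarithmic derivative at `0` of `Γ(1/4 + s) Γ(3/4 - s) = π / sin π(1/4 + s)`, namely `-π cot
(π/4) = -π`. -/
lemma digamma_quarters :
    Complex.digamma (1 / 4) = -Real.eulerMascheroniConstant - Real.pi / 2 - 3 * Real.log 2 ∧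
    Complex.digamma (3 / 4) = -Real.eulerMascheroniConstant + Real.pi / 2 - 3 * Real.log 2 := by
  have p1 : (0 : ℝ) < 1 / 4 := by norm_num
  have p3 : (0 : ℝ) < 3 / 4 := by norm_num
  obtain ⟨c₂, c₃, h1⟩ := exists_logJet_Gamma p1
  obtain ⟨d₂, d₃, h3⟩ := exists_logJet_Gamma p3
  have n1 := Gamma_ne_zero_of_pos p1
  have n3 := Gamma_ne_zero_of_pos p3
  have a1 := analyticAt_Gamma_add p1
  have a3 := analyticAt_Gamma_add p3
  push_cast at h1 h3 n1 n3 a1 a3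
  have hsum : Complex.digamma (1 / 4) + Complex.digamma (3 / 4) =
      -(6 * Real.log 2) - 2 * Real.eulerMascheroniConstant := by
    have e1 := (h1.mul h3).deriv_eq (a1.mul a3)
    rw [logJet_Gamma_quarters.deriv_eq (a1.mul a3)] at e1
    exact (mul_left_cancel₀ (mul_ne_zero n1 n3) e1).symm
  have hdiff : Complex.digamma (1 / 4) - Complex.digamma (3 / 4) = -Real.pi := by
    have a3' : AnalyticAt ℂ (fun s => Complex.Gamma (3 / 4 + -1 * s)) 0 :=
      AnalyticAt.comp (g := fun s => Complex.Gamma (3 / 4 + s)) (f := fun s => -1 * s)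
        (by simpa using a3) (by fun_prop)
    have e1 := (h1.mul (h3.comp_mul (-1))).deriv_eq (a1.mul a3')
    have e2 : (fun s => Complex.Gamma (1 / 4 + s) * Complex.Gamma (3 / 4 + -1 * s)) =
        fun s => Real.pi / Complex.sin (Real.pi * (1 / 4 + s)) := by
      funext s
      rw [← Complex.Gamma_mul_Gamma_one_sub]
      ring_nf
    have e3 := congrFun e2 0
    have hs4 : Complex.sin (Real.pi * (1 / 4)) = Complex.cos (Real.pi * (1 / 4)) := by
      rw [show (Real.pi * (1 / 4) : ℂ) = ((Real.pi / 4 : ℝ) : ℂ) by push_cast; ring,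
        ← Complex.ofReal_sin, ← Complex.ofReal_cos, Real.sin_pi_div_four, Real.cos_pi_div_four]
    have hs0 : Complex.sin (Real.pi * (1 / 4)) ≠ 0 := by
      rw [show (Real.pi * (1 / 4) : ℂ) = ((Real.pi / 4 : ℝ) : ℂ) by push_cast; ring,
        ← Complex.ofReal_sin, Real.sin_pi_div_four]
      have : (0 : ℝ) < √2 / 2 := by positivity
      exact_mod_cast this.ne'
    have e4 : HasDerivAt (fun s => Real.pi / Complex.sin (Real.pi * (1 / 4 + s)))
        (-(Real.pi * Real.pi / Complex.sin (Real.pi * (1 / 4)))) 0 := by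
      have h5 : HasDerivAt (fun s => Complex.sin (Real.pi * (1 / 4 + s)))
          (Complex.cos (Real.pi * (1 / 4)) * Real.pi) 0 := by
        have h6 : HasDerivAt (fun s : ℂ => (Real.pi : ℂ) * (1 / 4 + s)) Real.pi 0 := by
          exact (((hasDerivAt_id (0 : ℂ)).const_add (1 / 4)).const_mul (Real.pi : ℂ)).congr_deriv
            (mul_one _)
        exact h6.csin.congr_deriv (by rw [add_zero])
      have h7 := (hasDerivAt_const (0 : ℂ) (Real.pi : ℂ)).fun_div h5 (by simpa using hs0)
      refine h7.congr_deriv ?_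
      rw [← hs4, add_zero]
      generalize Complex.sin (Real.pi * (1 / 4)) = S at hs0 ⊢
      field_simp
      ring
    rw [e2, e4.deriv] at e1
    simp only [mul_zero, add_zero] at e3
    rw [e3] at e1
    have hpi : (Real.pi : ℂ) ≠ 0 := by exact_mod_cast Real.pi_ne_zero
    refine mul_left_cancel₀ (div_ne_zero hpi hs0) ?_
    linear_combination -e1
  constructor
  · linear_combination (hsum + hdiff) / 2
  · linear_combination (hsum - hdiff) / 2

lemma Regular.admissible {M : Model} {lam : ℝ} {n : Fin 4 → ℕ} (hM : Regular M lam n) (i : Fin 4) :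
    Admissible (fun k => M.a i + (0 : Fin 4 → ℝ) k) (fun k => 1 + M.a i + -M.a k) := fun k =>
  ⟨by simpa using hM.a_pos i, by
    simp only [Pi.zero_apply]
    linarith [hM.a_lt_one k]⟩

lemma frobGamma_infinity_eq (M : Model) (r ρ : ℝ) (s : ℂ) : frobGamma (fun k => -M.a k) 0 r ρ s =
    Complex.Gamma (ρ + s) ^ 4 * (∏ k, (Complex.Gamma (((1 + ρ - M.a k : ℝ) : ℂ) + s))⁻¹) *
      Complex.exp (-Real.log r * s) := by
  rw [frobGamma, hypGamma]
  simp only [Pi.zero_apply, add_zero, Finset.prod_mul_distrib, Finset.prod_const, Finset.card_univ,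
    Fintype.card_fin, ← sub_eq_add_neg]
  rw [mul_comm s, neg_mul]

/-- The inverse Taylor series at infinity, up to order three. -/
lemma Regular.exists_inv_jet {M : Model} {lam : ℝ} {n : Fin 4 → ℕ} (hM : Regular M lam n) (i : Fin 4)
    {K c₁ c₂ c₃ : ℂ} (hJ : LogJet (frobGamma (fun k => -M.a k) 0 (lam / M.mu) (M.a i)) K c₁ c₂ c₃) :
    ∃ γ : ℕ → ℂ, jet (frobGamma (fun k => -M.a k) 0 (lam / M.mu) (M.a i)) * PowerSeries.mk γ = 1 ∧
      γ 0 = K⁻¹ ∧ γ 1 = -(K⁻¹ * c₁) ∧ γ 2 = K⁻¹ * (-c₂ + c₁ ^ 2 / 2) ∧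
      γ 3 = K⁻¹ * (-c₃ + c₁ * c₂ - c₁ ^ 3 / 6) := by
  have ha := analyticAt_hypGamma (r := lam / M.mu) (hM.admissible i)
  have h0 := hypGamma_zero_ne_zero (r := lam / M.mu) (hM.admissible i)
  set γ : ℕ → ℂ := fun j => coeff j
    (jet fun s => (frobGamma (fun k => -M.a k) 0 (lam / M.mu) (M.a i) s)⁻¹) with hγ
  have hmk : PowerSeries.mk γ =
      jet fun s => (frobGamma (fun k => -M.a k) 0 (lam / M.mu) (M.a i) s)⁻¹ := by
    ext j
    rw [coeff_mk]
  have hc := fun j (hj : j < 4) => hJ.inv.coeff_jet (ha.inv h0) (c := fun l => match l with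
    | 0 => K⁻¹
    | 1 => -(K⁻¹ * c₁)
    | 2 => K⁻¹ * (-c₂ + c₁ ^ 2 / 2)
    | _ => K⁻¹ * (-c₃ + c₁ * c₂ - c₁ ^ 3 / 6)) rfl (by change -(K⁻¹ * c₁) = _; ring)
    (by change K⁻¹ * (-c₂ + c₁ ^ 2 / 2) = _; ring)
    (by change K⁻¹ * (-c₃ + c₁ * c₂ - c₁ ^ 3 / 6) = _; ring) hj
  refine ⟨γ, ?_, hc 0 (by norm_num), hc 1 (by norm_num), hc 2 (by norm_num), hc 3 (by norm_num)⟩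
  rw [hmk]
  exact jet_mul_jet_inv ha h0

/-- The leading constant of the row of the exponent `a_i`. -/
noncomputable def rowConst (M : Model) (lam : ℝ) (i : Fin 4) : ℝ :=
  (lam / M.mu) ^ M.a i * (∏ k, Real.Gamma (M.a k)) *
    ((∏ k, Real.Gamma (1 + M.a i - M.a k)) / Real.Gamma (M.a i) ^ 4)

lemma Regular.rowConst_eq {M : Model} {lam : ℝ} {n : Fin 4 → ℕ} (hM : Regular M lam n) (i : Fin 4)
    {K c₁ c₂ c₃ : ℂ} (hJ : LogJet (frobGamma (fun k => -M.a k) 0 (lam / M.mu) (M.a i)) K c₁ c₂ c₃) :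
    ((lam / M.mu : ℝ) : ℂ) ^ (M.a i : ℂ) * (∏ k, Complex.Gamma (M.a k)) * K⁻¹ =
      rowConst M lam i := by
  rw [← hJ.apply_zero, frobGamma_infinity_eq, rowConst]
  simp only [add_zero, mul_zero, Complex.exp_zero, mul_one, Complex.Gamma_ofReal]
  rw [← Complex.ofReal_cpow (div_pos hM.lam_pos hM.mu_pos).le]
  push_cast
  rw [Finset.prod_inv_distrib, mul_inv, inv_inv]
  ring

lemma rowPoly_smul (M : Model) (ε : ℝ) (C : ℂ) (m : Fin 4 → ℂ) (u : ℂ) :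
    rowPoly M ε (C • m) u = C * rowPoly M ε m u := by
  simp only [rowPoly, Pi.smul_apply, smul_eq_mul]
  ring

/-- The kernel identity that determines the row `m` of the exponent `a_i`. -/
def IsRow (M : Model) (lam ε : ℝ) (n : Fin 4 → ℕ) (i : Fin 4) (m : Fin 4 → ℂ) : Prop :=
  ∃ γ : ℕ → ℂ, jet (frobGamma (fun k => -M.a k) 0 (lam / M.mu) (M.a i)) * PowerSeries.mk γ = 1 ∧
    ∀ u v : ℂ, v = Complex.exp (wt ε * M.a i) * u - 1 → v ≠ 0 →
      ((lam / M.mu : ℝ) : ℂ) ^ (M.a i : ℂ) * (∏ k, Complex.Gamma (M.a k)) *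
        (∏ k, (Complex.exp (wt ε * M.a k) * u - 1)) *
        ∑ j ∈ Finset.range (n i + 1), γ j * kerPoly (wt (-ε)) (n i - j) v⁻¹ =
      twoPiI * rowPoly M ε m u

/-- The row of an exponent without logarithms. -/
lemma Regular.isRow_zero {M : Model} {lam : ℝ} {n : Fin 4 → ℕ} (hM : Regular M lam n) {ε : ℝ}
    {i : Fin 4} (hn : n i = 0) {C : ℂ} (hC : (rowConst M lam i : ℂ) = C) {m : Fin 4 → ℂ} {q : ℂ → ℂ}
    (hq : ∀ u, ∏ k, (Complex.exp (wt ε * M.a k) * u - 1) =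
      (Complex.exp (wt ε * M.a i) * u - 1) * q u)
    (hm : ∀ u, -ε * q u = rowPoly M ε m u) : IsRow M lam ε n i (C • m) := by
  obtain ⟨c₂, c₃, hJ⟩ := exists_logJet (analyticAt_hypGamma (r := lam / M.mu) (hM.admissible i))
    (hypGamma_zero_ne_zero (hM.admissible i))
  obtain ⟨γ, hγ, h0, -⟩ := hM.exists_inv_jet i hJ
  have hK := hM.rowConst_eq i hJ
  refine ⟨γ, hγ, fun u v hv hv0 => ?_⟩
  rw [← h0] at hK
  rw [hq, ← hv, rowPoly_smul, ← hm, ← hC, ← hK, hn]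
  simp only [Finset.sum_range_succ, Finset.sum_range_zero, kerPoly, wt_eq]
  push_cast
  field_simp
  ring

lemma Regular.exists_logJet_infinity {M : Model} {lam : ℝ} {n : Fin 4 → ℕ} (hM : Regular M lam n)
    (i : Fin 4) : ∃ K c₂ c₃, LogJet (frobGamma (fun k => -M.a k) 0 (lam / M.mu) (M.a i)) K
      (4 * Complex.digamma (M.a i) - ∑ k, Complex.digamma ((1 + M.a i - M.a k : ℝ) : ℂ) -
        Real.log (lam / M.mu)) c₂ c₃ := by
  obtain ⟨d₂, d₃, hd⟩ := exists_logJet_Gamma (hM.a_pos i)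
  choose e₂ e₃ he using fun k => exists_logJet_Gamma (q := 1 + M.a i - M.a k)
    (by linarith [hM.a_pos i, hM.a_lt_one k])
  refine ⟨_, _, _, (((hd.pow 4).mul ((((he 0).inv.mul (he 1).inv).mul (he 2).inv).mul
    (he 3).inv)).mul (logJet_exp (-Real.log (lam / M.mu)))).congr
      (Eventually.of_forall fun s => ?_) rfl ?_ rfl rfl⟩
  · rw [frobGamma_infinity_eq, Fin.prod_univ_four]
  · rw [Fin.sum_univ_four]
    push_cast
    ring

/-- The row of the first logarithm of an exponent. -/
lemma Regular.isRow_one {M : Model} {lam : ℝ} {n : Fin 4 → ℕ} (hM : Regular M lam n) {ε : ℝ}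
    (hε : ε = 1 ∨ ε = -1) {i : Fin 4} (hn : n i = 1) {C c : ℂ} (hC : (rowConst M lam i : ℂ) = C)
    (hc : 4 * Complex.digamma (M.a i) - ∑ k, Complex.digamma ((1 + M.a i - M.a k : ℝ) : ℂ) -
        Real.log (lam / M.mu) = c) {m : Fin 4 → ℂ} {q : ℂ → ℂ}
    (hq : ∀ u, ∏ k, (Complex.exp (wt ε * M.a k) * u - 1) =
      (Complex.exp (wt ε * M.a i) * u - 1) ^ 2 * q u)
    (hm : ∀ u, q u * (twoPiI * (Complex.exp (wt ε * M.a i) * u) +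
      ε * c * (Complex.exp (wt ε * M.a i) * u - 1)) = rowPoly M ε m u) :
    IsRow M lam ε n i (C • m) := by
  obtain ⟨K, c₂, c₃, hJ⟩ := hM.exists_logJet_infinity i
  rw [hc] at hJ
  obtain ⟨γ, hγ, h0, h1, -⟩ := hM.exists_inv_jet i hJ
  have hK := hM.rowConst_eq i hJ
  have hεε : (ε : ℂ) ^ 2 = 1 := by rcases hε with rfl | rfl <;> simp
  refine ⟨γ, hγ, fun u v hv hv0 => ?_⟩
  -- In the variable `v` the double zero of the product cancels the double pole of the kernel.
  have hbu : Complex.exp (wt ε * M.a i) * u = v + 1 := by rw [hv]; ring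
  rw [hq, rowPoly_smul, ← hm, ← hC, ← hK, hn, hbu]
  simp only [Finset.sum_range_succ, Finset.sum_range_zero, kerPoly, wt_eq, h0, h1]
  push_cast
  rw [add_sub_cancel_right, ← h0]
  field_simp
  simp only [hεε]
  ring

end CYPeriods

/-! ### The exponents of the five families, and the solutions `omega` of the quintic. -/

namespace CYPeriods

open Filter Topology PowerSeries

lemma rpow_div_eq {x : ℝ} (hx : 0 ≤ x) (k m : ℕ) : x ^ (k / m : ℝ) = (x ^ (1 / m : ℝ)) ^ k := by
  rw [← Real.rpow_natCast, ← Real.rpow_mul hx]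
  congr 1
  ring

lemma regular_modelX5 : Regular modelX5 1 ![0, 0, 0, 0] where
  mu_pos := by norm_num [modelX5]
  lam_pos := one_pos
  a_pos k := by fin_cases k <;> norm_num [modelX5]
  a_lt_one k := by fin_cases k <;> norm_num [modelX5]
  sum_a := by
    simp [modelX5, Fin.sum_univ_four]
    norm_num
  inj i j := by fin_cases i <;> fin_cases j <;> norm_num [modelX5]
  lower i j hj := by fin_cases i <;> simp at hj
  n_lt i := by fin_cases i <;> simp

lemma regular_modelX43 : Regular modelX43 1 ![0, 0, 0, 0] where
  mu_pos := by norm_num [modelX43]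
  lam_pos := one_pos
  a_pos k := by fin_cases k <;> norm_num [modelX43]
  a_lt_one k := by fin_cases k <;> norm_num [modelX43]
  sum_a := by
    simp [modelX43, Fin.sum_univ_four]
    norm_num
  inj i j := by fin_cases i <;> fin_cases j <;> norm_num [modelX43]
  lower i j hj := by fin_cases i <;> simp at hj
  n_lt i := by fin_cases i <;> simp

lemma regular_modelX42 : Regular modelX42 (1 / 2 ^ 12) ![0, 0, 1, 0] where
  mu_pos := by norm_num [modelX42]
  lam_pos := by positivity
  a_pos k := by fin_cases k <;> norm_num [modelX42]
  a_lt_one k := by fin_cases k <;> norm_num [modelX42]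
  sum_a := by
    simp [modelX42, Fin.sum_univ_four]
    norm_num
  inj i j := by fin_cases i <;> fin_cases j <;> norm_num [modelX42]
  lower i j hj := by
    fin_cases i <;> simp at hj
    exact ⟨1, by simp [modelX42], by simp [hj]⟩
  n_lt i := by fin_cases i <;> simp

lemma regular_modelX44 : Regular modelX44 (1 / 2 ^ 20) ![0, 1, 0, 1] where
  mu_pos := by norm_num [modelX44]
  lam_pos := by positivity
  a_pos k := by fin_cases k <;> norm_num [modelX44]
  a_lt_one k := by fin_cases k <;> norm_num [modelX44]
  sum_a := by
    simp [modelX44, Fin.sum_univ_four]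
    norm_num
  inj i j := by fin_cases i <;> fin_cases j <;> norm_num [modelX44]
  lower i j hj := by
    fin_cases i <;> simp at hj
    · exact ⟨0, by simp [modelX44], by simp [hj]⟩
    · exact ⟨2, by simp [modelX44], by simp [hj]⟩
  n_lt i := by fin_cases i <;> simp

lemma regular_modelX2222 : Regular modelX2222 (1 / 2 ^ 16) ![0, 1, 2, 3] where
  mu_pos := by norm_num [modelX2222]
  lam_pos := by positivity
  a_pos k := by fin_cases k <;> norm_num [modelX2222]
  a_lt_one k := by fin_cases k <;> norm_num [modelX2222]
  sum_a := by
    simp [modelX2222, Fin.sum_univ_four]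
    norm_num
  inj i j := by fin_cases i <;> fin_cases j <;> norm_num [modelX2222]
  lower i j hj := by
    have hlt : j < 4 := hj.trans (by fin_cases i <;> simp)
    refine ⟨⟨j, hlt⟩, ?_, ?_⟩
    · generalize (⟨j, hlt⟩ : Fin 4) = k
      fin_cases i <;> fin_cases k <;> rfl
    · interval_cases j <;> rfl
  n_lt i := by fin_cases i <;> simp

lemma exp_wt_half : Complex.exp (wt 1 * (1 / 2)) = -1 := by
  rw [show wt 1 * (1 / 2) = Real.pi * Complex.I by rw [wt]; push_cast; ring, Complex.exp_pi_mul_I]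

lemma exp_wt_quarter : Complex.exp (wt 1 * (1 / 4)) = Complex.I := by
  rw [show wt 1 * (1 / 4) = Real.pi / 2 * Complex.I by rw [wt]; push_cast; ring,
    Complex.exp_pi_div_two_mul_I]

lemma exp_wt_three_quarters : Complex.exp (wt 1 * (3 / 4)) = -Complex.I := by
  rw [show wt 1 * (3 / 4) = wt 1 * (1 / 2) + wt 1 * (1 / 4) by ring, Complex.exp_add, exp_wt_half,
    exp_wt_quarter, neg_one_mul]

/-- With `X = i + 1`, the step from `n` to `n + 1` adds the factors `X + 5n, …, X + 5n + 4` to the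
denominator. The first is five times `X/5 + n` and cancels one of the five numerator factors; the
others are five times the factors `1 + a_i - a_k + n`. Together the fives give `5 ^ 5 = 1 / μ`. -/
lemma omega_coeff_eq (i : Fin 4) (n : ℕ) : (ascPochhammer ℂ n).eval (((i : ℕ) + 1 : ℂ) / 5) ^ 5 /
      (ascPochhammer ℂ (5 * n)).eval ((i : ℕ) + 1 : ℂ) =
    hypRatio (fun k => modelX5.a i + (0 : Fin 4 → ℝ) k) (fun k => 1 + modelX5.a i + -modelX5.a k)
      (1 / modelX5.mu) n 0 := by
  have ha : (modelX5.a i : ℂ) = ((i : ℕ) + 1 : ℂ) / 5 := by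
    fin_cases i <;> simp [modelX5] <;> norm_num
  have hne : ∀ m : ℕ, ((i : ℕ) + 1 + m : ℂ) ≠ 0 := fun m => by
    exact_mod_cast (by omega : (i : ℕ) + 1 + m ≠ 0)
  have hasc : ∀ m : ℕ, (ascPochhammer ℂ m).eval ((i : ℕ) + 1 : ℂ) ≠ 0 := fun m => by
    induction m with
    | zero => simp
    | succ m ih =>
      rw [ascPochhammer_succ_eval]
      exact mul_ne_zero ih (hne m)
  induction n with
  | zero => simp [hypRatio]
  | succ n ih =>
    have h5 : 5 * (n + 1) = 5 * n + 1 + 1 + 1 + 1 + 1 := by ring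
    have hp : ∀ c : ℝ, ((1 + modelX5.a i + -c : ℝ) : ℂ) + n + 0 =
        ((i : ℕ) + 1 + 5 * n + 5 - 5 * c) / 5 := fun c => by
      push_cast
      rw [ha]
      ring
    rw [hypRatio, Finset.prod_range_succ, ← hypRatio, ← ih, h5]
    simp only [ascPochhammer_succ_eval, Fin.prod_univ_four, hp, Pi.zero_apply, add_zero, ha]
    have hh := fun j : ℕ => hne (5 * n + j)
    have e0 := hh 0
    have e1 := hh 1
    have e2 := hh 2
    have e3 := hh 3
    have e4 := hh 4
    have hp0 := hasc (5 * n)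
    have a0 : modelX5.a 0 = 1 / 5 := rfl
    have a1 : modelX5.a 1 = 2 / 5 := rfl
    have a2 : modelX5.a 2 = 3 / 5 := rfl
    have a3 : modelX5.a 3 = 4 / 5 := rfl
    have hmu : modelX5.mu = 1 / 5 ^ 5 := rfl
    rw [a0, a1, a2, a3, hmu]
    generalize (ascPochhammer ℂ (5 * n)).eval ((i : ℕ) + 1 : ℂ) = P at hp0 ⊢
    generalize (ascPochhammer ℂ n).eval (((i : ℕ) + 1 : ℂ) / 5) = Q
    push_cast at e0 e1 e2 e3 e4 ⊢
    generalize ((i : ℕ) + 1 : ℂ) = X at *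
    generalize (n : ℂ) = N at *
    have f0 : X + 5 * N ≠ 0 := by simpa using e0
    have g1 : X + 5 * N + 1 ≠ 0 := by rwa [add_assoc]
    have g2 : X + 5 * N + 2 ≠ 0 := by rwa [add_assoc]
    have g3 : X + 5 * N + 3 ≠ 0 := by rwa [add_assoc]
    have g4 : X + 5 * N + 4 ≠ 0 := by rwa [add_assoc]
    rw [show X + 5 * N + 5 - 5 * (1 / 5) = X + 5 * N + 4 by ring,
      show X + 5 * N + 5 - 5 * (2 / 5) = X + 5 * N + 3 by ring,
      show X + 5 * N + 5 - 5 * (3 / 5) = X + 5 * N + 2 by ring,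
      show X + 5 * N + 5 - 5 * (4 / 5) = X + 5 * N + 1 by ring,
      show X + (5 * N + 1) = X + 5 * N + 1 by ring,
      show X + (5 * N + 2) = X + 5 * N + 2 by ring,
      show X + (5 * N + 3) = X + 5 * N + 3 by ring,
      show X + (5 * N + 4) = X + 5 * N + 4 by ring,
      show X / 5 + N = (X + 5 * N) / 5 by ring]
    clear e0 e1 e2 e3 e4 hh hne hasc
    field_simp

lemma omega_eq (i : Fin 4) (z : ℂ) : omega i z =
    logSeries (modelX5.a i) (frobSeries (fun k => -modelX5.a k) 0 (1 / modelX5.mu) (modelX5.a i)) 0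
      ((1 : ℝ) / z) := by
  have ha : (modelX5.a i : ℂ) = ((i : ℕ) + 1 : ℂ) / 5 := by
    fin_cases i <;> simp [modelX5] <;> norm_num
  rw [omega, logSeries, ha, Finset.sum_range_one, frobSeries, ser]
  simp only [omega_coeff_eq, frobCoeff, coeff_zero_jet, Complex.ofReal_one, one_div, pow_zero,
    Nat.sub_zero, Nat.factorial_zero, Nat.cast_one, mul_one, div_one]

lemma isBasisAtInfinity_omega : IsBasisAtInfinity modelX5 1 ![0, 0, 0, 0] omega :=
  regular_modelX5.isBasisAtInfinity fun i z _ _ => by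
    rw [omega_eq]
    congr 1
    fin_cases i <;> rfl

end CYPeriods

/-! ### The rows of `X_{4,2}` and `X_{4,4}`. -/

namespace CYPeriods

open Filter Topology PowerSeries

lemma rpow_div_of_pow_eq {x y : ℝ} (hy : 0 ≤ y) {m : ℕ} (hm : m ≠ 0) (k : ℕ) (h : y ^ m = x) :
    x ^ (k / m : ℝ) = y ^ k := by
  rw [← h, ← Real.rpow_natCast, ← Real.rpow_mul hy, ← Real.rpow_natCast]
  congr 1
  field_simp

lemma Gamma_quarter_mul : Real.Gamma (1 / 4) * Real.Gamma (3 / 4) = Real.pi * √2 := by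
  have h := Real.Gamma_mul_Gamma_one_sub (1 / 4)
  rw [show (1 : ℝ) - 1 / 4 = 3 / 4 by norm_num, show Real.pi * (1 / 4) = Real.pi / 4 by ring,
    Real.sin_pi_div_four] at h
  rw [h]
  have h2 : √2 * √2 = (2 : ℝ) := Real.mul_self_sqrt (by norm_num)
  have h3 : √2 ≠ (0 : ℝ) := by positivity
  field_simp
  linarith

lemma sqrt_pi_sq : √Real.pi ^ 2 = Real.pi := Real.sq_sqrt Real.pi_pos.le

lemma sqrt_two_sq : (√2 : ℝ) ^ 2 = 2 := Real.sq_sqrt (by norm_num)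

lemma pi_rpow_half (k : ℕ) : Real.pi ^ (k / 2 : ℝ) = √Real.pi ^ k := by
  have := rpow_div_of_pow_eq (Real.sqrt_nonneg Real.pi) two_ne_zero k sqrt_pi_sq
  exact_mod_cast this

lemma Gamma_five_quarters : Real.Gamma (5 / 4) = Real.Gamma (1 / 4) / 4 := by
  rw [show (5 / 4 : ℝ) = 1 / 4 + 1 by norm_num, Real.Gamma_add_one (by norm_num)]
  ring

lemma Gamma_three_halves : Real.Gamma (3 / 2) = √Real.pi / 2 := by
  rw [show (3 / 2 : ℝ) = 1 / 2 + 1 by norm_num, Real.Gamma_add_one (by norm_num),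
    Real.Gamma_one_half_eq]
  ring

lemma negOnePow_eq (s : ℝ) :
    negOnePow s = Real.cos (Real.pi * s) + Real.sin (Real.pi * s) * Complex.I := by
  rw [negOnePow, show (Real.pi * Complex.I * s : ℂ) = ((Real.pi * s : ℝ) : ℂ) * Complex.I by
    push_cast; ring, Complex.exp_mul_I, Complex.ofReal_cos, Complex.ofReal_sin]

lemma exp_wt_modelX42 (k : Fin 4) : Complex.exp (wt 1 * modelX42.a k) =
    (![Complex.I, -1, -1, -Complex.I] : Fin 4 → ℂ) k := by
  have h1 := exp_wt_quarter
  have h2 := exp_wt_half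
  have h3 := exp_wt_three_quarters
  fin_cases k <;> simp [modelX42] at h1 h2 h3 ⊢ <;> assumption

lemma prod_modelX42 (u : ℂ) :
    ∏ k, (Complex.exp (wt 1 * modelX42.a k) * u - 1) = (u + 1) ^ 2 * (u ^ 2 + 1) := by
  simp only [exp_wt_modelX42, Fin.prod_univ_four]
  simp
  linear_combination (-(u + 1) ^ 2 * u ^ 2) * Complex.I_sq

lemma Gamma_quarter_ne_zero : Real.Gamma (1 / 4) ≠ 0 := (Real.Gamma_pos_of_pos (by norm_num)).ne'

lemma Gamma_three_quarters_ne_zero : Real.Gamma (3 / 4) ≠ 0 :=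
  (Real.Gamma_pos_of_pos (by norm_num)).ne'

/-- This form and `Gamma_quarter_eq` eliminate one of the two values, according to which of them the
constant of the row is written in. -/
lemma Gamma_three_quarters_eq :
    Real.Gamma (3 / 4) = √Real.pi ^ 2 * √2 / Real.Gamma (1 / 4) := by
  rw [eq_div_iff Gamma_quarter_ne_zero, mul_comm, Gamma_quarter_mul, sqrt_pi_sq]

lemma Gamma_quarter_eq : Real.Gamma (1 / 4) = √Real.pi ^ 2 * √2 / Real.Gamma (3 / 4) := by
  rw [eq_div_iff Gamma_three_quarters_ne_zero, Gamma_quarter_mul, sqrt_pi_sq]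

lemma quarter_rpow (k : ℕ) : (1 / 2 ^ 12 / (1 / 2 ^ 10) : ℝ) ^ (k / 4 : ℝ) = (√2)⁻¹ ^ k := by
  have h := rpow_div_of_pow_eq (x := 1 / 2 ^ 12 / (1 / 2 ^ 10)) (y := (√2)⁻¹) (by positivity)
    (m := 4) (by norm_num) k (by
      rw [inv_pow, show (√2 : ℝ) ^ 4 = (√2 ^ 2) ^ 2 by ring, sqrt_two_sq]; norm_num)
  exact_mod_cast h

lemma rowConst_modelX42_zero :
    rowConst modelX42 (1 / 2 ^ 12) 0 = 2 * Real.pi ^ (9 / 2 : ℝ) / Real.Gamma (1 / 4) ^ 6 := by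
  have hr := quarter_rpow 1
  have h9 := pi_rpow_half 9
  have hx := Gamma_quarter_ne_zero
  push_cast at hr h9
  simp only [rowConst, modelX42, Fin.prod_univ_four]
  simp only [Matrix.cons_val]
  rw [hr, h9]
  norm_num
  rw [Real.Gamma_one_half_eq, Gamma_three_quarters_eq]
  generalize Real.Gamma (1 / 4) = x at hx ⊢
  field_simp
  exact sqrt_two_sq

lemma rowConst_modelX42_three :
    rowConst modelX42 (1 / 2 ^ 12) 3 = Real.pi ^ (9 / 2 : ℝ) / (32 * Real.Gamma (3 / 4) ^ 6) := by
  have hr := quarter_rpow 3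
  have h9 := pi_rpow_half 9
  have hx := Gamma_three_quarters_ne_zero
  push_cast at hr h9
  simp only [rowConst, modelX42, Fin.prod_univ_four]
  simp only [Matrix.cons_val]
  rw [hr, h9]
  norm_num
  rw [Real.Gamma_one_half_eq, Gamma_five_quarters, Gamma_three_halves, Gamma_quarter_eq]
  generalize Real.Gamma (3 / 4) = x at hx ⊢
  field_simp
  norm_num

lemma rowConst_modelX42_half {i : Fin 4} (hi : modelX42.a i = 1 / 2) :
    rowConst modelX42 (1 / 2 ^ 12) i = Real.pi / 4 := by
  have hr := quarter_rpow 2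
  have hx := Gamma_quarter_ne_zero
  push_cast at hr
  rw [show (2 / 4 : ℝ) = 1 / 2 by norm_num, inv_pow, sqrt_two_sq] at hr
  rw [rowConst, hi]
  simp only [modelX42, Fin.prod_univ_four]
  simp only [Matrix.cons_val]
  rw [hr]
  norm_num
  rw [Real.Gamma_one_half_eq, Gamma_five_quarters, Gamma_three_quarters_eq, ← sqrt_pi_sq]
  generalize Real.Gamma (1 / 4) = x at hx ⊢
  rw [Real.sqrt_sq (Real.sqrt_nonneg _)]
  field_simp
  rw [sqrt_two_sq]

lemma ofReal_log_two : ((Real.log 2 : ℝ) : ℂ) = Complex.log 2 := by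
  rw [Complex.ofReal_log zero_le_two, Complex.ofReal_ofNat]

lemma digamma_half :
    Complex.digamma (1 / 2) = -2 * Real.log 2 - Real.eulerMascheroniConstant := by
  rw [Complex.digamma_one_half, ofReal_log_two]

lemma digamma_five_quarters : Complex.digamma (5 / 4) = Complex.digamma (1 / 4) + 4 := by
  rw [show (5 / 4 : ℂ) = 1 / 4 + 1 by norm_num, Complex.digamma_apply_add_one _ fun m hm => ?_]
  · norm_num
  · have h := congrArg Complex.re hm
    have hm0 : (0 : ℝ) ≤ m := m.cast_nonneg
    norm_num at h
    linarith

lemma digamma_three_halves : Complex.digamma (3 / 2) = Complex.digamma (1 / 2) + 2 := by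
  rw [show (3 / 2 : ℂ) = 1 / 2 + 1 by norm_num, Complex.digamma_apply_add_one _ fun m hm => ?_]
  · norm_num
  · have h := congrArg Complex.re hm
    have hm0 : (0 : ℝ) ≤ m := m.cast_nonneg
    norm_num at h
    linarith

lemma isRow_modelX42_zero : IsRow modelX42 (1 / 2 ^ 12) 1 ![0, 0, 1, 0] 0 (matX42 0) := by
  have hI := Complex.I_sq
  have h2 : ((√2 : ℝ) : ℂ) ^ 2 = 2 := by exact_mod_cast sqrt_two_sq
  have e : negOnePow (1 / 4) * rpw 2 (1 / 2) = 1 + Complex.I := by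
    rw [negOnePow_eq, show Real.pi * (1 / 4) = Real.pi / 4 by ring, Real.cos_pi_div_four,
      Real.sin_pi_div_four, rpw, ← Real.sqrt_eq_rpow]
    push_cast
    linear_combination (1 + Complex.I) / 2 * h2
  rw [show matX42 0 = (2 * rpw Real.pi (9 / 2) / gam (1 / 4) ^ 6) •
      ![(1 + Complex.I) / 2, 1 / 2, -1, -2 * Complex.I] by
    ext j
    fin_cases j <;> simp [matX42]
    · rw [one_div, one_div] at e
      rw [e]
      ring
    all_goals ring]
  -- `q` is the product without the factor `I u - 1`, by `u² + 1 = -(I u - 1)(I u + 1)`.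
  refine regular_modelX42.isRow_zero rfl ?_
    (q := fun u => -(Complex.I * u + 1) * (u + 1) ^ 2) ?_ ?_
  · rw [rowConst_modelX42_zero, rpw, gam]
    push_cast
    rfl
  · intro u
    rw [prod_modelX42, exp_wt_modelX42]
    simp
    linear_combination (u + 1) ^ 2 * u ^ 2 * hI
  · intro u
    simp [rowPoly, sigma, modelX42]
    ring

lemma isRow_modelX42_one : IsRow modelX42 (1 / 2 ^ 12) 1 ![0, 0, 1, 0] 1 (matX42 1) := by
  rw [show matX42 1 = ((Real.pi / 4 : ℝ) : ℂ) • ![1 / 2, 1 / 4, -1, 0] by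
    ext j
    fin_cases j <;> simp [matX42] <;> ring]
  refine regular_modelX42.isRow_zero rfl ?_ (q := fun u => -(u + 1) * (u ^ 2 + 1)) ?_ ?_
  · rw [rowConst_modelX42_half rfl]
  · intro u
    rw [prod_modelX42, exp_wt_modelX42]
    simp
    ring
  · intro u
    simp [rowPoly, sigma, modelX42]
    ring

lemma isRow_modelX42_two : IsRow modelX42 (1 / 2 ^ 12) 1 ![0, 0, 1, 0] 2 (matX42 2) := by
  have hI := Complex.I_sq
  rw [show matX42 2 = ((Real.pi / 4 : ℝ) : ℂ) • ![(4 - Complex.I * Real.pi) / 2, 1, -4,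
      Complex.I * Real.pi] by
    ext j
    fin_cases j <;> simp [matX42] <;> ring]
  -- The `4` stems from `ψ(5/4) = ψ(1/4) + 4`. The terms `π/2` cancel in `ψ(1/4) + ψ(3/4)`, and the
  -- scale `2^{12}` of the coordinate cancels `log 2`.
  refine regular_modelX42.isRow_one (.inl rfl) rfl ?_ (c := -4) ?_ (q := fun u => u ^ 2 + 1) ?_ ?_
  · rw [rowConst_modelX42_half rfl]
  · obtain ⟨h1, h3⟩ := digamma_quarters
    have h5 := digamma_five_quarters
    have hh := digamma_half
    have hr : Real.log (1 / 2 ^ 12 / modelX42.mu) = -(2 * Real.log 2) := by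
      rw [show 1 / 2 ^ 12 / modelX42.mu = 1 / 2 ^ 2 by norm_num [modelX42], log_one_div_pow]
      norm_num
    rw [hr, Fin.sum_univ_four]
    simp only [modelX42]
    simp only [Matrix.cons_val]
    norm_num
    rw [Complex.digamma_one, ← ofReal_log_two]
    linear_combination 4 * hh - h5 - h1 - h3
  · intro u
    rw [prod_modelX42, exp_wt_modelX42]
    simp
    exact Or.inl (by ring)
  · intro u
    rw [exp_wt_modelX42]
    simp [rowPoly, sigma, modelX42, twoPiI]
    ring

lemma isRow_modelX42_three : IsRow modelX42 (1 / 2 ^ 12) 1 ![0, 0, 1, 0] 3 (matX42 3) := by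
  have hI := Complex.I_sq
  rw [show matX42 3 = (rpw Real.pi (9 / 2) / (32 * gam (3 / 4) ^ 6)) •
      ![(1 - Complex.I) / 2, 1 / 2, -1, 2 * Complex.I] by
    ext j
    fin_cases j <;> simp [matX42] <;> ring]
  refine regular_modelX42.isRow_zero rfl ?_
    (q := fun u => (Complex.I * u - 1) * (u + 1) ^ 2) ?_ ?_
  · rw [rowConst_modelX42_three, rpw, gam]
    push_cast
    rfl
  · intro u
    rw [prod_modelX42, exp_wt_modelX42]
    simp
    linear_combination (u + 1) ^ 2 * u ^ 2 * hI
  · intro u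
    simp [rowPoly, sigma, modelX42]
    ring

lemma exp_wt_modelX44 (k : Fin 4) : Complex.exp (wt 1 * modelX44.a k) =
    (![Complex.I, Complex.I, -Complex.I, -Complex.I] : Fin 4 → ℂ) k := by
  have h1 := exp_wt_quarter
  have h3 := exp_wt_three_quarters
  fin_cases k <;> simp [modelX44] at h1 h3 ⊢ <;> assumption

lemma prod_modelX44 (u : ℂ) : ∏ k, (Complex.exp (wt 1 * modelX44.a k) * u - 1) =
    (Complex.I * u - 1) ^ 2 * (Complex.I * u + 1) ^ 2 := by
  simp only [exp_wt_modelX44, Fin.prod_univ_four]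
  simp
  ring

lemma rowConst_modelX44_quarter {i : Fin 4} (hi : modelX44.a i = 1 / 4) :
    rowConst modelX44 (1 / 2 ^ 20) i = Real.pi ^ 3 / (2 * Real.Gamma (1 / 4) ^ 4) := by
  have hr := rpow_div_of_pow_eq (x := 1 / 2 ^ 20 / (1 / 2 ^ 12)) (y := 1 / 4) (by positivity)
    (m := 4) (by norm_num) 1 (by norm_num)
  have hx := Gamma_quarter_ne_zero
  push_cast at hr
  rw [rowConst, hi]
  simp only [modelX44, Fin.prod_univ_four]
  simp only [Matrix.cons_val]
  rw [hr]
  norm_num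
  rw [Real.Gamma_one_half_eq, Gamma_three_quarters_eq, ← sqrt_pi_sq]
  generalize Real.Gamma (1 / 4) = x at hx ⊢
  rw [Real.sqrt_sq (Real.sqrt_nonneg _)]
  field_simp
  rw [sqrt_two_sq]
  norm_num

lemma rowConst_modelX44_three_quarters {i : Fin 4} (hi : modelX44.a i = 3 / 4) :
    rowConst modelX44 (1 / 2 ^ 20) i = Real.pi ^ 3 / (128 * Real.Gamma (3 / 4) ^ 4) := by
  have hr := rpow_div_of_pow_eq (x := 1 / 2 ^ 20 / (1 / 2 ^ 12)) (y := 1 / 4) (by positivity)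
    (m := 4) (by norm_num) 3 (by norm_num)
  have hx := Gamma_three_quarters_ne_zero
  push_cast at hr
  rw [rowConst, hi]
  simp only [modelX44, Fin.prod_univ_four]
  simp only [Matrix.cons_val]
  rw [hr]
  norm_num
  rw [Gamma_three_halves, Gamma_quarter_eq, ← sqrt_pi_sq]
  generalize Real.Gamma (3 / 4) = x at hx ⊢
  rw [Real.sqrt_sq (Real.sqrt_nonneg _)]
  field_simp
  rw [sqrt_two_sq]
  norm_num

lemma log_modelX44 : Real.log (1 / 2 ^ 20 / modelX44.mu) = -(8 * Real.log 2) := by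
  rw [show 1 / 2 ^ 20 / modelX44.mu = 1 / 2 ^ 8 by norm_num [modelX44], log_one_div_pow]
  norm_num

lemma isRow_modelX44_zero : IsRow modelX44 (1 / 2 ^ 20) 1 ![0, 1, 0, 1] 0 (matX44 0) := by
  have hI := Complex.I_sq
  rw [show matX44 0 = (Real.pi ^ 3 / (2 * gam (1 / 4) ^ 4)) •
      ![(1 + Complex.I) / 2, 1 / 2, -1, -Complex.I] by
    ext j
    fin_cases j <;> simp [matX44] <;> ring]
  refine regular_modelX44.isRow_zero rfl ?_
    (q := fun u => (Complex.I * u - 1) * (Complex.I * u + 1) ^ 2) ?_ ?_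
  · rw [rowConst_modelX44_quarter rfl, gam]
    push_cast
    rfl
  · intro u
    rw [prod_modelX44, exp_wt_modelX44]
    simp
    ring
  · intro u
    simp [rowPoly, sigma, modelX44]
    linear_combination (-u ^ 3 * Complex.I - u ^ 2) * hI

lemma isRow_modelX44_one : IsRow modelX44 (1 / 2 ^ 20) 1 ![0, 1, 0, 1] 1 (matX44 1) := by
  have hI := Complex.I_sq
  rw [show matX44 1 = (Real.pi ^ 3 / (2 * gam (1 / 4) ^ 4)) •
      ![(Real.pi : ℂ), 0, -2 * Real.pi, 2 * Complex.I * Real.pi] by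
    ext j
    fin_cases j <;> simp [matX44] <;> ring]
  -- `4 ψ(1/4)` leaves `-2π`; the scale `2^{20}` of the coordinate removes `log 2`.
  refine regular_modelX44.isRow_one (.inl rfl) rfl ?_ (c := -2 * Real.pi) ?_
    (q := fun u => (Complex.I * u + 1) ^ 2) ?_ ?_
  · rw [rowConst_modelX44_quarter rfl, gam]
    push_cast
    rfl
  · have h1 := digamma_quarters.1
    have hh := digamma_half
    rw [log_modelX44, Fin.sum_univ_four]
    simp only [modelX44]
    simp only [Matrix.cons_val]
    norm_num
    rw [Complex.digamma_one, ← ofReal_log_two]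
    linear_combination 4 * h1 - 2 * hh
  · intro u
    rw [prod_modelX44, exp_wt_modelX44]
    rfl
  · intro u
    rw [exp_wt_modelX44]
    simp [rowPoly, sigma, modelX44, twoPiI]
    ring_nf
    simp [hI]
    ring

lemma isRow_modelX44_two : IsRow modelX44 (1 / 2 ^ 20) 1 ![0, 1, 0, 1] 2 (matX44 2) := by
  have hI := Complex.I_sq
  rw [show matX44 2 = (Real.pi ^ 3 / (128 * gam (3 / 4) ^ 4)) •
      ![(1 - Complex.I) / 2, 1 / 2, -1, Complex.I] by
    ext j
    fin_cases j <;> simp [matX44] <;> ring]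
  refine regular_modelX44.isRow_zero rfl ?_
    (q := fun u => -(Complex.I * u - 1) ^ 2 * (Complex.I * u + 1)) ?_ ?_
  · rw [rowConst_modelX44_three_quarters rfl, gam]
    push_cast
    rfl
  · intro u
    rw [prod_modelX44, exp_wt_modelX44]
    simp
    ring
  · intro u
    simp [rowPoly, sigma, modelX44]
    linear_combination (u ^ 3 * Complex.I - u ^ 2) * hI

lemma isRow_modelX44_three : IsRow modelX44 (1 / 2 ^ 20) 1 ![0, 1, 0, 1] 3 (matX44 3) := by
  have hI := Complex.I_sq
  rw [show matX44 3 = (Real.pi ^ 3 / (128 * gam (3 / 4) ^ 4)) •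
      ![(2 - 2 * Complex.I) - Real.pi, 2, 2 * (Real.pi - 2), 2 * Complex.I * (2 + Real.pi)] by
    ext j
    fin_cases j <;> simp [matX44] <;> ring]
  -- `4 ψ(3/4)` gives `2π`, and `ψ(3/2) = ψ(1/2) + 2`, which occurs twice, gives `-4`.
  refine regular_modelX44.isRow_one (.inl rfl) rfl ?_ (c := 2 * Real.pi - 4) ?_
    (q := fun u => (Complex.I * u - 1) ^ 2) ?_ ?_
  · rw [rowConst_modelX44_three_quarters rfl, gam]
    push_cast
    rfl
  · have h3 := digamma_quarters.2
    have hh := digamma_half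
    have h5 := digamma_three_halves
    rw [log_modelX44, Fin.sum_univ_four]
    simp only [modelX44]
    simp only [Matrix.cons_val]
    norm_num
    rw [Complex.digamma_one, ← ofReal_log_two]
    linear_combination 4 * h3 - 2 * hh - 2 * h5
  · intro u
    rw [prod_modelX44, exp_wt_modelX44]
    simp
    ring
  · intro u
    rw [exp_wt_modelX44]
    simp [rowPoly, sigma, modelX44, twoPiI]
    ring_nf
    simp [hI]
    ring

end CYPeriods

/-! ### The rows of `X_{2,2,2,2}`. -/

namespace CYPeriods

open Filter Topology PowerSeries

lemma exp_wt_modelX2222 (k : Fin 4) : Complex.exp (wt 1 * modelX2222.a k) = -1 := by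
  have h2 := exp_wt_half
  fin_cases k <;> simp [modelX2222] at h2 ⊢ <;> assumption

lemma rowConst_modelX2222 (i : Fin 4) : rowConst modelX2222 (1 / 2 ^ 16) i = 1 / 16 := by
  have hr := rpow_div_of_pow_eq (x := 1 / 2 ^ 16 / (1 / 2 ^ 8)) (y := 1 / 16) (by positivity)
    (m := 2) (by norm_num) 1 (by norm_num)
  push_cast at hr
  have hi : modelX2222.a i = 1 / 2 := by fin_cases i <;> rfl
  rw [rowConst, hi]
  simp only [modelX2222, Fin.prod_univ_four]
  simp only [Matrix.cons_val]
  rw [hr]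
  norm_num
  rw [Real.Gamma_one_half_eq]
  have : √Real.pi ≠ 0 := by positivity
  field_simp

/-- All exponents are `1/2`, so the quotient is `2^{8s} (Γ(1/2 + s) / Γ(1 + s))^4`. The scale
`2^{16}` of the coordinate makes the linear term vanish; only `ζ(2)` and `ζ(3)` remain. -/
lemma logJet_modelX2222 (i : Fin 4) :
    LogJet (frobGamma (fun k => -modelX2222.a k) 0 (1 / 2 ^ 16 / modelX2222.mu) (modelX2222.a i))
      (Complex.Gamma (1 / 2) ^ 4) 0 (4 * riemannZeta 2) (-8 * riemannZeta 3) := by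
  have ha : ∀ k, modelX2222.a k = 1 / 2 := fun k => by fin_cases k <;> rfl
  have hr : Real.log (1 / 2 ^ 16 / modelX2222.mu) = -(8 * Real.log 2) := by
    rw [show 1 / 2 ^ 16 / modelX2222.mu = 1 / 2 ^ 8 by norm_num [modelX2222], log_one_div_pow]
    norm_num
  refine (((logJet_Gamma_half.pow 4).mul (logJet_Gamma_one_add.inv.pow 4)).mul
    (logJet_exp (8 * Real.log 2))).congr (Eventually.of_forall fun s => ?_) (by simp) ?_ ?_ ?_
  · rw [frobGamma_infinity_eq, hr]
    simp only [ha, Finset.prod_const, Finset.card_univ, Fintype.card_fin]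
    norm_num
  · push_cast
    ring
  · push_cast
    ring
  · push_cast
    ring

lemma isRow_modelX2222 (i : Fin 4) :
    IsRow modelX2222 (1 / 2 ^ 16) 1 ![0, 1, 2, 3] i (matX2222 i) := by
  obtain ⟨γ, hγ, h0, h1, h2, h3⟩ := regular_modelX2222.exists_inv_jet i (logJet_modelX2222 i)
  have hK := regular_modelX2222.rowConst_eq i (logJet_modelX2222 i)
  rw [rowConst_modelX2222] at hK
  refine ⟨γ, hγ, fun u v hv hv0 => ?_⟩
  have hu : u = -(v + 1) := by
    rw [hv, exp_wt_modelX2222]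
    ring
  -- The fourfold zero cancels the poles of all four kernels at once.
  have hprod : ∏ k, (Complex.exp (wt 1 * modelX2222.a k) * u - 1) = v ^ 4 := by
    simp only [exp_wt_modelX2222, Fin.prod_univ_four, hu]
    ring
  have hI := Complex.I_sq
  rw [hprod]
  generalize ((1 / 2 ^ 16 / modelX2222.mu : ℝ) : ℂ) ^ (modelX2222.a i : ℂ) *
    (∏ k, Complex.Gamma (modelX2222.a k)) = A at hK ⊢
  generalize (Complex.Gamma (1 / 2) ^ 4)⁻¹ = K' at *
  push_cast at hK
  rw [riemannZeta_two] at h2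
  have g0 : A * γ 0 = 1 / 16 := by rw [h0, hK]
  have g1 : A * γ 1 = 0 := by
    rw [h1]
    ring
  have g2 : A * γ 2 = -Real.pi ^ 2 / 24 := by
    rw [h2]
    linear_combination (-4 * (Real.pi ^ 2 / 6)) * hK
  have g3 : A * γ 3 = riemannZeta 3 / 2 := by
    rw [h3]
    linear_combination (8 * riemannZeta 3) * hK
  have hI3 : Complex.I ^ 3 = -Complex.I := by rw [pow_succ, hI]; ring
  have hI4 : Complex.I ^ 4 = 1 := Complex.I_pow_four
  have hsum : ∀ (w : ℂ) (N : ℕ), A * v ^ 4 * ∑ j ∈ Finset.range (N + 1), γ j * kerPoly w (N - j) v⁻¹ =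
      v ^ 4 * ∑ j ∈ Finset.range (N + 1), A * γ j * kerPoly w (N - j) v⁻¹ := fun w N => by
    rw [mul_comm A, mul_assoc, Finset.mul_sum]
    simp only [mul_assoc]
  rw [hsum]
  clear hsum h0 h1 h2 h3 hK hv hprod hγ
  fin_cases i <;>
  simp [Finset.sum_range_succ, kerPoly, rowPoly, matX2222, modelX2222, sigma, wt, twoPiI, g0, g1,
    g2, g3, hu]
  all_goals
    field_simp
    try simp only [hI]
    ring

end CYPeriods

/-! ### The kernel identity of the quintic. -/

namespace CYPeriods

open Filter Topology PowerSeries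

lemma alpha_isPrimitiveRoot : IsPrimitiveRoot alpha 5 := by
  have h := Complex.isPrimitiveRoot_exp 5 (by norm_num)
  rwa [Nat.cast_ofNat] at h

lemma alpha_cyclotomic : 1 + alpha + alpha ^ 2 + alpha ^ 3 + alpha ^ 4 = 0 := by
  have h := alpha_isPrimitiveRoot.geom_sum_eq_zero (by norm_num)
  simpa [Finset.sum_range_succ] using h

lemma exp_wt_modelX5 (k : Fin 4) :
    Complex.exp (wt (-1) * modelX5.a k) = (alpha ^ ((k : ℕ) + 1))⁻¹ := by
  rw [alpha, ← Complex.exp_nat_mul, ← Complex.exp_neg]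
  congr 1
  fin_cases k <;> simp [modelX5, wt] <;> ring

/-- The four exponentials are the primitive fifth roots of unity, so the product is the fifth
cyclotomic polynomial. -/
lemma prod_modelX5 (u : ℂ) :
    ∏ k, (Complex.exp (wt (-1) * modelX5.a k) * u - 1) = 1 + u + u ^ 2 + u ^ 3 + u ^ 4 := by
  have h := alpha_cyclotomic
  have h5 := alpha_isPrimitiveRoot.pow_eq_one
  have i1 : (alpha ^ 1)⁻¹ = alpha ^ 4 := inv_eq_of_mul_eq_one_right (by rw [← h5]; ring)
  have i2 : (alpha ^ 2)⁻¹ = alpha ^ 3 := inv_eq_of_mul_eq_one_right (by rw [← h5]; ring)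
  have i3 : (alpha ^ 3)⁻¹ = alpha ^ 2 := inv_eq_of_mul_eq_one_right (by rw [← h5]; ring)
  have i4 : (alpha ^ 4)⁻¹ = alpha := inv_eq_of_mul_eq_one_right (by rw [← h5]; ring)
  simp only [exp_wt_modelX5, Fin.prod_univ_four]
  simp only [Fin.val_zero, Fin.val_one, Fin.val_two, zero_add, Nat.reduceAdd, i1, i2,
    show ((3 : Fin 4) : ℕ) = 3 from rfl, i3, i4]
  generalize alpha = g at *
  clear i1 i2 i3 i4
  grind

lemma isRow_modelX5 (i : Fin 4) {β C : ℂ} (hβ : alpha ^ ((i : ℕ) + 1) = β)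
    (hC : (rowConst modelX5 1 i : ℂ) = C) :
    IsRow modelX5 1 (-1) ![0, 0, 0, 0] i
      (C • ![-β / (β - 1), -β / (β - 1) ^ 2, -1, β * (2 * β + 3) / (1 - β) ^ 3]) := by
  have h5 : β ^ 5 = 1 := by
    rw [← hβ, ← pow_mul, mul_comm, pow_mul, alpha_isPrimitiveRoot.pow_eq_one, one_pow]
  have h1 : β - 1 ≠ 0 := by
    rw [← hβ]
    exact sub_ne_zero.2 (alpha_isPrimitiveRoot.pow_ne_one_of_pos_of_lt (by omega) (by omega))
  have h : 1 + β + β ^ 2 + β ^ 3 + β ^ 4 = 0 :=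
    mul_left_cancel₀ h1 (by linear_combination h5)
  have hinv : β⁻¹ = β ^ 4 := inv_eq_of_mul_eq_one_right (by rw [← h5]; ring)
  -- Horner division of the cyclotomic polynomial by `β⁻¹ u - 1`, which vanishes at `u = β`.
  refine regular_modelX5.isRow_zero (by fin_cases i <;> rfl) hC (q := fun u =>
    β * (u ^ 3 + (1 + β) * u ^ 2 + (1 + β + β ^ 2) * u + (1 + β + β ^ 2 + β ^ 3))) ?_ ?_
  · intro u
    rw [prod_modelX5, exp_wt_modelX5, hβ, hinv]
    clear hβ hinv hC
    grind
  · intro u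
    -- Modulo the cyclotomic relation the inverse is a polynomial in `β`, so the claim contains no
    -- denominators in `β`.
    have hw : (β - 1)⁻¹ = -(4 + 3 * β + 2 * β ^ 2 + β ^ 3) / 5 :=
      inv_eq_of_mul_eq_one_right (by linear_combination -(1 / 5) * h)
    have hw' : (1 - β)⁻¹ = (4 + 3 * β + 2 * β ^ 2 + β ^ 3) / 5 :=
      inv_eq_of_mul_eq_one_right (by linear_combination (-1 / 5) * h)
    simp [rowPoly, modelX5, sigma, div_eq_mul_inv, ← inv_pow, hw, hw']
    clear hβ hinv hC hw hw'
    grind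

end CYPeriods

/-! ### The leading constants of the quintic. -/

namespace CYPeriods

open Filter Topology PowerSeries

/-- Reflection pairs `1/5` with `4/5` and `2/5` with `3/5`; the sines contribute `sin² (π/5) sin²
(2π/5) = 5/16`. -/
lemma prod_Gamma_fifths_sq :
    (Real.Gamma (1 / 5) * Real.Gamma (2 / 5) * Real.Gamma (3 / 5) * Real.Gamma (4 / 5)) ^ 2 =
      16 * Real.pi ^ 4 / 5 := by
  have h1 := Real.Gamma_mul_Gamma_one_sub (1 / 5)
  have h2 := Real.Gamma_mul_Gamma_one_sub (2 / 5)
  rw [show (1 : ℝ) - 1 / 5 = 4 / 5 by norm_num, show Real.pi * (1 / 5) = Real.pi / 5 by ring] at h1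
  rw [show (1 : ℝ) - 2 / 5 = 3 / 5 by norm_num,
    show Real.pi * (2 / 5) = 2 * (Real.pi / 5) by ring, Real.sin_two_mul] at h2
  have hs : (√5 : ℝ) ^ 2 = 5 := Real.sq_sqrt (by norm_num)
  have hc := Real.cos_pi_div_five
  have hsq : Real.sin (Real.pi / 5) ^ 2 * (2 * Real.sin (Real.pi / 5) * Real.cos (Real.pi / 5)) ^ 2 =
      5 / 16 := by
    rw [show Real.sin (Real.pi / 5) ^ 2 * (2 * Real.sin (Real.pi / 5) * Real.cos (Real.pi / 5)) ^ 2 =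
      4 * (Real.sin (Real.pi / 5) ^ 2) ^ 2 * Real.cos (Real.pi / 5) ^ 2 by ring, Real.sin_sq, hc]
    grind
  rw [show (Real.Gamma (1 / 5) * Real.Gamma (2 / 5) * Real.Gamma (3 / 5) * Real.Gamma (4 / 5)) ^ 2 =
    (Real.Gamma (1 / 5) * Real.Gamma (4 / 5)) ^ 2 * (Real.Gamma (2 / 5) * Real.Gamma (3 / 5)) ^ 2
    by ring, h1, h2, div_pow, div_pow, div_mul_div_comm, hsq]
  ring

/-- Let `P` be the product of the four Gamma values at the fifths. Up to a rational factor `∏ Γ(1 +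
a_i - a_k)` equals `P / Γ(a_i)`, so only `P²` enters. -/
lemma rowConst_modelX5 (i : Fin 4) : rowConst modelX5 1 i =
    (![16, 16, 32, 96] : Fin 4 → ℝ) i * Real.pi ^ 4 / Real.Gamma (modelX5.a i) ^ 5 := by
  have h := prod_Gamma_fifths_sq
  have hr := fun k => rpow_div_of_pow_eq (x := 1 / (1 / 5 ^ 5)) (y := 5) (by positivity)
    (m := 5) (by norm_num) k (by norm_num)
  have r1 := hr 1
  have r2 := hr 2
  have r3 := hr 3
  have r4 := hr 4
  have s1 : Real.Gamma (6 / 5) = 1 / 5 * Real.Gamma (1 / 5) := by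
    rw [← Real.Gamma_add_one (by norm_num)]; norm_num
  have s2 : Real.Gamma (7 / 5) = 2 / 5 * Real.Gamma (2 / 5) := by
    rw [← Real.Gamma_add_one (by norm_num)]; norm_num
  have s3 : Real.Gamma (8 / 5) = 3 / 5 * Real.Gamma (3 / 5) := by
    rw [← Real.Gamma_add_one (by norm_num)]; norm_num
  have p1 : Real.Gamma (1 / 5) ≠ 0 := (Real.Gamma_pos_of_pos (by norm_num)).ne'
  have p2 : Real.Gamma (2 / 5) ≠ 0 := (Real.Gamma_pos_of_pos (by norm_num)).ne'
  have p3 : Real.Gamma (3 / 5) ≠ 0 := (Real.Gamma_pos_of_pos (by norm_num)).ne'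
  have p4 : Real.Gamma (4 / 5) ≠ 0 := (Real.Gamma_pos_of_pos (by norm_num)).ne'
  push_cast at r1 r2 r3 r4
  have hmu : modelX5.mu = 1 / 5 ^ 5 := rfl
  simp only [rowConst, Fin.prod_univ_four, hmu]
  fin_cases i <;> simp only [modelX5, Fin.zero_eta, Fin.mk_one, Fin.reduceFinMk, Matrix.cons_val]
  · rw [r1]
    norm_num
    generalize Real.Gamma (1 / 5) = x at *
    field_simp
    linear_combination 5 * h
  · rw [r2]
    norm_num
    rw [s1]
    generalize Real.Gamma (2 / 5) = x at *
    field_simp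
    linear_combination 25 * h
  · rw [r3]
    norm_num
    rw [s1, s2]
    generalize Real.Gamma (3 / 5) = x at *
    field_simp
    linear_combination 250 * h
  · rw [r4]
    norm_num
    rw [s1, s2, s3]
    generalize Real.Gamma (4 / 5) = x at *
    field_simp
    linear_combination 3750 * h

lemma matX5_row (i : Fin 4) : matX5 i = ((![16, 16, 32, 96] : Fin 4 → ℂ) i * Real.pi ^ 4 /
    gam (modelX5.a i) ^ 5) • ![-alpha ^ ((i : ℕ) + 1) / (alpha ^ ((i : ℕ) + 1) - 1),
      -alpha ^ ((i : ℕ) + 1) / (alpha ^ ((i : ℕ) + 1) - 1) ^ 2, -1,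
      alpha ^ ((i : ℕ) + 1) * (2 * alpha ^ ((i : ℕ) + 1) + 3) / (1 - alpha ^ ((i : ℕ) + 1)) ^ 3] := by
  ext j
  fin_cases i <;> fin_cases j <;> simp [matX5, modelX5, div_eq_mul_inv] <;> ring

lemma isRow_matX5 (i : Fin 4) : IsRow modelX5 1 (-1) ![0, 0, 0, 0] i (matX5 i) := by
  rw [matX5_row]
  refine isRow_modelX5 i rfl ?_
  rw [rowConst_modelX5, gam]
  push_cast
  congr 2
  fin_cases i <;> simp

end CYPeriods

/-! ### The leading constants of `X_{4,3}`. -/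

namespace CYPeriods

open Filter Topology PowerSeries

lemma Gamma_triplication (s : ℝ) :
    Real.Gamma (1 / 3 + s) * Real.Gamma (2 / 3 + s) * Real.Gamma (1 + s) =
      Real.Gamma (1 / 3) * Real.Gamma (2 / 3) * (3 ^ (-(3 * s)) * Real.Gamma (1 + 3 * s)) := by
  have h := prod_Gamma_div_add (m := 3) (by norm_num) s
  rw [← Complex.ofReal_inj, Real.rpow_def_of_pos (by norm_num)]
  push_cast
  simp only [← Complex.Gamma_ofReal]
  push_cast
  simp only [Finset.prod_range_succ, Finset.prod_range_zero] at h
  push_cast at h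
  norm_num at h ⊢
  rw [h]
  ring_nf

lemma sqrt_three_sq : (√3 : ℝ) ^ 2 = 3 := Real.sq_sqrt (by norm_num)

lemma Gamma_third_mul : Real.Gamma (1 / 3) * Real.Gamma (2 / 3) = 2 * √Real.pi ^ 2 / √3 := by
  have h := Real.Gamma_mul_Gamma_one_sub (1 / 3)
  rw [show (1 : ℝ) - 1 / 3 = 2 / 3 by norm_num, show Real.pi * (1 / 3) = Real.pi / 3 by ring,
    Real.sin_pi_div_three] at h
  rw [h, sqrt_pi_sq]
  field_simp

/-- The fractional powers of two from the duplication formula become powers of the single number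
`2^{1/6}`. -/
lemma two_rpow_sixth (k : ℕ) : (2 : ℝ) ^ (k / 6 : ℝ) = ((2 : ℝ) ^ (1 / 6 : ℝ)) ^ k := by
  have := rpow_div_eq (x := 2) (by norm_num) k 6
  exact_mod_cast this

lemma two_rpow_sixth_cube : ((2 : ℝ) ^ (1 / 6 : ℝ)) ^ 3 = √2 := by
  rw [← two_rpow_sixth, Real.sqrt_eq_rpow]
  norm_num

/-- The values of the Gamma function at the twelfths in terms of those at the thirds. -/
lemma Gamma_twelfths :
    Real.Gamma (1 / 12) * Real.Gamma (7 / 12) =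
      Real.Gamma (1 / 6) * ((2 : ℝ) ^ (1 / 6 : ℝ)) ^ 5 * √Real.pi ∧
    Real.Gamma (5 / 12) * Real.Gamma (11 / 12) =
      Real.Gamma (5 / 6) * (2 : ℝ) ^ (1 / 6 : ℝ) * √Real.pi ∧
    Real.Gamma (1 / 6) * Real.Gamma (2 / 3) =
      Real.Gamma (1 / 3) * ((2 : ℝ) ^ (1 / 6 : ℝ)) ^ 4 * √Real.pi ∧
    Real.Gamma (1 / 3) * Real.Gamma (5 / 6) =
      Real.Gamma (2 / 3) * ((2 : ℝ) ^ (1 / 6 : ℝ)) ^ 2 * √Real.pi := by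
  have h1 := Real.Gamma_mul_Gamma_add_half (1 / 12)
  have h2 := Real.Gamma_mul_Gamma_add_half (5 / 12)
  have h3 := Real.Gamma_mul_Gamma_add_half (1 / 6)
  have h4 := Real.Gamma_mul_Gamma_add_half (1 / 3)
  rw [← two_rpow_sixth 5, ← two_rpow_sixth 4, ← two_rpow_sixth 2]
  push_cast
  norm_num at h1 h2 h3 h4 ⊢
  exact ⟨h1, h2, h3, h4⟩

/-- Triplication at `s = -1/12` and `s = -1/4`, for the exponents `1/4` and `3/4`. -/
lemma Gamma_twelfths_triple :
    Real.Gamma (1 / 4) * Real.Gamma (7 / 12) * Real.Gamma (11 / 12) =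
      2 * √Real.pi ^ 2 / √3 * ((3 : ℝ) ^ (1 / 4 : ℝ) * Real.Gamma (3 / 4)) ∧
    Real.Gamma (1 / 12) * Real.Gamma (5 / 12) * Real.Gamma (3 / 4) =
      2 * √Real.pi ^ 2 / √3 * (((3 : ℝ) ^ (1 / 4 : ℝ)) ^ 3 * Real.Gamma (1 / 4)) := by
  have h1 := Gamma_triplication (-1 / 12)
  have h2 := Gamma_triplication (-1 / 4)
  have h3 := rpow_div_eq (x := 3) (by norm_num) 3 4
  push_cast at h3
  rw [Gamma_third_mul] at h1 h2
  rw [← h3]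
  norm_num at h1 h2 ⊢
  exact ⟨h1, h2⟩

lemma rpow_quarter_1728 (k : ℕ) : (1 / (1 / (2 ^ 6 * 3 ^ 3)) : ℝ) ^ (k / 4 : ℝ) =
    (6 * √2 / (3 : ℝ) ^ (1 / 4 : ℝ)) ^ k := by
  have h3 := rpow_div_eq (x := 3) (by norm_num) 4 4
  have h := rpow_div_of_pow_eq (x := 1 / (1 / (2 ^ 6 * 3 ^ 3))) (m := 4)
    (y := 6 * √2 / (3 : ℝ) ^ (1 / 4 : ℝ)) (by positivity) (by norm_num) k (by
      rw [div_pow, mul_pow, show (√2 : ℝ) ^ 4 = (√2 ^ 2) ^ 2 by ring, sqrt_two_sq]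
      push_cast at h3
      rw [← h3]
      norm_num)
  exact_mod_cast h

lemma rpow_third_1728 (k : ℕ) : (1 / (1 / (2 ^ 6 * 3 ^ 3)) : ℝ) ^ (k / 3 : ℝ) = 12 ^ k := by
  have h := rpow_div_of_pow_eq (x := 1 / (1 / (2 ^ 6 * 3 ^ 3))) (m := 3)
    (y := 12) (by positivity) (by norm_num) k (by norm_num)
  exact_mod_cast h

lemma rowConst_modelX43_zero : rowConst modelX43 1 0 =
    16 * 2 ^ (1 / 2 : ℝ) * Real.pi ^ (9 / 2 : ℝ) / Real.Gamma (1 / 4) ^ 6 := by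
  have hr := rpow_quarter_1728 1
  have h9 := pi_rpow_half 9
  have hx := Gamma_quarter_ne_zero
  have ht := Gamma_twelfths_triple.1
  have hg := Gamma_third_mul
  push_cast at hr h9
  simp only [rowConst, modelX43, Fin.prod_univ_four]
  simp only [Matrix.cons_val]
  rw [hr, h9, ← Real.sqrt_eq_rpow]
  norm_num
  rw [Real.Gamma_one_half_eq]
  rw [Gamma_three_quarters_eq] at ht ⊢
  have h3 : (3 : ℝ) ^ (1 / 4 : ℝ) ≠ 0 := by positivity
  generalize Real.Gamma (1 / 4) = x at *
  generalize (3 : ℝ) ^ (1 / 4 : ℝ) = d at *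
  have hs2 := sqrt_two_sq
  have hs3 := sqrt_three_sq
  have ht3 : (√3 : ℝ) ≠ 0 := by positivity
  generalize √2 = s at *
  generalize √3 = t at *
  field_simp at ht hg ⊢
  grind

lemma Gamma_pos_ne_zero {q : ℝ} (hq : 0 < q) : Real.Gamma q ≠ 0 := (Real.Gamma_pos_of_pos hq).ne'

lemma Gamma_thirteen_twelfths : Real.Gamma (13 / 12) = 1 / 12 * Real.Gamma (1 / 12) := by
  rw [← Real.Gamma_add_one (by norm_num)]
  norm_num

lemma Gamma_seventeen_twelfths : Real.Gamma (17 / 12) = 5 / 12 * Real.Gamma (5 / 12) := by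
  rw [← Real.Gamma_add_one (by norm_num)]
  norm_num

lemma Gamma_four_thirds : Real.Gamma (4 / 3) = 1 / 3 * Real.Gamma (1 / 3) := by
  rw [← Real.Gamma_add_one (by norm_num)]
  norm_num

/-- The Gamma arguments `1 + 1/3 - a_k` are `13/12, 1, 2/3, 7/12`. Duplication handles the twelfths,
and again the pair `1/6, 2/3`. -/
lemma rowConst_modelX43_one : rowConst modelX43 1 1 =
    4 * 2 ^ (2 / 3 : ℝ) * Real.pi ^ (5 / 2 : ℝ) / (Real.Gamma (1 / 6) * Real.Gamma (1 / 3)) := by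
  have hr := rpow_third_1728 1
  have h5 := pi_rpow_half 5
  have h4 := two_rpow_sixth 4
  obtain ⟨ha, -, hb, -⟩ := Gamma_twelfths
  have hg := Gamma_third_mul
  have hq := Gamma_three_quarters_eq
  have hc := two_rpow_sixth_cube
  have hs2 := sqrt_two_sq
  have hs3 := sqrt_three_sq
  have hs : (√2 : ℝ) ≠ 0 := by positivity
  have ht : (√3 : ℝ) ≠ 0 := by positivity
  have hp : √Real.pi ≠ 0 := by positivity
  have hx := Gamma_quarter_ne_zero
  have hx6 := Gamma_pos_ne_zero (q := 1 / 6) (by norm_num)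
  have hx3 := Gamma_pos_ne_zero (q := 1 / 3) (by norm_num)
  push_cast at hr h5 h4
  rw [show (4 / 6 : ℝ) = 2 / 3 by norm_num] at h4
  simp only [rowConst, modelX43, Fin.prod_univ_four]
  simp only [Matrix.cons_val]
  rw [hr, h5, h4]
  norm_num
  rw [Gamma_thirteen_twelfths, hq]
  clear hr h4 h5 hq
  generalize (2 : ℝ) ^ (1 / 6 : ℝ) = c at *
  generalize Real.Gamma (1 / 4) = x at *
  generalize Real.Gamma (1 / 3) = y at *
  generalize Real.Gamma (2 / 3) = z at *
  generalize Real.Gamma (1 / 6) = w at *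
  generalize √2 = s at *
  generalize √3 = t at *
  generalize √Real.pi = p at *
  field_simp at hg ⊢
  linear_combination z ^ 2 * s * w * ha + s * c ^ 5 * p * (w * z + y * c ^ 4 * p) * hb +
    y ^ 2 * p ^ 3 * c ^ 4 * (s * (c ^ 6 + c ^ 3 * s + s ^ 2) * hc + (s ^ 2 + 2) * hs2)

/-- Here the arguments are `17/12, 4/3, 1, 11/12`; duplication leads to `Γ(5/6)`, and a second
duplication eliminates it. -/
lemma rowConst_modelX43_two : rowConst modelX43 1 2 =
    80 * Real.pi ^ 3 / (3 ^ (1 / 2 : ℝ) * Real.Gamma (2 / 3) ^ 3) := by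
  have hr := rpow_third_1728 2
  obtain ⟨-, ha, -, hb⟩ := Gamma_twelfths
  have hg := Gamma_third_mul
  have hq := Gamma_three_quarters_eq
  have hc := two_rpow_sixth_cube
  have hs2 := sqrt_two_sq
  have hs3 := sqrt_three_sq
  have hs : (√2 : ℝ) ≠ 0 := by positivity
  have ht : (√3 : ℝ) ≠ 0 := by positivity
  have hp : √Real.pi ≠ 0 := by positivity
  have hx := Gamma_quarter_ne_zero
  have hx3 := Gamma_pos_ne_zero (q := 2 / 3) (by norm_num)
  push_cast at hr
  simp only [rowConst, modelX43, Fin.prod_univ_four]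
  simp only [Matrix.cons_val]
  rw [hr, ← Real.sqrt_eq_rpow]
  norm_num
  rw [Gamma_seventeen_twelfths, Gamma_four_thirds, hq, ← sqrt_pi_sq]
  clear hr hq
  rw [Real.sqrt_sq (Real.sqrt_nonneg _)]
  generalize (2 : ℝ) ^ (1 / 6 : ℝ) = c at *
  generalize Real.Gamma (1 / 4) = x at *
  generalize Real.Gamma (1 / 3) = y at *
  generalize Real.Gamma (2 / 3) = z at *
  generalize √2 = s at *
  generalize √3 = t at *
  generalize √Real.pi = p at *
  field_simp at hg ⊢
  linear_combination 720 * y ^ 2 * t * s * ha + 720 * y * t * s * c * p * hb +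
    720 * s * c ^ 3 * p ^ 2 * hg + 1440 * s * p ^ 4 * hc + 1440 * p ^ 4 * hs2

lemma rowConst_modelX43_three : rowConst modelX43 1 3 =
    20 * 2 ^ (1 / 2 : ℝ) * Real.pi ^ (9 / 2 : ℝ) / Real.Gamma (3 / 4) ^ 6 := by
  have hr := rpow_quarter_1728 3
  have h9 := pi_rpow_half 9
  have hx := Gamma_three_quarters_ne_zero
  have ht := Gamma_twelfths_triple.2
  have hg := Gamma_third_mul
  push_cast at hr h9
  simp only [rowConst, modelX43, Fin.prod_univ_four]
  simp only [Matrix.cons_val]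
  rw [hr, h9, ← Real.sqrt_eq_rpow]
  norm_num
  rw [Gamma_three_halves, Gamma_thirteen_twelfths, Gamma_seventeen_twelfths]
  rw [Gamma_quarter_eq] at ht ⊢
  have h3 : (3 : ℝ) ^ (1 / 4 : ℝ) ≠ 0 := by positivity
  clear hr h9
  generalize Real.Gamma (3 / 4) = x at *
  generalize (3 : ℝ) ^ (1 / 4 : ℝ) = d at *
  have hs2 := sqrt_two_sq
  have hs3 := sqrt_three_sq
  have ht3 : (√3 : ℝ) ≠ 0 := by positivity
  generalize √2 = s at *
  generalize √3 = t at *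
  generalize √Real.pi = p at *
  field_simp at ht hg ⊢
  grind

end CYPeriods

/-! ### The rows of `X_{4,3}`. -/

namespace CYPeriods

open Filter Topology PowerSeries

lemma exp_wt_third : Complex.exp (wt 1 * (1 / 3)) = (-1 + √3 * Complex.I) / 2 := by
  rw [show wt 1 * (1 / 3) = ((Real.pi - Real.pi / 3 : ℝ) : ℂ) * Complex.I by
    rw [wt]; push_cast; ring, Complex.exp_mul_I, ← Complex.ofReal_cos, ← Complex.ofReal_sin,
    Real.cos_pi_sub, Real.sin_pi_sub, Real.cos_pi_div_three, Real.sin_pi_div_three]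
  push_cast
  ring

lemma ofReal_sqrt_three_sq : ((√3 : ℝ) : ℂ) ^ 2 = 3 := by exact_mod_cast sqrt_three_sq

lemma exp_wt_two_thirds : Complex.exp (wt 1 * (2 / 3)) = (-1 - √3 * Complex.I) / 2 := by
  rw [show wt 1 * (2 / 3) = wt 1 * (1 / 3) + wt 1 * (1 / 3) by ring, Complex.exp_add, exp_wt_third]
  linear_combination (√3 : ℂ) ^ 2 / 4 * Complex.I_sq - 1 / 4 * ofReal_sqrt_three_sq

lemma exp_wt_modelX43 (k : Fin 4) : Complex.exp (wt 1 * modelX43.a k) =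
    (![Complex.I, (-1 + √3 * Complex.I) / 2, (-1 - √3 * Complex.I) / 2, -Complex.I] :
      Fin 4 → ℂ) k := by
  have h1 := exp_wt_quarter
  have h2 := exp_wt_third
  have h3 := exp_wt_two_thirds
  have h4 := exp_wt_three_quarters
  fin_cases k <;> simp [modelX43] at h1 h2 h3 h4 ⊢ <;> assumption

lemma prod_modelX43 (u : ℂ) :
    ∏ k, (Complex.exp (wt 1 * modelX43.a k) * u - 1) = (u ^ 2 + 1) * (u ^ 2 + u + 1) := by
  have h1 := Complex.I_sq
  have h2 := ofReal_sqrt_three_sq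
  simp only [exp_wt_modelX43, Fin.prod_univ_four]
  simp
  generalize ((√3 : ℝ) : ℂ) = t at *
  generalize Complex.I = I at *
  grind

lemma isRow_modelX43_zero : IsRow modelX43 1 1 ![0, 0, 0, 0] 0 (matX43 0) := by
  have hI := Complex.I_sq
  rw [show matX43 0 = (16 * rpw 2 (1 / 2) * rpw Real.pi (9 / 2) / gam (1 / 4) ^ 6) •
      ![(1 + Complex.I) / 2, 1 / 2, -1, -(3 * Complex.I) / 2] by
    ext j
    fin_cases j <;> simp [matX43] <;> ring]
  refine regular_modelX43.isRow_zero rfl ?_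
    (q := fun u => -(Complex.I * u + 1) * (u ^ 2 + u + 1)) ?_ ?_
  · rw [rowConst_modelX43_zero, rpw, rpw, gam]
    push_cast
    rfl
  · intro u
    rw [prod_modelX43, exp_wt_modelX43]
    simp
    linear_combination (u ^ 2 + u + 1) * u ^ 2 * hI
  · intro u
    simp [rowPoly, sigma, modelX43]
    ring

lemma isRow_modelX43_one : IsRow modelX43 1 1 ![0, 0, 0, 0] 1 (matX43 1) := by
  have hI := Complex.I_sq
  have h3 := ofReal_sqrt_three_sq
  have hi : ((√3 : ℝ) : ℂ)⁻¹ = √3 / 3 := inv_eq_of_mul_eq_one_right (by linear_combination h3 / 3)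
  have hn : negOnePow (1 / 6) = (√3 + Complex.I) / 2 := by
    rw [negOnePow_eq, show Real.pi * (1 / 6) = Real.pi / 6 by ring, Real.cos_pi_div_six,
      Real.sin_pi_div_six]
    push_cast
    ring
  rw [show matX43 1 = (4 * rpw 2 (2 / 3) * rpw Real.pi (5 / 2) / (gam (1 / 6) * gam (1 / 3))) •
      ![(√3 + Complex.I) * √3 / 6, 1 / 3, -1, -Complex.I * √3 / 3] by
    have hr : rpw 3 (1 / 2) = √3 := by rw [rpw, ← Real.sqrt_eq_rpow]
    rw [matX43, hn, hr]
    ext j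
    fin_cases j <;> simp [div_eq_mul_inv, hi] <;> ring]
  refine regular_modelX43.isRow_zero rfl ?_
    (q := fun u => (u ^ 2 + 1) * ((-1 - √3 * Complex.I) / 2 * u - 1)) ?_ ?_
  · rw [rowConst_modelX43_one, rpw, rpw, gam, gam]
    push_cast
    rfl
  · intro u
    rw [prod_modelX43, exp_wt_modelX43]
    simp
    generalize ((√3 : ℝ) : ℂ) = t at *
    generalize Complex.I = I at *
    grind
  · intro u
    simp [rowPoly, sigma, modelX43]
    generalize ((√3 : ℝ) : ℂ) = t at *
    generalize Complex.I = I at *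
    grind

lemma isRow_modelX43_two : IsRow modelX43 1 1 ![0, 0, 0, 0] 2 (matX43 2) := by
  have hI := Complex.I_sq
  have h3 := ofReal_sqrt_three_sq
  have hi : ((√3 : ℝ) : ℂ)⁻¹ = √3 / 3 := inv_eq_of_mul_eq_one_right (by linear_combination h3 / 3)
  have hr : rpw 3 (1 / 2) = √3 := by rw [rpw, ← Real.sqrt_eq_rpow]
  have hn : negOnePow (5 / 6) = (-√3 + Complex.I) / 2 := by
    rw [negOnePow_eq, show Real.pi * (5 / 6) = Real.pi - Real.pi / 6 by ring, Real.cos_pi_sub,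
      Real.sin_pi_sub, Real.cos_pi_div_six, Real.sin_pi_div_six]
    push_cast
    ring
  rw [show matX43 2 = (80 * Real.pi ^ 3 / (rpw 3 (1 / 2) * gam (2 / 3) ^ 3)) •
      ![(√3 - Complex.I) * √3 / 6, 1 / 3, -1, Complex.I * √3 / 3] by
    rw [matX43, hn, hr]
    ext j
    fin_cases j <;> simp [div_eq_mul_inv, hi]
    · linear_combination 40 / 9 * Real.pi ^ 3 * (gam (2 * 3⁻¹))⁻¹ ^ 3 * (Complex.I - √3) * h3
    · ring
    · linear_combination (-80 / 9) * Complex.I * Real.pi ^ 3 * (gam (2 * 3⁻¹))⁻¹ ^ 3 * h3]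
  refine regular_modelX43.isRow_zero rfl ?_
    (q := fun u => (u ^ 2 + 1) * ((-1 + √3 * Complex.I) / 2 * u - 1)) ?_ ?_
  · rw [rowConst_modelX43_two, rpw, gam]
    push_cast
    rfl
  · intro u
    rw [prod_modelX43, exp_wt_modelX43]
    simp
    generalize ((√3 : ℝ) : ℂ) = t at *
    generalize Complex.I = I at *
    grind
  · intro u
    simp [rowPoly, sigma, modelX43]
    generalize ((√3 : ℝ) : ℂ) = t at *
    generalize Complex.I = I at *
    grind

lemma isRow_modelX43_three : IsRow modelX43 1 1 ![0, 0, 0, 0] 3 (matX43 3) := by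
  have hI := Complex.I_sq
  rw [show matX43 3 = (20 * rpw 2 (1 / 2) * rpw Real.pi (9 / 2) / gam (3 / 4) ^ 6) •
      ![(1 - Complex.I) / 2, 1 / 2, -1, 3 * Complex.I / 2] by
    ext j
    fin_cases j <;> simp [matX43] <;> ring]
  refine regular_modelX43.isRow_zero rfl ?_
    (q := fun u => (Complex.I * u - 1) * (u ^ 2 + u + 1)) ?_ ?_
  · rw [rowConst_modelX43_three, rpw, rpw, gam]
    push_cast
    rfl
  · intro u
    rw [prod_modelX43, exp_wt_modelX43]
    simp
    linear_combination (u ^ 2 + u + 1) * u ^ 2 * hI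
  · intro u
    simp [rowPoly, sigma, modelX43]
    ring

end CYPeriods

/-! ### Existence of the basis at infinity, and the theorem. -/

namespace CYPeriods

lemma Regular.exists_isBasisAtInfinity {M : Model} {lam : ℝ} {n : Fin 4 → ℕ}
    (hM : Regular M lam n) : ∃ B, IsBasisAtInfinity M lam n B :=
  ⟨fun i z => logSeries (M.a i) (frobSeries (fun k => -M.a k) 0 (lam / M.mu) (M.a i)) (n i)
    (lam / z), hM.isBasisAtInfinity fun _ _ _ _ => rfl⟩

end CYPeriods

theorem mainTheorem6 :
    -- the mirror quintic, in the coordinate `w = 1 / z`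
    ((∃ B₀, CYPeriods.IsBasisAtZero CYPeriods.modelX5 B₀) ∧
      CYPeriods.IsBasisAtInfinity CYPeriods.modelX5 1 ![0, 0, 0, 0] CYPeriods.omega ∧
      ∀ B₀, CYPeriods.IsBasisAtZero CYPeriods.modelX5 B₀ →
        CYPeriods.HasInverseTransitionMatrix CYPeriods.modelX5 CYPeriods.lowerHalf B₀
          CYPeriods.omega ((CYPeriods.twoPiI ^ 3)⁻¹ • CYPeriods.matX5)) ∧
    -- `X_{4,3}`, in the coordinate `x = 1 / z`
    ((∃ B₀, CYPeriods.IsBasisAtZero CYPeriods.modelX43 B₀) ∧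
      (∃ B, CYPeriods.IsBasisAtInfinity CYPeriods.modelX43 1 ![0, 0, 0, 0] B) ∧
      ∀ B₀ B, CYPeriods.IsBasisAtZero CYPeriods.modelX43 B₀ →
        CYPeriods.IsBasisAtInfinity CYPeriods.modelX43 1 ![0, 0, 0, 0] B →
        CYPeriods.HasInverseTransitionMatrix CYPeriods.modelX43 CYPeriods.upperHalf B₀ B
          ((CYPeriods.twoPiI ^ 3)⁻¹ • CYPeriods.matX43)) ∧
    -- `X_{4,2}`, in the coordinate `x = 1 / (2 ^ 12 z)`
    ((∃ B₀, CYPeriods.IsBasisAtZero CYPeriods.modelX42 B₀) ∧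
      (∃ B, CYPeriods.IsBasisAtInfinity CYPeriods.modelX42 (1 / 2 ^ 12) ![0, 0, 1, 0] B) ∧
      ∀ B₀ B, CYPeriods.IsBasisAtZero CYPeriods.modelX42 B₀ →
        CYPeriods.IsBasisAtInfinity CYPeriods.modelX42 (1 / 2 ^ 12) ![0, 0, 1, 0] B →
        CYPeriods.HasInverseTransitionMatrix CYPeriods.modelX42 CYPeriods.upperHalf B₀ B
          ((CYPeriods.twoPiI ^ 3)⁻¹ • CYPeriods.matX42)) ∧
    -- `X_{4,4}`, in the coordinate `x = 1 / (2 ^ 20 z)`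
    ((∃ B₀, CYPeriods.IsBasisAtZero CYPeriods.modelX44 B₀) ∧
      (∃ B, CYPeriods.IsBasisAtInfinity CYPeriods.modelX44 (1 / 2 ^ 20) ![0, 1, 0, 1] B) ∧
      ∀ B₀ B, CYPeriods.IsBasisAtZero CYPeriods.modelX44 B₀ →
        CYPeriods.IsBasisAtInfinity CYPeriods.modelX44 (1 / 2 ^ 20) ![0, 1, 0, 1] B →
        CYPeriods.HasInverseTransitionMatrix CYPeriods.modelX44 CYPeriods.upperHalf B₀ B
          ((CYPeriods.twoPiI ^ 3)⁻¹ • CYPeriods.matX44)) ∧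
    -- `X_{2,2,2,2}`, in the coordinate `x = 1 / (2 ^ 16 z)`
    ((∃ B₀, CYPeriods.IsBasisAtZero CYPeriods.modelX2222 B₀) ∧
      (∃ B, CYPeriods.IsBasisAtInfinity CYPeriods.modelX2222 (1 / 2 ^ 16) ![0, 1, 2, 3] B) ∧
      ∀ B₀ B, CYPeriods.IsBasisAtZero CYPeriods.modelX2222 B₀ →
        CYPeriods.IsBasisAtInfinity CYPeriods.modelX2222 (1 / 2 ^ 16) ![0, 1, 2, 3] B →
        CYPeriods.HasInverseTransitionMatrix CYPeriods.modelX2222 CYPeriods.upperHalf B₀ B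
          ((CYPeriods.twoPiI ^ 3)⁻¹ • CYPeriods.matX2222)) := by
  -- The two half-planes are the cases `ε = 1` and `ε = -1` of the common form `0 < ε Im z`.
  have hup : CYPeriods.upperHalf = {z | 0 < (1 : ℝ) * z.im} := by
    simp [CYPeriods.upperHalf]
  have hlow : CYPeriods.lowerHalf = {z | 0 < (-1 : ℝ) * z.im} := by
    simp [CYPeriods.lowerHalf]
  refine ⟨⟨CYPeriods.regular_modelX5.exists_isBasisAtZero, CYPeriods.isBasisAtInfinity_omega,
    fun B₀ hB₀ => ?_⟩, ⟨CYPeriods.regular_modelX43.exists_isBasisAtZero,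
    CYPeriods.regular_modelX43.exists_isBasisAtInfinity, fun B₀ B hB₀ hB => ?_⟩,
    ⟨CYPeriods.regular_modelX42.exists_isBasisAtZero,
    CYPeriods.regular_modelX42.exists_isBasisAtInfinity, fun B₀ B hB₀ hB => ?_⟩,
    ⟨CYPeriods.regular_modelX44.exists_isBasisAtZero,
    CYPeriods.regular_modelX44.exists_isBasisAtInfinity, fun B₀ B hB₀ hB => ?_⟩,
    ⟨CYPeriods.regular_modelX2222.exists_isBasisAtZero,
    CYPeriods.regular_modelX2222.exists_isBasisAtInfinity, fun B₀ B hB₀ hB => ?_⟩⟩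
  · rw [hlow]
    exact CYPeriods.regular_modelX5.hasInverseTransitionMatrix (.inr rfl)
      CYPeriods.gammaClass_modelX5 CYPeriods.isRow_matX5 hB₀ CYPeriods.isBasisAtInfinity_omega
  · rw [hup]
    refine CYPeriods.regular_modelX43.hasInverseTransitionMatrix (.inl rfl)
      CYPeriods.gammaClass_modelX43 (fun i => ?_) hB₀ hB
    fin_cases i
    exacts [CYPeriods.isRow_modelX43_zero, CYPeriods.isRow_modelX43_one,
      CYPeriods.isRow_modelX43_two, CYPeriods.isRow_modelX43_three]
  · rw [hup]
    refine CYPeriods.regular_modelX42.hasInverseTransitionMatrix (.inl rfl)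
      CYPeriods.gammaClass_modelX42 (fun i => ?_) hB₀ hB
    fin_cases i
    exacts [CYPeriods.isRow_modelX42_zero, CYPeriods.isRow_modelX42_one,
      CYPeriods.isRow_modelX42_two, CYPeriods.isRow_modelX42_three]
  · rw [hup]
    refine CYPeriods.regular_modelX44.hasInverseTransitionMatrix (.inl rfl)
      CYPeriods.gammaClass_modelX44 (fun i => ?_) hB₀ hB
    fin_cases i
    exacts [CYPeriods.isRow_modelX44_zero, CYPeriods.isRow_modelX44_one,
      CYPeriods.isRow_modelX44_two, CYPeriods.isRow_modelX44_three]
  · rw [hup]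
    exact CYPeriods.regular_modelX2222.hasInverseTransitionMatrix (.inl rfl)
      CYPeriods.gammaClass_modelX2222 CYPeriods.isRow_modelX2222 hB₀ hB
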